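/- **Theorem (MaxWeightRCH).** For $p\in\mathbb{R}^2$ let $Q_1(p),\dots,Q_4(p)$ be the four open axis-parallel quadrants with apex $p$. For a set $S\subset\mathbb{R}^2$ put $M_i(S)=\bigcup_{p\in S}\overline{Q_i(p)}$, and let $RCH(S)=\bigcap_{i=1}^{4}M_i(S)$ be its rectilinear convex hull (so $RCH(\emptyset)=\emptyset$). The following problem can be solved in $O(n^3)$ time and $O(n^2)$ space on a real RAM. Given a set $P$ of $n$ points in the plane, no two of which share an $x$-coordinate or a $y$-coordinate, and a real (positive or negative) weight $w(p)$ for each $p\in P$, find a subset $S\subseteq P$ that maximizes $$\sum_{p\in P\cap RCH(S)}w(p)$$ over all subsets of $P$. More precisely, there are a single real-RAM program and a constant $C$ such that for every $n\ge 0$ and every such input, with the points listed in arbitrary order, the program stops after at most $C(n^3+1)$ steps, uses at most $C(n^2+1)$ memory cells, and outputs such a subset $S$. A memory cell holds a real number or a natural number. Every operation costs one step. All natural numbers computed are at most $C(n^2+1)$, and on real numbers the program uses only the constant $0$, addition, subtraction and comparison. -/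

import Mathlib

noncomputable section

/-! ### Rectilinear convex hulls -/

/-- The open axis-parallel quadrants with apex `p`; the indices `0, 1, 2, 3` stand for
`Q₁(p), Q₂(p), Q₃(p), Q₄(p)`. -/
def quadrant : Fin 4 → ℝ × ℝ → Set (ℝ × ℝ)
  | 0, p => {q | p.1 < q.1 ∧ p.2 < q.2}
  | 1, p => {q | q.1 < p.1 ∧ p.2 < q.2}
  | 2, p => {q | q.1 < p.1 ∧ q.2 < p.2}
  | 3, p => {q | p.1 < q.1 ∧ q.2 < p.2}

/-- `M_i(S)`: the union of the closed `i`-th quadrants at the points of `S`. -/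
def quadrantUnion (i : Fin 4) (S : Set (ℝ × ℝ)) : Set (ℝ × ℝ) :=
  ⋃ p ∈ S, closure (quadrant i p)

/-- The rectilinear convex hull of `S`. -/
def rch (S : Set (ℝ × ℝ)) : Set (ℝ × ℝ) :=
  ⋂ i : Fin 4, quadrantUnion i S

open scoped Classical in
/-- The total weight of the points `pts i` that lie in the region `Z`. -/
def regionWeight {n : ℕ} (pts : Fin n → ℝ × ℝ) (w : Fin n → ℝ) (Z : Set (ℝ × ℝ)) : ℝ :=
  ∑ i : Fin n with pts i ∈ Z, w i

/-- General position: no two of the points share an `x`-coordinate or a `y`-coordinate. -/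
def GeneralPosition {n : ℕ} (pts : Fin n → ℝ × ℝ) : Prop :=
  Function.Injective (fun i => (pts i).1) ∧ Function.Injective (fun i => (pts i).2)

/-- `S` is an optimal solution of MaxWeightRCH for the point set `P = range pts`. -/
def IsMaxWeightRCH {n : ℕ} (pts : Fin n → ℝ × ℝ) (w : Fin n → ℝ) (S : Set (ℝ × ℝ)) : Prop :=
  S ⊆ Set.range pts ∧
    ∀ S' ⊆ Set.range pts, regionWeight pts w (rch S') ≤ regionWeight pts w (rch S)

/-! ### A real RAM

Programs are finite imperative programs over two kinds of data: natural numbers (used as counters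
and array indices) and real numbers (stored exactly). A program `Cmd k` has, of each of the two
kinds, `k` scalar variables and `k` arrays. On a machine with parameter `M` each array has `M`
cells and every natural number that is ever computed has to be at most `M`, so that, when `M` is
polynomial in the input size, naturals fit in words of logarithmic length. Naturals and reals
cannot be converted into each other; on reals only `0`, addition, subtraction and comparison are
available (a subset of the operations of the usual real RAM). Each operation costs one step.

The input is read-only: the number `n` of points and, for each index `i < n`, the two coordinates
and the weight of the point number `i`, in arbitrary order. The output is the set of the indices
that the program has marked. -/

namespace RealRAM

/-- The input: `n` weighted points in the plane. -/
structure Input where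
  n : ℕ
  pts : Fin n → ℝ × ℝ
  w : Fin n → ℝ

/-- Reading an input array at a natural index (the value beyond the end is never used, since such
an access is not safe). -/
def Input.read (I : Input) (f : Fin I.n → ℝ) (i : ℕ) : ℝ :=
  if h : i < I.n then f ⟨i, h⟩ else 0

/-- The contents of the memory, and the set of marked indices. -/
structure Store (k : ℕ) where
  nvar : Fin k → ℕ
  rvar : Fin k → ℝ
  narr : Fin k → ℕ → ℕ
  rarr : Fin k → ℕ → ℝ
  marked : Finset ℕ

/-- At the start the whole memory is zero and nothing is marked. -/
def Store.initial (k : ℕ) : Store k where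
  nvar := fun _ => 0
  rvar := fun _ => 0
  narr := fun _ _ => 0
  rarr := fun _ _ => 0
  marked := ∅

/-- Expressions for natural numbers; `size` is the number of input points. -/
inductive NExpr (k : ℕ) : Type
  | const (c : ℕ)
  | size
  | var (v : Fin k)
  | load (a : Fin k) (i : NExpr k)
  | add (e f : NExpr k)
  | sub (e f : NExpr k)
  | mul (e f : NExpr k)

/-- Expressions for real numbers; `inputX i`, `inputY i`, `inputW i` read the coordinates and the
weight of the input point number `i`. -/
inductive RExpr (k : ℕ) : Type
  | zero
  | var (v : Fin k)
  | load (a : Fin k) (i : NExpr k)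
  | inputX (i : NExpr k)
  | inputY (i : NExpr k)
  | inputW (i : NExpr k)
  | add (e f : RExpr k)
  | sub (e f : RExpr k)

/-- Tests. -/
inductive Test (k : ℕ) : Type
  | natLt (e f : NExpr k)
  | natEq (e f : NExpr k)
  | realLt (e f : RExpr k)
  | not (b : Test k)
  | and (b c : Test k)

/-- Programs. -/
inductive Cmd (k : ℕ) : Type
  | skip
  | nset (v : Fin k) (e : NExpr k)
  | rset (v : Fin k) (e : RExpr k)
  | nstore (a : Fin k) (i e : NExpr k)
  | rstore (a : Fin k) (i : NExpr k) (e : RExpr k)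
  | mark (i : NExpr k)
  | seq (c d : Cmd k)
  | cond (b : Test k) (c d : Cmd k)
  | loop (b : Test k) (c : Cmd k)

variable {k : ℕ}

/-- The value of an expression (truncated subtraction). -/
def NExpr.eval (I : Input) (σ : Store k) : NExpr k → ℕ
  | .const c => c
  | .size => I.n
  | .var v => σ.nvar v
  | .load a i => σ.narr a (i.eval I σ)
  | .add e f => e.eval I σ + f.eval I σ
  | .sub e f => e.eval I σ - f.eval I σ
  | .mul e f => e.eval I σ * f.eval I σ

/-- The evaluation stays within the memory and within the bound on natural numbers. -/
def NExpr.Safe (M : ℕ) (I : Input) (σ : Store k) : NExpr k → Prop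
  | .const c => c ≤ M
  | .size => I.n ≤ M
  | .var _ => True
  | .load _ i => i.Safe M I σ ∧ i.eval I σ < M
  | .add e f => e.Safe M I σ ∧ f.Safe M I σ ∧ e.eval I σ + f.eval I σ ≤ M
  | .sub e f => e.Safe M I σ ∧ f.Safe M I σ
  | .mul e f => e.Safe M I σ ∧ f.Safe M I σ ∧ e.eval I σ * f.eval I σ ≤ M

/-- The number of steps of an evaluation. -/
def NExpr.cost : NExpr k → ℕ
  | .const _ => 1
  | .size => 1
  | .var _ => 1
  | .load _ i => i.cost + 1
  | .add e f => e.cost + f.cost + 1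
  | .sub e f => e.cost + f.cost + 1
  | .mul e f => e.cost + f.cost + 1

def RExpr.eval (I : Input) (σ : Store k) : RExpr k → ℝ
  | .zero => 0
  | .var v => σ.rvar v
  | .load a i => σ.rarr a (i.eval I σ)
  | .inputX i => I.read (fun j => (I.pts j).1) (i.eval I σ)
  | .inputY i => I.read (fun j => (I.pts j).2) (i.eval I σ)
  | .inputW i => I.read I.w (i.eval I σ)
  | .add e f => e.eval I σ + f.eval I σ
  | .sub e f => e.eval I σ - f.eval I σ

def RExpr.Safe (M : ℕ) (I : Input) (σ : Store k) : RExpr k → Prop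
  | .zero => True
  | .var _ => True
  | .load _ i => i.Safe M I σ ∧ i.eval I σ < M
  | .inputX i => i.Safe M I σ ∧ i.eval I σ < I.n
  | .inputY i => i.Safe M I σ ∧ i.eval I σ < I.n
  | .inputW i => i.Safe M I σ ∧ i.eval I σ < I.n
  | .add e f => e.Safe M I σ ∧ f.Safe M I σ
  | .sub e f => e.Safe M I σ ∧ f.Safe M I σ

def RExpr.cost : RExpr k → ℕ
  | .zero => 1
  | .var _ => 1
  | .load _ i => i.cost + 1
  | .inputX i => i.cost + 1
  | .inputY i => i.cost + 1
  | .inputW i => i.cost + 1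
  | .add e f => e.cost + f.cost + 1
  | .sub e f => e.cost + f.cost + 1

/-- The test succeeds. -/
def Test.Holds (I : Input) (σ : Store k) : Test k → Prop
  | .natLt e f => e.eval I σ < f.eval I σ
  | .natEq e f => e.eval I σ = f.eval I σ
  | .realLt e f => e.eval I σ < f.eval I σ
  | .not b => ¬ b.Holds I σ
  | .and b c => b.Holds I σ ∧ c.Holds I σ

/-- A conjunction is evaluated from left to right, and its second part only if the first holds. -/
def Test.Safe (M : ℕ) (I : Input) (σ : Store k) : Test k → Prop
  | .natLt e f => e.Safe M I σ ∧ f.Safe M I σ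
  | .natEq e f => e.Safe M I σ ∧ f.Safe M I σ
  | .realLt e f => e.Safe M I σ ∧ f.Safe M I σ
  | .not b => b.Safe M I σ
  | .and b c => b.Safe M I σ ∧ (b.Holds I σ → c.Safe M I σ)

def Test.cost : Test k → ℕ
  | .natLt e f => e.cost + f.cost + 1
  | .natEq e f => e.cost + f.cost + 1
  | .realLt e f => e.cost + f.cost + 1
  | .not b => b.cost + 1
  | .and b c => b.cost + c.cost + 1

/-- `Run M I c σ t σ'`: on the machine with parameter `M` and on the input `I`, the program `c`,
started with memory contents `σ`, stops after exactly `t` steps with memory contents `σ'`. There is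
no such run if `c` does not stop, or leaves its memory, or computes a natural number above `M`. -/
inductive Run (M : ℕ) (I : Input) : Cmd k → Store k → ℕ → Store k → Prop
  | skip (σ : Store k) : Run M I .skip σ 1 σ
  | nset (σ : Store k) (v : Fin k) (e : NExpr k) (he : e.Safe M I σ) :
      Run M I (.nset v e) σ (e.cost + 1)
        { σ with nvar := Function.update σ.nvar v (e.eval I σ) }
  | rset (σ : Store k) (v : Fin k) (e : RExpr k) (he : e.Safe M I σ) :
      Run M I (.rset v e) σ (e.cost + 1)
        { σ with rvar := Function.update σ.rvar v (e.eval I σ) }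
  | nstore (σ : Store k) (a : Fin k) (i e : NExpr k) (hi : i.Safe M I σ) (hM : i.eval I σ < M)
      (he : e.Safe M I σ) :
      Run M I (.nstore a i e) σ (i.cost + e.cost + 1)
        { σ with narr := Function.update σ.narr a
                  (Function.update (σ.narr a) (i.eval I σ) (e.eval I σ)) }
  | rstore (σ : Store k) (a : Fin k) (i : NExpr k) (e : RExpr k) (hi : i.Safe M I σ)
      (hM : i.eval I σ < M) (he : e.Safe M I σ) :
      Run M I (.rstore a i e) σ (i.cost + e.cost + 1)
        { σ with rarr := Function.update σ.rarr a
                  (Function.update (σ.rarr a) (i.eval I σ) (e.eval I σ)) }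
  | mark (σ : Store k) (i : NExpr k) (hi : i.Safe M I σ) (hn : i.eval I σ < I.n) :
      Run M I (.mark i) σ (i.cost + 1)
        { σ with marked := insert (i.eval I σ) σ.marked }
  | seq {σ σ' σ'' : Store k} {c d : Cmd k} {s t : ℕ} (hc : Run M I c σ s σ')
      (hd : Run M I d σ' t σ'') : Run M I (.seq c d) σ (s + t) σ''
  | cond_true {σ σ' : Store k} {b : Test k} {c d : Cmd k} {t : ℕ} (hs : b.Safe M I σ)
      (hb : b.Holds I σ) (hc : Run M I c σ t σ') : Run M I (.cond b c d) σ (b.cost + 1 + t) σ'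
  | cond_false {σ σ' : Store k} {b : Test k} {c d : Cmd k} {t : ℕ} (hs : b.Safe M I σ)
      (hb : ¬ b.Holds I σ) (hd : Run M I d σ t σ') : Run M I (.cond b c d) σ (b.cost + 1 + t) σ'
  | loop_done {σ : Store k} {b : Test k} {c : Cmd k} (hs : b.Safe M I σ) (hb : ¬ b.Holds I σ) :
      Run M I (.loop b c) σ (b.cost + 1) σ
  | loop_step {σ σ' σ'' : Store k} {b : Test k} {c : Cmd k} {s t : ℕ} (hs : b.Safe M I σ)
      (hb : b.Holds I σ) (hc : Run M I c σ s σ') (hl : Run M I (.loop b c) σ' t σ'') :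
      Run M I (.loop b c) σ (b.cost + 1 + s + t) σ''

/-- The number of memory cells of the machine with parameter `M` that runs programs of type `Cmd k`
on `n` points: `k` scalar variables and `k` arrays with `M` cells of either kind, `3 * n + 1` cells
for the input, and `n` cells for the marks. -/
def numCells (k M n : ℕ) : ℕ :=
  2 * (k + k * M) + (3 * n + 1) + n

/-- The points that the program has marked. -/
def Store.output (I : Input) (σ : Store k) : Set (ℝ × ℝ) :=
  {p | ∃ i : Fin I.n, (i : ℕ) ∈ σ.marked ∧ I.pts i = p}

end RealRAM

end

/-! Number the points from left to right and call them columns. A column `q` lies in the hull of `S`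
exactly when each of the four closed quadrants at `q` meets `S` (`mem_rch`), so the weight of the
hull depends only on column numbers and heights (`hull`, `regionWeight_rch`). It is maximized by
dynamic programming over the columns.

Let `b` be the lowest and `t` the highest point of `S`, and suppose that `t` is not to the right of
`b`; the other case is this one reflected at a horizontal line, whence a second run on `Cols.neg`.
Cut at column `b`. For a column right of `b` that satisfies the two right conditions, `b` and `t`
supply the two left ones, so only the points from `b` on matter: read from right to left, they form
a set of the family `KA`. For a column left of `b` the lower right condition follows from the lower
left one by means of `b`, and the right part enters only through its highest point `v`: the upper
right condition becomes "met by the left part, or not above `v`". This is the family `KR`. For fixed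
`b` and `v` the two parts are independent, and the weights add up, except that `w b` is counted
twice (`hull_union`, `hull_join`, `hull_split`).

Both families obey recurrences in the current column `c`. In `KA` the lowest and highest points
decide whether `c` counts, so a column that is not a new extreme need not be selected
(`Best.KA_succ`). In `KR` the lowest point `u` and the announced row `j` decide this in the same
way. Selecting `c` matters only if `c` is a new lowest point (`KR_self`) or is not below row `j`
(`Best.KR_succ`). In the latter case the set belongs to `KB`, which arises from `KR` with `c` as the
announced point, or from `KA` if `c` is the highest point (`KB_of_lt`). `KM` collects the sets above
row `j`, for which the announcement is void (`KM_value`).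

Each column costs a constant for each of O(n²) table entries and O(n) for each of O(n) further
entries, hence cubic time. A list cell is allocated only when a column is selected, for O(n) entries
per column; lists share their tails, so quadratic space suffices.

The algorithm is written in a small language `Prog` with a functional semantics. `Prog.compile_does`
transfers it to the machine with bounds on steps and allocations; what remains is a proof about
`Prog.eval`. -/

namespace RealRAM

variable {k : ℕ}

/-- The command `c`, started from `σ`, stops within `T` steps in a store that satisfies `Q`. -/
def Does (M : ℕ) (I : Input) (c : Cmd k) (σ : Store k) (T : ℕ) (Q : Store k → Prop) : Prop :=
  ∃ t σ', Run M I c σ t σ' ∧ t ≤ T ∧ Q σ'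

/-- A counting loop with loop variable `v`. -/
def Cmd.forTo (v : Fin k) (e : NExpr k) (c : Cmd k) : Cmd k :=
  .seq (.nset v (.const 0)) (.loop (.natLt (.var v) e) (.seq c (.nset v (.add (.var v) (.const 1)))))

namespace Does

variable {M : ℕ} {I : Input} {σ : Store k} {T : ℕ} {Q : Store k → Prop}

theorem mono {c : Cmd k} {T' : ℕ} {Q' : Store k → Prop} (h : Does M I c σ T Q) (hT : T ≤ T')
    (hQ : ∀ σ', Q σ' → Q' σ') : Does M I c σ T' Q' := by
  obtain ⟨t, σ', hr, ht, hq⟩ := h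
  exact ⟨t, σ', hr, ht.trans hT, hQ _ hq⟩

theorem skip (hT : 1 ≤ T) (h : Q σ) : Does M I .skip σ T Q := ⟨_, _, .skip σ, hT, h⟩

/-- The postcondition of the first command is the claim about the second one, so intermediate stores
need not be named. -/
theorem seq {c d : Cmd k} {T₁ T₂ : ℕ} (h : Does M I c σ T₁ fun σ' => Does M I d σ' T₂ Q)
    (hT : T₁ + T₂ ≤ T) : Does M I (.seq c d) σ T Q := by
  obtain ⟨t, σ', hr, ht, t', σ'', hr', ht', hq⟩ := h
  exact ⟨_, _, .seq hr hr', by omega, hq⟩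

theorem nset {v : Fin k} {e : NExpr k} (he : e.Safe M I σ) (hT : e.cost + 1 ≤ T)
    (h : Q { σ with nvar := Function.update σ.nvar v (e.eval I σ) }) :
    Does M I (.nset v e) σ T Q := ⟨_, _, .nset σ v e he, hT, h⟩

theorem rset {v : Fin k} {e : RExpr k} (he : e.Safe M I σ) (hT : e.cost + 1 ≤ T)
    (h : Q { σ with rvar := Function.update σ.rvar v (e.eval I σ) }) :
    Does M I (.rset v e) σ T Q := ⟨_, _, .rset σ v e he, hT, h⟩

theorem nstore {a : Fin k} {i e : NExpr k} (hi : i.Safe M I σ) (hM : i.eval I σ < M)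
    (he : e.Safe M I σ) (hT : i.cost + e.cost + 1 ≤ T)
    (h : Q { σ with narr := Function.update σ.narr a
                      (Function.update (σ.narr a) (i.eval I σ) (e.eval I σ)) }) :
    Does M I (.nstore a i e) σ T Q := ⟨_, _, .nstore σ a i e hi hM he, hT, h⟩

theorem rstore {a : Fin k} {i : NExpr k} {e : RExpr k} (hi : i.Safe M I σ) (hM : i.eval I σ < M)
    (he : e.Safe M I σ) (hT : i.cost + e.cost + 1 ≤ T)
    (h : Q { σ with rarr := Function.update σ.rarr a
                      (Function.update (σ.rarr a) (i.eval I σ) (e.eval I σ)) }) :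
    Does M I (.rstore a i e) σ T Q := ⟨_, _, .rstore σ a i e hi hM he, hT, h⟩

theorem cond {b : Test k} {c d : Cmd k} {T' : ℕ} (hs : b.Safe M I σ)
    (hc : b.Holds I σ → Does M I c σ T' Q) (hd : ¬ b.Holds I σ → Does M I d σ T' Q)
    (hT : b.cost + 1 + T' ≤ T) : Does M I (.cond b c d) σ T Q := by
  by_cases hb : b.Holds I σ
  · obtain ⟨t, σ', hr, ht, hq⟩ := hc hb
    exact ⟨_, _, .cond_true hs hb hr, by omega, hq⟩
  · obtain ⟨t, σ', hr, ht, hq⟩ := hd hb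
    exact ⟨_, _, .cond_false hs hb hr, by omega, hq⟩

/-- A round consists of the test (`e.cost + 3`), the body (`T'`) and the increment (4). The initial
assignment costs 2 and the final test `e.cost + 3`. The bound is evaluated anew in each test, so the
invariant has to fix its value. -/
theorem forTo {v : Fin k} {e : NExpr k} {c : Cmd k} {N T' : ℕ} (Inv : ℕ → Store k → Prop)
    (hN : N ≤ M)
    (h0 : Inv 0 { σ with nvar := Function.update σ.nvar v 0 })
    (hv : ∀ i ≤ N, ∀ σ, Inv i σ → σ.nvar v = i ∧ e.Safe M I σ ∧ e.eval I σ = N)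
    (hc : ∀ i < N, ∀ σ, Inv i σ → Does M I c σ T' fun σ' => σ'.nvar v = i ∧
      Inv (i + 1) { σ' with nvar := Function.update σ'.nvar v (i + 1) })
    (hT : N * (T' + e.cost + 7) + e.cost + 5 ≤ T) :
    Does M I (Cmd.forTo v e c) σ T (Inv N) := by
  have key : ∀ m i, i + m = N → ∀ σ, Inv i σ →
      Does M I (.loop (.natLt (.var v) e) (.seq c (.nset v (.add (.var v) (.const 1))))) σ
        (m * (T' + e.cost + 7) + e.cost + 3) (Inv N) := by
    intro m
    induction m with
    | zero =>
      intro i hi σ hσ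
      obtain ⟨h1, h2, h3⟩ := hv i (by omega) σ hσ
      refine ⟨_, _, .loop_done ⟨trivial, h2⟩ ?_, ?_, ?_⟩
      · simp only [Test.Holds, NExpr.eval, h1, h3]; omega
      · simp only [Test.cost, NExpr.cost]; omega
      · obtain rfl : i = N := by omega
        exact hσ
    | succ m ih =>
      intro i hi σ hσ
      obtain ⟨h1, h2, h3⟩ := hv i (by omega) σ hσ
      obtain ⟨t, σ', hr, ht, h4, h5⟩ := hc i (by omega) σ hσ
      obtain ⟨t', σ'', hr', ht', h6⟩ := ih (i + 1) (by omega) _ h5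
      have hset : Run M I (.nset v (.add (.var v) (.const 1))) σ' 4
          { σ' with nvar := Function.update σ'.nvar v (i + 1) } := by
        have := Run.nset (M := M) (I := I) σ' v (.add (.var v) (.const 1))
          ⟨trivial, by simp only [NExpr.Safe]; omega, by simp only [NExpr.eval, h4]; omega⟩
        simpa only [NExpr.eval, h4, NExpr.cost] using this
      refine ⟨_, _, .loop_step ⟨trivial, h2⟩ ?_ (.seq hr hset) hr', ?_, h6⟩
      · simp only [Test.Holds, NExpr.eval, h1, h3]; omega
      · simp only [Test.cost, NExpr.cost]
        rw [add_mul]; omega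
  refine Does.seq (T₁ := 2) (Does.nset (by simp [NExpr.Safe]) (by simp [NExpr.cost]) ?_)
    (T₂ := N * (T' + e.cost + 7) + e.cost + 3) (by omega)
  exact key N 0 (by omega) _ h0

end Does

/-! ### Linked lists on the heap -/

/-- The set stored in the linked list with head `i`; `p` holds the links and `m` the entries, and
`0` is the empty list. -/
def linkedSet (p m : ℕ → ℕ) : ℕ → Finset ℕ
  | 0 => ∅
  | i + 1 => if _h : p (i + 1) < i + 1 then insert (m (i + 1)) (linkedSet p m (p (i + 1))) else ∅

/-- The guard in `linkedSet` only serves termination: on the heap every link points to a smaller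
address. -/
theorem linkedSet_of_pos {p m : ℕ → ℕ} {i : ℕ} (hi : 0 < i) (hp : p i < i) :
    linkedSet p m i = insert (m i) (linkedSet p m (p i)) := by
  obtain ⟨i, rfl⟩ := Nat.exists_eq_succ_of_ne_zero hi.ne'
  rw [linkedSet, dif_pos hp]

/-- A list never visits an address above its head. Hence allocating fresh cells above `c` changes no
existing list, which is what makes the sharing of tails safe. -/
theorem linkedSet_congr {p m p' m' : ℕ → ℕ} {c : ℕ} (h : ∀ i ≤ c, p' i = p i ∧ m' i = m i) :
    ∀ i ≤ c, linkedSet p' m' i = linkedSet p m i := by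
  intro i
  induction i using Nat.strong_induction_on with
  | _ i ih =>
    intro hi
    cases i with
    | zero => simp [linkedSet]
    | succ i =>
      obtain ⟨h1, h2⟩ := h _ hi
      rw [linkedSet, linkedSet, h1, h2]
      by_cases hp : p (i + 1) < i + 1
      · rw [dif_pos hp, dif_pos hp, ih _ hp (by omega)]
      · rw [dif_neg hp, dif_neg hp]

/-- A partial solution of a dynamic program: its value and the set of points it uses. -/
abbrev Cell := Option (ℝ × Finset ℕ)

/-- The partial solution with value `v` and list `i`; the list `0` stands for no solution. -/
def decode (p m : ℕ → ℕ) (v : ℝ) (i : ℕ) : Cell :=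
  if i = 0 then none else some (v, linkedSet p m i)

/-- The better of two partial solutions. -/
noncomputable def Cell.better : Cell → Cell → Cell
  | none, y => y
  | some a, none => some a
  | some a, some b => if a.1 < b.1 then some b else some a

/-! ### A language for dynamic programs

The programs of this language work on tables of partial solutions, indexed by pairs of columns. -/

namespace DP

/-- Column indices: `0`, a loop variable, or its mirror image. -/
inductive Idx
  | zero
  | var (v : Fin 3)
  | rev (v : Fin 3)

/-- Bounds of loops. -/
inductive Bnd
  | size
  | var (v : Fin 3)
  | succ (v : Fin 3)

inductive Prog
  | skip
  | clear
  | load (a : Fin 6) (i j : Idx)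
  | improve (a : Fin 6) (i j : Idx)
  | store (a : Fin 6) (i j : Idx)
  | push (i : Idx)
  | single (i : Idx)
  | addw (i : Idx)
  | combine (a : Fin 6) (i j : Idx) (b : Fin 6) (i' j' : Idx)
  | ite (i j : Idx) (c d : Prog)
  | seq (c d : Prog)
  | forTo (v : Fin 3) (b : Bnd) (c : Prog)

/-- The columns: heights, weights and input positions of the points. -/
structure Cols where
  y : ℕ → ℝ
  w : ℕ → ℝ
  pt : ℕ → ℕ

/-- The state: an accumulator, the tables, and the best solution that was found. -/
structure St where
  acc : Cell
  tab : Fin 6 → ℕ → ℕ → Cell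
  best : ℝ × Finset ℕ

def Idx.eval (n : ℕ) (env : Fin 3 → ℕ) : Idx → ℕ
  | .zero => 0
  | .var v => env v
  | .rev v => n - 1 - env v

def Bnd.eval (n : ℕ) (env : Fin 3 → ℕ) : Bnd → ℕ
  | .size => n
  | .var v => env v
  | .succ v => env v + 1

/-- Iteration of a step that depends on the number of the step. -/
def iter {α : Type*} (f : ℕ → α → α) : ℕ → α → α
  | 0, s => s
  | i + 1, s => f i (iter f i s)

noncomputable def pushCell (D : Cols) (c : ℕ) (x : Cell) : Cell :=
  x.map fun z => (z.1 + D.w c, insert (D.pt c) z.2)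

noncomputable def addCell (D : Cols) (c : ℕ) (x : Cell) : Cell :=
  x.map fun z => (z.1 + D.w c, z.2)

def setTab (t : Fin 6 → ℕ → ℕ → Cell) (a : Fin 6) (i j : ℕ) (x : Cell) : Fin 6 → ℕ → ℕ → Cell :=
  fun a' i' j' => if a' = a ∧ i' = i ∧ j' = j then x else t a' i' j'

/-- The solution obtained from a left and a right part that share the point of column `c`. -/
noncomputable def joinBest (D : Cols) (c : ℕ) (best : ℝ × Finset ℕ) : Cell → Cell → ℝ × Finset ℕ
  | some x, some z =>
      if best.1 < x.1 - D.w c + z.1 then (x.1 - D.w c + z.1, x.2 ∪ z.2) else best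
  | _, _ => best

noncomputable def Prog.eval (n : ℕ) (D : Cols) : Prog → (Fin 3 → ℕ) → St → St
  | .skip, _, s => s
  | .clear, _, s => { s with acc := none }
  | .load a i j, env, s => { s with acc := s.tab a (i.eval n env) (j.eval n env) }
  | .improve a i j, env, s =>
      { s with acc := s.acc.better (s.tab a (i.eval n env) (j.eval n env)) }
  | .store a i j, env, s => { s with tab := setTab s.tab a (i.eval n env) (j.eval n env) s.acc }
  | .push i, env, s => { s with acc := pushCell D (i.eval n env) s.acc }
  | .single i, env, s =>
      { s with acc := some (D.w (i.eval n env), {D.pt (i.eval n env)}) }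
  | .addw i, env, s => { s with acc := addCell D (i.eval n env) s.acc }
  | .combine a i j b i' j', env, s =>
      { s with
        best := joinBest D (i.eval n env) s.best (s.tab a (i.eval n env) (j.eval n env))
          (s.tab b (i'.eval n env) (j'.eval n env)) }
  | .ite i j c d, env, s =>
      if D.y (i.eval n env) < D.y (j.eval n env) then c.eval n D env s else d.eval n D env s
  | .seq c d, env, s => d.eval n D env (c.eval n D env s)
  | .forTo v b c, env, s =>
      iter (fun i s => c.eval n D (Function.update env v i) s) (b.eval n env) s

/-- A loop variable in scope is less than `n`, so a nonempty scope guarantees that `0` is a column.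
-/
def Idx.Ok (Γ : Finset (Fin 3)) : Idx → Prop
  | .zero => Γ.Nonempty
  | .var v => v ∈ Γ
  | .rev v => v ∈ Γ

def Bnd.Ok (Γ : Finset (Fin 3)) : Bnd → Prop
  | .size => True
  | .var v => v ∈ Γ
  | .succ v => v ∈ Γ

/-- Only loop variables that are in scope are used. -/
def Prog.Ok : Finset (Fin 3) → Prog → Prop
  | _, .skip => True
  | _, .clear => True
  | Γ, .load _ i j => i.Ok Γ ∧ j.Ok Γ
  | Γ, .improve _ i j => i.Ok Γ ∧ j.Ok Γ
  | Γ, .store _ i j => i.Ok Γ ∧ j.Ok Γ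
  | Γ, .push i => i.Ok Γ
  | Γ, .single i => i.Ok Γ
  | Γ, .addw i => i.Ok Γ
  | Γ, .combine _ i j _ i' j' => i.Ok Γ ∧ j.Ok Γ ∧ i'.Ok Γ ∧ j'.Ok Γ
  | Γ, .ite i j c d => i.Ok Γ ∧ j.Ok Γ ∧ c.Ok Γ ∧ d.Ok Γ
  | Γ, .seq c d => c.Ok Γ ∧ d.Ok Γ
  | Γ, .forTo v b c => v ∉ Γ ∧ b.Ok Γ ∧ c.Ok (insert v Γ)

/-- A bound for the number of list entries that are allocated. -/
def Prog.alloc (n : ℕ) : Prog → ℕ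
  | .push _ => 1
  | .single _ => 1
  | .ite _ _ c d => c.alloc n + d.alloc n
  | .seq c d => c.alloc n + d.alloc n
  | .forTo _ _ c => n * c.alloc n
  | _ => 0

/-- A bound for the number of steps. -/
def Prog.cost (n : ℕ) : Prog → ℕ
  | .ite _ _ c d => c.cost n + d.cost n + 100
  | .seq c d => c.cost n + d.cost n
  | .forTo _ _ c => n * (c.cost n + 10) + 8
  | _ => 300

/-! The machine variables: the naturals `0, 1, 2, 3` are the accumulator, the number of list entries,
and the two lists of the best solution; `5, 6, 7` are the loop variables. The reals `0, 1` are the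
values of the accumulator and of the best solution. The arrays `0, …, 5` are the tables; the natural
arrays `6, 7, 8, 9` hold the input positions of the columns, the sorted order of the input, and the
links and the entries of the lists; the real arrays `6, 7` hold the heights and the weights. -/

def loopVar (v : Fin 3) : Fin 10 := ⟨v + 5, by omega⟩

def tabVar (a : Fin 6) : Fin 10 := ⟨a, by omega⟩

def Idx.expr : Idx → NExpr 10
  | .zero => .const 0
  | .var v => .var (loopVar v)
  | .rev v => .sub (.sub .size (.const 1)) (.var (loopVar v))

def Bnd.expr : Bnd → NExpr 10
  | .size => .size
  | .var v => .var (loopVar v)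
  | .succ v => .add (.var (loopVar v)) (.const 1)

def addr (i j : Idx) : NExpr 10 := .add (.mul i.expr .size) j.expr

/-- Prepend the point of column `i` to the list of the accumulator. -/
def allocCmd (i : Idx) : Cmd 10 :=
  .seq (.nset 1 (.add (.var 1) (.const 1)))
    (.seq (.nstore 8 (.var 1) (.var 0))
      (.seq (.nstore 9 (.var 1) (.load 6 i.expr)) (.nset 0 (.var 1))))

def loadCmd (a : Fin 6) (i j : Idx) : Cmd 10 :=
  .seq (.nset 0 (.load (tabVar a) (addr i j))) (.rset 0 (.load (tabVar a) (addr i j)))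

def improveTest (a : Fin 6) (i j : Idx) : Test 10 :=
  .and (.not (.natEq (.load (tabVar a) (addr i j)) (.const 0)))
    (.not (.and (.not (.natEq (.var 0) (.const 0)))
      (.not (.realLt (.var 0) (.load (tabVar a) (addr i j))))))

def joinExpr (a : Fin 6) (i j : Idx) (b : Fin 6) (i' j' : Idx) : RExpr 10 :=
  .add (.sub (.load (tabVar a) (addr i j)) (.load 7 i.expr)) (.load (tabVar b) (addr i' j'))

def joinTest (a : Fin 6) (i j : Idx) (b : Fin 6) (i' j' : Idx) : Test 10 :=
  .and (.not (.natEq (.load (tabVar a) (addr i j)) (.const 0)))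
    (.and (.not (.natEq (.load (tabVar b) (addr i' j')) (.const 0)))
      (.realLt (.var 1) (joinExpr a i j b i' j')))

/-- Translation to machine programs. -/
def Prog.compile : Prog → Cmd 10
  | .skip => .skip
  | .clear => .nset 0 (.const 0)
  | .load a i j => loadCmd a i j
  | .improve a i j => .cond (improveTest a i j) (loadCmd a i j) .skip
  | .store a i j =>
      .seq (.nstore (tabVar a) (addr i j) (.var 0)) (.rstore (tabVar a) (addr i j) (.var 0))
  | .push i => .cond (.natEq (.var 0) (.const 0)) .skip
      (.seq (.rset 0 (.add (.var 0) (.load 7 i.expr))) (allocCmd i))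
  | .single i => .seq (.nset 0 (.const 0)) (.seq (.rset 0 (.load 7 i.expr)) (allocCmd i))
  | .addw i => .rset 0 (.add (.var 0) (.load 7 i.expr))
  | .combine a i j b i' j' => .cond (joinTest a i j b i' j')
      (.seq (.rset 1 (joinExpr a i j b i' j'))
        (.seq (.nset 2 (.load (tabVar a) (addr i j))) (.nset 3 (.load (tabVar b) (addr i' j')))))
      .skip
  | .ite i j c d => .cond (.realLt (.load 6 i.expr) (.load 6 j.expr)) c.compile d.compile
  | .seq c d => .seq c.compile d.compile
  | .forTo v b c => .forTo (loopVar v) b.expr c.compile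

/-- The store `σ` represents the state `s`, with at most `K` list entries. -/
structure Core (n K : ℕ) (s : St) (σ : Store 10) : Prop where
  count : σ.nvar 1 ≤ K
  heap : ∀ i, 0 < i → i ≤ σ.nvar 1 → σ.narr 8 i < i ∧ σ.narr 9 i < n
  acc : decode (σ.narr 8) (σ.narr 9) (σ.rvar 0) (σ.nvar 0) = s.acc
  acc_le : σ.nvar 0 ≤ σ.nvar 1
  tab : ∀ a i j, i < n → j < n → decode (σ.narr 8) (σ.narr 9) (σ.rarr (tabVar a) (i * n + j))
    (σ.narr (tabVar a) (i * n + j)) = s.tab a i j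
  tab_le : ∀ a i j, i < n → j < n → σ.narr (tabVar a) (i * n + j) ≤ σ.nvar 1
  best : σ.rvar 1 = s.best.1
  best_set : linkedSet (σ.narr 8) (σ.narr 9) (σ.nvar 2) ∪
    linkedSet (σ.narr 8) (σ.narr 9) (σ.nvar 3) = s.best.2
  best_le : σ.nvar 2 ≤ σ.nvar 1 ∧ σ.nvar 3 ≤ σ.nvar 1
  marked : σ.marked = ∅

/-- The columns `D` are stored in memory. -/
def Loaded (n : ℕ) (D : Cols) (σ : Store 10) : Prop :=
  ∀ x < n, σ.rarr 6 x = D.y x ∧ σ.rarr 7 x = D.w x ∧ σ.narr 6 x = D.pt x ∧ D.pt x < n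

/-- The loop variables in scope have their values, which are columns. -/
def InScope (n : ℕ) (Γ : Finset (Fin 3)) (env : Fin 3 → ℕ) (σ : Store 10) : Prop :=
  ∀ v ∈ Γ, σ.nvar (loopVar v) = env v ∧ env v < n

/-- The sorted order of the input is stored in memory. -/
def Ordered (n : ℕ) (ord : ℕ → ℕ) (σ : Store 10) : Prop :=
  ∀ x < n, σ.narr 7 x = ord x

structure Rel (n K : ℕ) (ord : ℕ → ℕ) (D : Cols) (Γ : Finset (Fin 3)) (env : Fin 3 → ℕ) (s : St)
    (σ : Store 10) : Prop where
  core : Core n K s σ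
  loaded : Loaded n D σ
  scope : InScope n Γ env σ
  ordered : Ordered n ord σ

end DP
end RealRAM

/-! ### Representation of states in the machine memory -/

namespace RealRAM
namespace DP

variable {n K M : ℕ} {ord : ℕ → ℕ} {D : Cols} {Γ : Finset (Fin 3)} {env : Fin 3 → ℕ} {s : St}
  {σ : Store 10} {I : Input}

theorem Idx.expr_spec (hn : I.n = n) (hM : n ≤ M) (hs : InScope n Γ env σ) {i : Idx} (hi : i.Ok Γ) :
    i.expr.Safe M I σ ∧ i.expr.eval I σ = i.eval n env ∧ i.eval n env < n := by
  subst hn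
  cases i with
  | zero =>
    obtain ⟨v, hv⟩ := hi
    have := (hs v hv).2
    exact ⟨Nat.zero_le _, rfl, Nat.zero_lt_of_lt this⟩
  | var v => exact ⟨trivial, (hs v hi).1, (hs v hi).2⟩
  | rev v =>
    have h := hs v hi
    refine ⟨⟨⟨hM, ?_⟩, trivial⟩, ?_, ?_⟩
    · simp only [NExpr.Safe]; omega
    · simp only [Idx.expr, NExpr.eval, Idx.eval, h.1]
    · simp only [Idx.eval]; omega

theorem Idx.expr_cost (i : Idx) : i.expr.cost ≤ 5 := by
  cases i <;> simp [Idx.expr, NExpr.cost]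

theorem addr_cost (i j : Idx) : (addr i j).cost ≤ 13 := by
  have := i.expr_cost
  have := j.expr_cost
  simp only [addr, NExpr.cost]; omega

theorem addr_lt {i j : ℕ} (hi : i < n) (hj : j < n) : i * n + j < n * n := by nlinarith

theorem addr_spec (hn : I.n = n) (hM : n * n ≤ M) (hs : InScope n Γ env σ) {i j : Idx}
    (hi : i.Ok Γ) (hj : j.Ok Γ) :
    (addr i j).Safe M I σ ∧ (addr i j).eval I σ = i.eval n env * n + j.eval n env ∧
      i.eval n env * n + j.eval n env < M := by
  have hM' : n ≤ M := (Nat.le_mul_self n).trans hM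
  obtain ⟨h1, h2, h3⟩ := Idx.expr_spec hn hM' hs hi
  obtain ⟨h4, h5, h6⟩ := Idx.expr_spec hn hM' hs hj
  have h7 := addr_lt h3 h6
  refine ⟨⟨⟨h1, ?_, ?_⟩, h4, ?_⟩, ?_, h7.trans_le hM⟩
  · simp only [NExpr.Safe]; omega
  · simp only [NExpr.eval, h2, hn]; omega
  · simp only [NExpr.eval, h2, h5, hn]; omega
  · simp only [addr, NExpr.eval, h2, h5, hn]

theorem addr_inj {i j i' j' : ℕ} (hj : j < n) (hj' : j' < n) (h : i * n + j = i' * n + j') :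
    i = i' ∧ j = j' := by
  have h1 : (i * n + j) / n = (i' * n + j') / n := by rw [h]
  have h2 : (i * n + j) % n = (i' * n + j') % n := by rw [h]
  have hn : 0 < n := by omega
  rw [mul_comm i, mul_comm i', Nat.mul_add_div hn, Nat.mul_add_div hn, Nat.div_eq_of_lt hj,
    Nat.div_eq_of_lt hj'] at h1
  rw [mul_comm i, mul_comm i', Nat.mul_add_mod, Nat.mul_add_mod, Nat.mod_eq_of_lt hj,
    Nat.mod_eq_of_lt hj'] at h2
  omega

theorem decode_eq_none {p m : ℕ → ℕ} {v : ℝ} {i : ℕ} : decode p m v i = none ↔ i = 0 := by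
  unfold decode; split <;> simp_all

theorem decode_of_ne {p m : ℕ → ℕ} {v : ℝ} {i : ℕ} (h : i ≠ 0) :
    decode p m v i = some (v, linkedSet p m i) := if_neg h

theorem decode_congr {p m p' m' : ℕ → ℕ} {c : ℕ} (h : ∀ i ≤ c, p' i = p i ∧ m' i = m i)
    (v : ℝ) {i : ℕ} (hi : i ≤ c) : decode p' m' v i = decode p m v i := by
  unfold decode; rw [linkedSet_congr h i hi]

theorem tabVar_ne {a : Fin 6} {x : Fin 10} (hx : 6 ≤ (x : ℕ)) : tabVar a ≠ x := by
  rintro rfl; simp only [tabVar] at hx; omega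

theorem loopVar_ne {v : Fin 3} {x : Fin 10} (hx : (x : ℕ) < 5) : loopVar v ≠ x := by
  rintro rfl; simp [loopVar] at hx

@[simp] theorem tabVar_ne_six (a : Fin 6) : tabVar a ≠ 6 := tabVar_ne (by decide)
@[simp] theorem six_ne_tabVar (a : Fin 6) : 6 ≠ tabVar a := (tabVar_ne_six a).symm
@[simp] theorem tabVar_ne_seven (a : Fin 6) : tabVar a ≠ 7 := tabVar_ne (by decide)
@[simp] theorem seven_ne_tabVar (a : Fin 6) : 7 ≠ tabVar a := (tabVar_ne_seven a).symm
@[simp] theorem tabVar_ne_eight (a : Fin 6) : tabVar a ≠ 8 := tabVar_ne (by decide)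
@[simp] theorem eight_ne_tabVar (a : Fin 6) : 8 ≠ tabVar a := (tabVar_ne_eight a).symm
@[simp] theorem tabVar_ne_nine (a : Fin 6) : tabVar a ≠ 9 := tabVar_ne (by decide)
@[simp] theorem nine_ne_tabVar (a : Fin 6) : 9 ≠ tabVar a := (tabVar_ne_nine a).symm
@[simp] theorem tabVar_inj (a b : Fin 6) : tabVar a = tabVar b ↔ a = b := by
  simp [tabVar, Fin.ext_iff]
@[simp] theorem loopVar_ne_zero (v : Fin 3) : loopVar v ≠ 0 := loopVar_ne (by decide)
@[simp] theorem zero_ne_loopVar (v : Fin 3) : 0 ≠ loopVar v := (loopVar_ne_zero v).symm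
@[simp] theorem loopVar_ne_one (v : Fin 3) : loopVar v ≠ 1 := loopVar_ne (by decide)
@[simp] theorem one_ne_loopVar (v : Fin 3) : 1 ≠ loopVar v := (loopVar_ne_one v).symm
@[simp] theorem loopVar_ne_two (v : Fin 3) : loopVar v ≠ 2 := loopVar_ne (by decide)
@[simp] theorem two_ne_loopVar (v : Fin 3) : 2 ≠ loopVar v := (loopVar_ne_two v).symm
@[simp] theorem loopVar_ne_three (v : Fin 3) : loopVar v ≠ 3 := loopVar_ne (by decide)
@[simp] theorem three_ne_loopVar (v : Fin 3) : 3 ≠ loopVar v := (loopVar_ne_three v).symm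
@[simp] theorem loopVar_inj (a b : Fin 3) : loopVar a = loopVar b ↔ a = b := by
  simp [loopVar, Fin.ext_iff]

theorem Core.mono {K' : ℕ} (h : Core n K s σ) (hK : K ≤ K') : Core n K' s σ :=
  { h with count := h.count.trans hK }

theorem Rel.mono {K' : ℕ} (h : Rel n K ord D Γ env s σ) (hK : K ≤ K') :
    Rel n K' ord D Γ env s σ :=
  { h with core := h.core.mono hK }

/-- Covers all changes of the accumulator that allocate nothing: loading, clearing, and adding a
weight. -/
theorem Rel.setAcc (h : Rel n K ord D Γ env s σ) (v : ℝ) (i : ℕ) (hi : i ≤ σ.nvar 1) :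
    Rel n K ord D Γ env { s with acc := decode (σ.narr 8) (σ.narr 9) v i }
      { σ with
        nvar := Function.update σ.nvar 0 i
        rvar := Function.update σ.rvar 0 v } where
  core :=
    { count := by simpa using h.core.count
      heap := by simpa using h.core.heap
      acc := by simp
      acc_le := by simpa using hi
      tab := by simpa using h.core.tab
      tab_le := by simpa using h.core.tab_le
      best := by simpa using h.core.best
      best_set := by simpa using h.core.best_set
      best_le := by simpa using h.core.best_le
      marked := h.core.marked }
  loaded := h.loaded
  scope := by simpa [InScope] using h.scope
  ordered := h.ordered

/-- The new cell lies just above all cells in use, so every table entry and both lists of the best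
solution decode as before. -/
theorem Rel.alloc (h : Rel n K ord D Γ env s σ) (v : ℝ) {x : ℕ} (hx : x < n) :
    Rel n (K + 1) ord D Γ env
      { s with acc := some (v, insert x (linkedSet (σ.narr 8) (σ.narr 9) (σ.nvar 0))) }
      { σ with
        nvar := Function.update (Function.update σ.nvar 1 (σ.nvar 1 + 1)) 0 (σ.nvar 1 + 1)
        rvar := Function.update σ.rvar 0 v
        narr := Function.update (Function.update σ.narr 8
          (Function.update (σ.narr 8) (σ.nvar 1 + 1) (σ.nvar 0))) 9
          (Function.update (σ.narr 9) (σ.nvar 1 + 1) x) } := by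
  have hacc := h.core.acc_le
  have hc : ∀ i ≤ σ.nvar 1,
      Function.update (σ.narr 8) (σ.nvar 1 + 1) (σ.nvar 0) i = σ.narr 8 i ∧
      Function.update (σ.narr 9) (σ.nvar 1 + 1) x i = σ.narr 9 i := by
    intro i hi
    rw [Function.update_of_ne (by omega), Function.update_of_ne (by omega)]
    exact ⟨rfl, rfl⟩
  refine ⟨⟨?_, ?_, ?_, ?_, ?_, ?_, ?_, ?_, ?_, h.core.marked⟩, ?_, ?_, ?_⟩
  · simpa using h.core.count
  · intro i hi0 hi
    simp at hi ⊢
    by_cases hi' : i = σ.nvar 1 + 1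
    · subst hi'; simp; exact ⟨by omega, hx⟩
    · obtain ⟨h1, h2⟩ := hc i (by omega)
      rw [h1, h2]
      exact h.core.heap i hi0 (by omega)
  · simp
    rw [decode_of_ne (by omega), linkedSet_of_pos (by omega) (by simp; omega)]
    simp only [Function.update_self]
    rw [linkedSet_congr hc _ hacc]
  · simp
  · intro a i j hi hj
    simp [Function.update_of_ne]
    rw [decode_congr hc _ (h.core.tab_le a i j hi hj)]
    exact h.core.tab a i j hi hj
  · intro a i j hi hj
    simp [Function.update_of_ne]
    exact (h.core.tab_le a i j hi hj).trans (Nat.le_succ _)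
  · simpa using h.core.best
  · simp
    rw [linkedSet_congr hc _ h.core.best_le.1, linkedSet_congr hc _ h.core.best_le.2]
    exact h.core.best_set
  · have := h.core.best_le
    simp; omega
  · intro y hy; simpa using h.loaded y hy
  · simpa [InScope] using h.scope
  · intro y hy; simpa using h.ordered y hy


theorem InScope.update (h : InScope n Γ env σ) {x : Fin 10} (hx : (x : ℕ) < 5) (z : ℕ) :
    InScope n Γ env { σ with nvar := Function.update σ.nvar x z } := fun v hv => by
  simpa [Function.update_of_ne (loopVar_ne hx)] using h v hv

theorem loadCmd_does (hn : I.n = n) (hM : n * n ≤ M) (h : Rel n K ord D Γ env s σ) {a : Fin 6}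
    {i j : Idx} (hi : i.Ok Γ) (hj : j.Ok Γ) :
    Does M I (loadCmd a i j) σ 30
      (Rel n K ord D Γ env { s with acc := s.tab a (i.eval n env) (j.eval n env) }) := by
  have hM' : n ≤ M := (Nat.le_mul_self n).trans hM
  obtain ⟨h1, h2, h3⟩ := addr_spec hn hM h.scope hi hj
  have hi' := (Idx.expr_spec hn hM' h.scope hi).2.2
  have hj' := (Idx.expr_spec hn hM' h.scope hj).2.2
  have hcost := addr_cost i j
  refine Does.seq (T₁ := 15) (T₂ := 15) ?_ le_rfl
  refine Does.nset ⟨h1, h2 ▸ h3⟩ (by simp only [NExpr.cost]; omega) ?_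
  obtain ⟨h4, h5, -⟩ := addr_spec hn hM (h.scope.update (x := 0) (by decide)
    (NExpr.eval I σ (.load (tabVar a) (addr i j)))) hi hj
  refine Does.rset ⟨h4, h5 ▸ h3⟩ (by simp only [RExpr.cost]; omega) ?_
  have := h.setAcc (σ.rarr (tabVar a) (i.eval n env * n + j.eval n env))
    (σ.narr (tabVar a) (i.eval n env * n + j.eval n env)) (h.core.tab_le a _ _ hi' hj')
  rw [h.core.tab a _ _ hi' hj'] at this
  simp only [NExpr.eval, h2] at h5
  simpa only [NExpr.eval, RExpr.eval, h2, h5] using this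

theorem allocCmd_does (hn : I.n = n) (hM : n ≤ M) (hK : K + 1 < M) (h : Rel n K ord D Γ env s σ)
    (v : ℝ) {i : Idx} (hi : i.Ok Γ) :
    Does M I (allocCmd i) { σ with rvar := Function.update σ.rvar 0 v } 20
      (Rel n (K + 1) ord D Γ env { s with
        acc := some (v, insert (D.pt (i.eval n env))
          (linkedSet (σ.narr 8) (σ.narr 9) (σ.nvar 0))) }) := by
  have hc := h.core.count
  have hcost := i.expr_cost
  obtain ⟨h1, h2, h3⟩ := Idx.expr_spec hn hM (h.scope.update (x := 1) (by decide)
    (σ.nvar 1 + 1)) hi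
  obtain ⟨-, -, h4, h5⟩ := h.loaded _ h3
  -- The value of an index depends only on the natural variables, so this serves for every later
  -- store, whatever its arrays are.
  have h2' : ∀ τ : Store 10, τ.nvar = Function.update σ.nvar 1 (σ.nvar 1 + 1) →
      i.expr.eval I τ = i.eval n env ∧ i.expr.Safe M I τ := by
    intro τ hτ
    have hs : InScope n Γ env τ := by
      have := h.scope.update (x := 1) (by decide) (σ.nvar 1 + 1)
      simpa only [InScope, hτ] using this
    exact ⟨(Idx.expr_spec hn hM hs hi).2.1, (Idx.expr_spec hn hM hs hi).1⟩
  have hfin := h.alloc v h5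
  refine Does.seq (T₁ := 4) (T₂ := 16) (Does.nset ?_ (by simp [NExpr.cost]) ?_) le_rfl
  · exact ⟨trivial, show 1 ≤ M by omega, show σ.nvar 1 + 1 ≤ M by omega⟩
  refine Does.seq (T₁ := 3) (T₂ := 13) (Does.nstore trivial ?_ trivial (by simp [NExpr.cost]) ?_)
    le_rfl
  · simp [NExpr.eval]; omega
  refine Does.seq (T₁ := 8) (T₂ := 2) (Does.nstore trivial ?_ ?_
    (by simp only [NExpr.cost]; omega) ?_) (by omega)
  · simp [NExpr.eval]; omega
  · refine ⟨(h2' _ rfl).2, ?_⟩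
    rw [(h2' _ rfl).1]; omega
  refine Does.nset trivial (by simp [NExpr.cost]) ?_
  have e1 := (h2' (Store.mk (Function.update σ.nvar 1 (σ.nvar 1 + 1)) (Function.update σ.rvar 0 v)
    (Function.update σ.narr 8 (Function.update (σ.narr 8) (σ.nvar 1 + 1) (σ.nvar 0)))
    σ.rarr σ.marked) rfl).1
  convert hfin using 1
  simp [NExpr.eval, e1, h4]

end DP
end RealRAM

/-! ### Simulation of the language by the machine -/

namespace RealRAM
namespace DP

variable {n K M : ℕ} {ord : ℕ → ℕ} {D : Cols} {Γ : Finset (Fin 3)} {env : Fin 3 → ℕ} {s : St}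
  {σ : Store 10} {I : Input}

/-- The condition has the shape of `improveTest`, where a disjunction must be expressed by negation
and conjunction. -/
theorem better_decode (p m : ℕ → ℕ) (v v' : ℝ) (i i' : ℕ) :
    (decode p m v i).better (decode p m v' i') =
      if i' ≠ 0 ∧ ¬ (i ≠ 0 ∧ ¬ v < v') then decode p m v' i' else decode p m v i := by
  unfold decode Cell.better
  by_cases h : i = 0 <;> by_cases h' : i' = 0 <;> simp [h, h']

theorem cost_improveTest (a : Fin 6) (i j : Idx) : (improveTest a i j).cost ≤ 60 := by
  have := addr_cost i j
  simp only [improveTest, Test.cost, NExpr.cost, RExpr.cost]; omega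

theorem improve_does (hn : I.n = n) (hM : n * n ≤ M) (h : Rel n K ord D Γ env s σ) {a : Fin 6}
    {i j : Idx} (hi : i.Ok Γ) (hj : j.Ok Γ) :
    Does M I (Prog.improve a i j).compile σ 300
      (Rel n K ord D Γ env ((Prog.improve a i j).eval n D env s)) := by
  have hM' : n ≤ M := (Nat.le_mul_self n).trans hM
  obtain ⟨h1, h2, h3⟩ := addr_spec hn hM h.scope hi hj
  have hi' := (Idx.expr_spec hn hM' h.scope hi).2.2
  have hj' := (Idx.expr_spec hn hM' h.scope hj).2.2
  have hcost := cost_improveTest a i j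
  have hb := better_decode (σ.narr 8) (σ.narr 9) (σ.rvar 0)
    (σ.rarr (tabVar a) (i.eval n env * n + j.eval n env)) (σ.nvar 0)
    (σ.narr (tabVar a) (i.eval n env * n + j.eval n env))
  rw [h.core.acc, h.core.tab a _ _ hi' hj'] at hb
  have hl : (NExpr.load (tabVar a) (addr i j)).Safe M I σ := ⟨h1, h2 ▸ h3⟩
  have hl' : (RExpr.load (tabVar a) (addr i j)).Safe M I σ := ⟨h1, h2 ▸ h3⟩
  refine Does.cond (T' := 30) ⟨⟨hl, Nat.zero_le _⟩, fun _ => ⟨⟨trivial, Nat.zero_le _⟩,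
    fun _ => ⟨trivial, hl'⟩⟩⟩ (fun ht => ?_) (fun ht => ?_) (by omega)
  · simp only [improveTest, Test.Holds, NExpr.eval, RExpr.eval, h2] at ht
    rw [if_pos ht] at hb
    simpa only [Prog.eval, hb] using loadCmd_does hn hM h hi hj
  · simp only [improveTest, Test.Holds, NExpr.eval, RExpr.eval, h2] at ht
    rw [if_neg ht] at hb
    exact Does.skip (by omega) (by simpa only [Prog.eval, hb] using h)

theorem store_does (hn : I.n = n) (hM : n * n ≤ M) (h : Rel n K ord D Γ env s σ) {a : Fin 6}
    {i j : Idx} (hi : i.Ok Γ) (hj : j.Ok Γ) :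
    Does M I (Prog.store a i j).compile σ 300
      (Rel n K ord D Γ env ((Prog.store a i j).eval n D env s)) := by
  have hM' : n ≤ M := (Nat.le_mul_self n).trans hM
  obtain ⟨h1, h2, h3⟩ := addr_spec hn hM h.scope hi hj
  have hi' := (Idx.expr_spec hn hM' h.scope hi).2.2
  have hj' := (Idx.expr_spec hn hM' h.scope hj).2.2
  have hcost := addr_cost i j
  refine Does.seq (T₁ := 15) (T₂ := 15) (Does.nstore h1 (h2 ▸ h3) trivial
    (by simp only [NExpr.cost]; omega) ?_) (by omega)
  obtain ⟨h4, h5, h6⟩ := addr_spec (σ := { σ with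
    narr := Function.update σ.narr (tabVar a) (Function.update (σ.narr (tabVar a))
      ((addr i j).eval I σ) ((NExpr.var 0).eval I σ)) }) hn hM h.scope hi hj
  refine Does.rstore h4 (h5 ▸ h6) trivial (by simp only [RExpr.cost]; omega) ?_
  simp only [NExpr.eval, RExpr.eval, h2] at h5 ⊢
  rw [h5]
  simp only [Prog.eval]
  refine ⟨⟨h.core.count, by simpa using h.core.heap, by simpa using h.core.acc, h.core.acc_le,
    ?_, ?_, h.core.best, by simpa using h.core.best_set, h.core.best_le, h.core.marked⟩,
    by simpa [Loaded] using h.loaded, h.scope, by simpa [Ordered] using h.ordered⟩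
  · intro a' i' j' hi1 hj1
    by_cases ha : a' = a
    · subst ha
      by_cases hij : i' = i.eval n env ∧ j' = j.eval n env
      · obtain ⟨rfl, rfl⟩ := hij
        simpa [setTab] using h.core.acc
      · have : i' * n + j' ≠ i.eval n env * n + j.eval n env :=
          fun e => hij (addr_inj hj1 hj' e)
        simpa [setTab, hij, Function.update_of_ne this] using h.core.tab a' i' j' hi1 hj1
    · simpa [setTab, ha] using h.core.tab a' i' j' hi1 hj1
  · intro a' i' j' hi1 hj1
    by_cases ha : a' = a
    · subst ha
      by_cases hij : i' * n + j' = i.eval n env * n + j.eval n env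
      · simpa [hij] using h.core.acc_le
      · simpa [Function.update_of_ne hij] using h.core.tab_le a' i' j' hi1 hj1
    · simpa [ha] using h.core.tab_le a' i' j' hi1 hj1

theorem push_does (hn : I.n = n) (hM : n ≤ M) (hK : K + 1 < M) (h : Rel n K ord D Γ env s σ)
    {i : Idx} (hi : i.Ok Γ) :
    Does M I (Prog.push i).compile σ 300
      (Rel n (K + 1) ord D Γ env ((Prog.push i).eval n D env s)) := by
  obtain ⟨h1, h2, h3⟩ := Idx.expr_spec hn hM h.scope hi
  have hcost := i.expr_cost
  have hw := (h.loaded _ h3).2.1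
  have hacc := h.core.acc
  refine Does.cond (T' := 30) ⟨trivial, Nat.zero_le _⟩ (fun ht => ?_) (fun ht => ?_)
    (by simp [Test.cost, NExpr.cost])
  · simp only [Test.Holds, NExpr.eval] at ht
    refine Does.skip (by omega) ?_
    have : s.acc = none := by rw [← hacc, decode_eq_none, ht]
    have e : (Prog.push i).eval n D env s = s := by
      simp only [Prog.eval, pushCell, this, Option.map_none]; rw [← this]
    rw [e]
    exact h.mono (Nat.le_succ _)
  · simp only [Test.Holds, NExpr.eval] at ht
    refine Does.seq (T₁ := 10) (T₂ := 20) (Does.rset ⟨trivial, h1, by omega⟩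
      (by simp only [RExpr.cost]; omega) ?_) le_rfl
    refine (allocCmd_does hn hM hK h _ hi).mono le_rfl fun τ hτ => ?_
    rw [decode_of_ne ht] at hacc
    simpa only [Prog.eval, pushCell, ← hacc, Option.map_some, RExpr.eval, h2, hw] using hτ

theorem single_does (hn : I.n = n) (hM : n ≤ M) (hK : K + 1 < M) (h : Rel n K ord D Γ env s σ)
    {i : Idx} (hi : i.Ok Γ) :
    Does M I (Prog.single i).compile σ 300
      (Rel n (K + 1) ord D Γ env ((Prog.single i).eval n D env s)) := by
  have hcost := i.expr_cost
  have h0 := h.setAcc (σ.rvar 0) 0 (Nat.zero_le _)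
  obtain ⟨h1, h2, h3⟩ := Idx.expr_spec hn hM h0.scope hi
  have hw := (h.loaded _ h3).2.1
  refine Does.seq (T₁ := 2) (T₂ := 30) (Does.nset (Nat.zero_le _) (by simp [NExpr.cost]) ?_)
    (by omega)
  simp only [Function.update_eq_self] at h0 h1 h2
  simp only [NExpr.eval]
  refine Does.seq (T₁ := 10) (T₂ := 20) (Does.rset ⟨h1, by omega⟩
    (by simp only [RExpr.cost]; omega) ?_) le_rfl
  refine (allocCmd_does hn hM hK h0 _ hi).mono le_rfl fun τ hτ => ?_
  simpa [Prog.eval, linkedSet, RExpr.eval, h2, hw] using hτ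

/-- No test for an absent solution is needed: with list `0` the real value is ignored by `decode`.
-/
theorem addw_does (hn : I.n = n) (hM : n ≤ M) (h : Rel n K ord D Γ env s σ)
    {i : Idx} (hi : i.Ok Γ) :
    Does M I (Prog.addw i).compile σ 300
      (Rel n K ord D Γ env ((Prog.addw i).eval n D env s)) := by
  obtain ⟨h1, h2, h3⟩ := Idx.expr_spec hn hM h.scope hi
  have hcost := i.expr_cost
  have hw := (h.loaded _ h3).2.1
  have hacc := h.core.acc
  refine Does.rset ⟨trivial, h1, by omega⟩ (by simp only [RExpr.cost]; omega) ?_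
  have := h.setAcc (σ.rvar 0 + D.w (i.eval n env)) (σ.nvar 0) h.core.acc_le
  have e : decode (σ.narr 8) (σ.narr 9) (σ.rvar 0 + D.w (i.eval n env)) (σ.nvar 0) =
      addCell D (i.eval n env) s.acc := by
    rw [← hacc]; unfold decode addCell; split <;> simp
  rw [e] at this
  simpa [Prog.eval, RExpr.eval, h2, hw] using this

theorem combine_does (hn : I.n = n) (hM : n * n ≤ M) (h : Rel n K ord D Γ env s σ) {a b : Fin 6}
    {i j i' j' : Idx} (hi : i.Ok Γ) (hj : j.Ok Γ) (hi' : i'.Ok Γ) (hj' : j'.Ok Γ) :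
    Does M I (Prog.combine a i j b i' j').compile σ 300
      (Rel n K ord D Γ env ((Prog.combine a i j b i' j').eval n D env s)) := by
  have hM' : n ≤ M := (Nat.le_mul_self n).trans hM
  have key : ∀ τ : Store 10, InScope n Γ env τ → _ := fun τ hτ =>
    (⟨addr_spec hn hM hτ hi hj, addr_spec hn hM hτ hi' hj', Idx.expr_spec hn hM' hτ hi⟩ :
      _ ∧ _ ∧ _)
  obtain ⟨⟨h1, h2, h3⟩, ⟨h4, h5, h6⟩, ⟨h7, h8, h9⟩⟩ := key σ h.scope
  have hjn := (Idx.expr_spec hn hM' h.scope hj).2.2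
  have hin' := (Idx.expr_spec hn hM' h.scope hi').2.2
  have hjn' := (Idx.expr_spec hn hM' h.scope hj').2.2
  have hcost := i.expr_cost
  have hcost1 := addr_cost i j
  have hcost2 := addr_cost i' j'
  have hw := (h.loaded _ h9).2.1
  have t1 := h.core.tab a _ _ h9 hjn
  have t2 := h.core.tab b _ _ hin' hjn'
  have l1 := h.core.tab_le a _ _ h9 hjn
  have l2 := h.core.tab_le b _ _ hin' hjn'
  have hjoin : (joinExpr a i j b i' j').Safe M I σ :=
    ⟨⟨⟨h1, h2 ▸ h3⟩, h7, by omega⟩, h4, h5 ▸ h6⟩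
  simp only [Prog.eval, ← t1, ← t2]
  refine Does.cond (T' := 120) ⟨⟨⟨h1, h2 ▸ h3⟩, Nat.zero_le _⟩, fun _ => ⟨⟨⟨h4, h5 ▸ h6⟩,
    Nat.zero_le _⟩, fun _ => ⟨trivial, hjoin⟩⟩⟩ (fun ht => ?_) (fun ht => ?_)
    (by simp only [joinTest, joinExpr, Test.cost, NExpr.cost, RExpr.cost]; omega)
  · simp only [joinTest, joinExpr, Test.Holds, NExpr.eval, RExpr.eval, h2, h5, h8, hw,
      ← ne_eq] at ht
    rw [decode_of_ne ht.1, decode_of_ne ht.2.1]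
    simp only [joinBest]
    rw [← h.core.best, if_pos ht.2.2]
    refine Does.seq (T₁ := 60) (T₂ := 60) (Does.rset hjoin
      (by simp only [joinExpr, RExpr.cost]; omega) ?_) le_rfl
    set r := Function.update σ.rvar 1 ((joinExpr a i j b i' j').eval I σ) with hr
    obtain ⟨⟨h1', h2', -⟩, -, -⟩ := key { σ with rvar := r } h.scope
    refine Does.seq (T₁ := 20) (T₂ := 20) (Does.nset ⟨h1', h2' ▸ h3⟩
      (by simp only [NExpr.cost]; omega) ?_) (by omega)
    obtain ⟨-, ⟨h4', h5', -⟩, -⟩ := key { σ with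
      rvar := r
      nvar := Function.update σ.nvar 2 (NExpr.eval I { σ with rvar := r }
        (.load (tabVar a) (addr i j))) } (h.scope.update (x := 2) (by decide) _)
    refine Does.nset ⟨h4', h5' ▸ h6⟩ (by simp only [NExpr.cost]; omega) ?_
    simp only [NExpr.eval, h2'] at h5' ⊢
    rw [h5', hr]
    simp only [joinExpr, RExpr.eval, h2, h5, h8, hw]
    refine ⟨⟨by simpa using h.core.count, by simpa using h.core.heap, by simpa using h.core.acc,
      by simpa using h.core.acc_le, by simpa using h.core.tab, by simpa using h.core.tab_le,
      by simp, by simp, by simpa using ⟨l1, l2⟩, h.core.marked⟩, h.loaded, ?_, h.ordered⟩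
    exact (h.scope.update (x := 2) (by decide) _).update (x := 3) (by decide) _
  · refine Does.skip (by omega) ?_
    simp only [joinTest, joinExpr, Test.Holds, NExpr.eval, RExpr.eval, h2, h5, h8, hw,
      h.core.best] at ht
    have e : joinBest D (i.eval n env) s.best
        (decode (σ.narr 8) (σ.narr 9) (σ.rarr (tabVar a) (i.eval n env * n + j.eval n env))
          (σ.narr (tabVar a) (i.eval n env * n + j.eval n env)))
        (decode (σ.narr 8) (σ.narr 9) (σ.rarr (tabVar b) (i'.eval n env * n + j'.eval n env))
          (σ.narr (tabVar b) (i'.eval n env * n + j'.eval n env))) = s.best := by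
      by_cases c1 : σ.narr (tabVar a) (i.eval n env * n + j.eval n env) = 0
      · rw [decode_eq_none.2 c1]; rfl
      by_cases c2 : σ.narr (tabVar b) (i'.eval n env * n + j'.eval n env) = 0
      · rw [decode_eq_none.2 c2, decode_of_ne c1]; rfl
      rw [decode_of_ne c1, decode_of_ne c2]
      exact if_neg fun hh => ht ⟨c1, c2, hh⟩
    rw [e]
    exact h

theorem Rel.update_loopVar (h : Rel n K ord D Γ env s σ) {v : Fin 3} (hv : v ∉ Γ) (z : ℕ) :
    Rel n K ord D Γ env s { σ with nvar := Function.update σ.nvar (loopVar v) z } := by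
  refine ⟨⟨by simpa using h.core.count, by simpa using h.core.heap, by simpa using h.core.acc,
    by simpa using h.core.acc_le, by simpa using h.core.tab, by simpa using h.core.tab_le,
    h.core.best, by simpa using h.core.best_set, by simpa using h.core.best_le, h.core.marked⟩,
    h.loaded, fun u hu => ?_, h.ordered⟩
  have : u ≠ v := fun e => hv (e ▸ hu)
  simpa [this] using h.scope u hu

theorem Rel.enter (h : Rel n K ord D Γ env s σ) {v : Fin 3} (hv : v ∉ Γ) {i : ℕ}
    (hi : σ.nvar (loopVar v) = i) (hin : i < n) :
    Rel n K ord D (insert v Γ) (Function.update env v i) s σ := by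
  refine ⟨h.core, h.loaded, fun u hu => ?_, h.ordered⟩
  by_cases e : u = v
  · subst e; simpa [hi] using hin
  · simpa [e] using h.scope u ((Finset.mem_insert.1 hu).resolve_left e)

theorem Rel.leave {i : ℕ} {v : Fin 3} (h : Rel n K ord D (insert v Γ) (Function.update env v i) s σ)
    (hv : v ∉ Γ) : Rel n K ord D Γ env s σ ∧ σ.nvar (loopVar v) = i := by
  refine ⟨⟨h.core, h.loaded, fun u hu => ?_, h.ordered⟩, ?_⟩
  · have : u ≠ v := fun e => hv (e ▸ hu)
    simpa [this] using h.scope u (Finset.mem_insert_of_mem hu)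
  · simpa using (h.scope v (Finset.mem_insert_self _ _)).1

theorem Bnd.expr_spec (hn : I.n = n) (hM : n ≤ M) (hs : InScope n Γ env σ) {b : Bnd} (hb : b.Ok Γ) :
    b.expr.Safe M I σ ∧ b.expr.eval I σ = b.eval n env ∧ b.eval n env ≤ n ∧ b.expr.cost ≤ 3 := by
  subst hn
  cases b with
  | size => exact ⟨hM, rfl, le_rfl, by simp [Bnd.expr, NExpr.cost]⟩
  | var v =>
    have h := hs v hb
    exact ⟨trivial, h.1, h.2.le, by simp [Bnd.expr, NExpr.cost]⟩
  | succ v =>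
    have h := hs v hb
    refine ⟨⟨trivial, ?_, ?_⟩, ?_, h.2, by simp [Bnd.expr, NExpr.cost]⟩
    · simp only [NExpr.Safe]; omega
    · simp only [NExpr.eval, h.1]; omega
    · simp only [Bnd.expr, NExpr.eval, h.1, Bnd.eval]

/-- The machine program does what the semantics of the dynamic program says. -/
theorem Prog.compile_does (hn : I.n = n) (hM : n * n ≤ M) (c : Prog) :
    ∀ {Γ env s σ K}, c.Ok Γ → Rel n K ord D Γ env s σ → K + c.alloc n < M →
      Does M I c.compile σ (c.cost n) (Rel n (K + c.alloc n) ord D Γ env (c.eval n D env s)) := by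
  have hM' : n ≤ M := (Nat.le_mul_self n).trans hM
  induction c with
  | skip => exact fun _ h _ => Does.skip (by simp [Prog.cost]) h
  | clear =>
    intro Γ env s σ K _ h _
    refine Does.nset (Nat.zero_le _) (by simp [Prog.cost, NExpr.cost]) ?_
    simpa [decode, Prog.eval, Prog.alloc, NExpr.eval] using h.setAcc (σ.rvar 0) 0 (Nat.zero_le _)
  | load a i j =>
    intro Γ env s σ K ok h _
    exact (loadCmd_does hn hM h ok.1 ok.2).mono (by simp [Prog.cost]) fun _ => id
  | improve a i j => exact fun ok h _ => improve_does hn hM h ok.1 ok.2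
  | store a i j => exact fun ok h _ => store_does hn hM h ok.1 ok.2
  | push i => exact fun ok h hK => push_does hn hM' hK h ok
  | single i => exact fun ok h hK => single_does hn hM' hK h ok
  | addw i => exact fun ok h hK => addw_does hn hM' h ok
  | combine a i j b i' j' =>
    exact fun ok h hK => combine_does hn hM h ok.1 ok.2.1 ok.2.2.1 ok.2.2.2
  | ite i j c d ihc ihd =>
    intro Γ env s σ K ok h hK
    obtain ⟨oi, oj, oc, od⟩ := ok
    obtain ⟨h1, h2, h3⟩ := Idx.expr_spec hn hM' h.scope oi
    obtain ⟨h4, h5, h6⟩ := Idx.expr_spec hn hM' h.scope oj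
    have hcost := i.expr_cost
    have hcost' := j.expr_cost
    simp only [Prog.alloc] at hK
    refine Does.cond (T' := c.cost n + d.cost n) ⟨⟨h1, by omega⟩, h4, by omega⟩
      (fun ht => ?_) (fun ht => ?_)
      (by simp only [Prog.cost, Test.cost, RExpr.cost]; omega)
    · simp only [Test.Holds, RExpr.eval, h2, h5, (h.loaded _ h3).1, (h.loaded _ h6).1] at ht
      refine (ihc oc h (by omega)).mono (by omega) fun τ hτ => ?_
      simp only [Prog.eval, if_pos ht, Prog.alloc]
      exact hτ.mono (by omega)
    · simp only [Test.Holds, RExpr.eval, h2, h5, (h.loaded _ h3).1, (h.loaded _ h6).1] at ht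
      refine (ihd od h (by omega)).mono (by omega) fun τ hτ => ?_
      simp only [Prog.eval, if_neg ht, Prog.alloc]
      exact hτ.mono (by omega)
  | seq c d ihc ihd =>
    intro Γ env s σ K ok h hK
    simp only [Prog.alloc] at hK
    refine Does.seq ((ihc ok.1 h (by omega)).mono le_rfl fun τ hτ => ?_)
      (T₂ := d.cost n) (by simp [Prog.cost])
    refine (ihd ok.2 hτ (by omega)).mono le_rfl fun τ' hτ' => ?_
    simpa only [Prog.alloc, Prog.eval, add_assoc] using hτ'
  | forTo v b c ih =>
    intro Γ env s σ K ok h hK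
    obtain ⟨hv, hb, hc⟩ := ok
    simp only [Prog.alloc] at hK
    obtain ⟨-, -, hbn, hbc⟩ := Bnd.expr_spec hn hM' h.scope hb
    -- The allocation budget grows by `c.alloc n` per round. Between rounds the loop variable is out
    -- of scope, so its value is tracked separately.
    refine (Does.forTo (N := b.eval n env) (T' := c.cost n) (T := (Prog.forTo v b c).cost n)
      (fun i τ => Rel n (K + i * c.alloc n) ord D Γ env
        (iter (fun i s => c.eval n D (Function.update env v i) s) i s) τ ∧
        τ.nvar (loopVar v) = i) (by omega) ?_ ?_ ?_ ?_).mono le_rfl fun τ hτ => ?_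
    · exact ⟨by simpa [iter] using h.update_loopVar hv 0, by simp⟩
    · intro i _ τ hτ
      obtain ⟨h1, h2, -, -⟩ := Bnd.expr_spec hn hM' hτ.1.scope hb
      exact ⟨hτ.2, h1, h2⟩
    · intro i hi τ hτ
      have hle : (i + 1) * c.alloc n ≤ n * c.alloc n := Nat.mul_le_mul_right _ (by omega)
      rw [add_mul, one_mul] at hle
      refine (ih hc (hτ.1.enter hv hτ.2 (by omega)) (by omega)).mono le_rfl fun τ' hτ' => ?_
      obtain ⟨h1, h2⟩ := hτ'.leave hv
      refine ⟨h2, ?_, by simp⟩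
      simpa [iter, add_mul, add_assoc] using h1.update_loopVar hv (i + 1)
    -- A bound expression costs at most 3, which explains the constants `10 = 3 + 7` and `8 = 3 + 5`
    -- in `Prog.cost`.
    · have : b.eval n env * (c.cost n + b.expr.cost + 7) ≤ n * (c.cost n + 10) :=
        Nat.mul_le_mul hbn (by omega)
      simp only [Prog.cost]; omega
    · have : b.eval n env * c.alloc n ≤ n * c.alloc n := Nat.mul_le_mul_right _ hbn
      exact hτ.1.mono (by simp only [Prog.alloc]; omega)

end DP
end RealRAM

namespace RealRAM
namespace DP

variable {D : Cols} {n : ℕ}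

/-! ### Optimal partial solutions -/

/-- `x` is an optimal element of `K`. -/
def Best (K : Set (ℝ × Finset ℕ)) (x : Cell) : Prop :=
  (∀ z, x = some z → z ∈ K) ∧ ∀ z ∈ K, ∃ z', x = some z' ∧ z.1 ≤ z'.1

namespace Best

variable {K K' : Set (ℝ × Finset ℕ)} {x x' : Cell}

theorem none : Best ∅ none := ⟨by simp, by simp⟩

theorem eq_none (h : Best ∅ x) : x = .none := by
  cases x with
  | none => rfl
  | some z => exact absurd (h.1 z rfl) (Set.notMem_empty _)

theorem single (z : ℝ × Finset ℕ) : Best {z} (some z) :=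
  ⟨fun z' h => by simpa [eq_comm] using h, fun z' h => ⟨z, rfl, by rw [Set.mem_singleton_iff.1 h]⟩⟩

theorem better (h : Best K x) (h' : Best K' x') : Best (K ∪ K') (x.better x') := by
  cases x with
  | none =>
    refine ⟨fun z hz => .inr (h'.1 z hz), ?_⟩
    rintro z (hz | hz)
    · obtain ⟨_, h0, _⟩ := h.2 z hz
      cases h0
    · exact h'.2 z hz
  | some a =>
    cases x' with
    | none =>
      refine ⟨fun z hz => .inl (h.1 z hz), ?_⟩
      rintro z (hz | hz)
      · exact h.2 z hz
      · obtain ⟨_, h0, _⟩ := h'.2 z hz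
        cases h0
    | some b =>
      simp only [Cell.better]
      have h2 : ∀ z ∈ K ∪ K', z.1 ≤ a.1 ∨ z.1 ≤ b.1 := by
        rintro z (hz | hz)
        · obtain ⟨_, h0, h1⟩ := h.2 z hz
          cases h0; exact .inl h1
        · obtain ⟨_, h0, h1⟩ := h'.2 z hz
          cases h0; exact .inr h1
      split_ifs with hab
      · refine ⟨fun z hz => .inr (h'.1 z hz), fun z hz => ⟨b, rfl, ?_⟩⟩
        rcases h2 z hz with h | h <;> linarith
      · refine ⟨fun z hz => .inl (h.1 z hz), fun z hz => ⟨a, rfl, ?_⟩⟩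
        rcases h2 z hz with h | h <;> linarith

theorem map (f : ℝ × Finset ℕ → ℝ × Finset ℕ) (hf : ∀ z z', z.1 ≤ z'.1 → (f z).1 ≤ (f z').1)
    (h : Best K x) : Best (f '' K) (x.map f) := by
  refine ⟨fun z hz => ?_, ?_⟩
  · obtain ⟨a, ha, rfl⟩ := Option.map_eq_some_iff.1 hz
    exact ⟨a, h.1 a ha, rfl⟩
  · rintro _ ⟨z, hz, rfl⟩
    obtain ⟨z', h0, h1⟩ := h.2 z hz
    exact ⟨f z', by rw [h0, Option.map_some], hf _ _ h1⟩

/-- Used when selecting a column makes no difference: the program explores only `K`, which still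
contains a competitor for every member of `K'`. -/
theorem of_le (h : Best K x) (hK : K ⊆ K') (hK' : ∀ z ∈ K', ∃ z' ∈ K, z.1 ≤ z'.1) : Best K' x := by
  refine ⟨fun z hz => hK (h.1 z hz), fun z hz => ?_⟩
  obtain ⟨z', hz', hle⟩ := hK' z hz
  obtain ⟨z'', h0, h1⟩ := h.2 z' hz'
  exact ⟨z'', h0, hle.trans h1⟩

theorem push (c : ℕ) (h : Best K x) :
    Best ((fun z => (z.1 + D.w c, insert (D.pt c) z.2)) '' K) (pushCell D c x) :=
  h.map _ fun _ _ hz => by simpa using hz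

theorem add (c : ℕ) (h : Best K x) :
    Best ((fun z => (z.1 + D.w c, z.2)) '' K) (addCell D c x) :=
  h.map _ fun _ _ hz => by simpa using hz

end Best

/-! ### Hulls of sets of columns -/

/-- The lower left, upper left, upper right, and lower right quadrants at the point of column `q`
meet `S`. -/
def SW (D : Cols) (S : Finset ℕ) (q : ℕ) : Prop := ∃ s ∈ S, s ≤ q ∧ D.y s ≤ D.y q
def NW (D : Cols) (S : Finset ℕ) (q : ℕ) : Prop := ∃ s ∈ S, s ≤ q ∧ D.y q ≤ D.y s
def NE (D : Cols) (S : Finset ℕ) (q : ℕ) : Prop := ∃ s ∈ S, q ≤ s ∧ D.y q ≤ D.y s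
def SE (D : Cols) (S : Finset ℕ) (q : ℕ) : Prop := ∃ s ∈ S, q ≤ s ∧ D.y s ≤ D.y q

open scoped Classical in
/-- The total weight of the columns before `c` that satisfy `p`. -/
noncomputable def wsum (D : Cols) (c : ℕ) (p : ℕ → Prop) : ℝ :=
  ∑ q ∈ Finset.range c with p q, D.w q

theorem wsum_congr {c : ℕ} {p p' : ℕ → Prop} (h : ∀ q < c, p q ↔ p' q) :
    wsum D c p = wsum D c p' := by
  unfold wsum
  congr 1
  ext q
  simp only [Finset.mem_filter, Finset.mem_range]
  exact and_congr_right (h q)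

theorem wsum_succ_of {c : ℕ} {p p' : ℕ → Prop} (hc : p c) (h : ∀ q < c, p q ↔ p' q) :
    wsum D (c + 1) p = wsum D c p' + D.w c := by
  rw [← wsum_congr h]
  unfold wsum
  rw [Finset.range_add_one, Finset.filter_insert, if_pos hc, Finset.sum_insert (by simp), add_comm]

theorem wsum_succ_of_not {c : ℕ} {p p' : ℕ → Prop} (hc : ¬ p c) (h : ∀ q < c, p q ↔ p' q) :
    wsum D (c + 1) p = wsum D c p' := by
  rw [← wsum_congr h]
  unfold wsum
  rw [Finset.range_add_one, Finset.filter_insert, if_neg hc]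

theorem wsum_eq_zero {c : ℕ} {p : ℕ → Prop} (h : ∀ q < c, ¬ p q) : wsum D c p = 0 := by
  unfold wsum
  rw [Finset.sum_filter]
  exact Finset.sum_eq_zero fun q hq => if_neg (h q (Finset.mem_range.1 hq))

/-- The partial solutions `S` with property `P`, with their values `f S`. -/
def solutions (D : Cols) (P : Finset ℕ → Prop) (f : Finset ℕ → ℝ) : Set (ℝ × Finset ℕ) :=
  {z | ∃ S, P S ∧ z = (f S, S.image D.pt)}

/-- Sets of columns before `c` with lowest point `l` and highest point `h`; the value is the weight
of the part before column `c` of the hull of `S` and a far point on the right. -/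
def KA (D : Cols) (c l h : ℕ) : Set (ℝ × Finset ℕ) :=
  solutions D (fun S => (∀ s ∈ S, s < c) ∧ l ∈ S ∧ h ∈ S ∧ ∀ s ∈ S, D.y l ≤ D.y s ∧ D.y s ≤ D.y h)
    fun S => wsum D c fun q => SW D S q ∧ NW D S q

/-- Nonempty sets of columns before `c` above the row of `j`. -/
def KM (D : Cols) (c j : ℕ) : Set (ℝ × Finset ℕ) :=
  solutions D (fun S => (∀ s ∈ S, s < c) ∧ S.Nonempty ∧ ∀ s ∈ S, D.y j < D.y s)
    fun S => wsum D c fun q => SW D S q ∧ NW D S q ∧ NE D S q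

/-- Sets of columns with last column `c` and lowest point `u`. -/
def KB (D : Cols) (c u : ℕ) : Set (ℝ × Finset ℕ) :=
  solutions D (fun S => (∀ s ∈ S, s < c + 1) ∧ c ∈ S ∧ u ∈ S ∧ ∀ s ∈ S, D.y u ≤ D.y s)
    fun S => wsum D (c + 1) fun q => SW D S q ∧ NW D S q ∧ NE D S q

/-- Sets of columns before `c` with lowest point `u` and a point not below the row of `j`, to be
continued to the right by points whose highest one is in the row of `j`. -/
def KR (D : Cols) (c u j : ℕ) : Set (ℝ × Finset ℕ) :=
  solutions D (fun S => (∀ s ∈ S, s < c) ∧ u ∈ S ∧ (∀ s ∈ S, D.y u ≤ D.y s) ∧ D.y u ≤ D.y j ∧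
      ∃ s ∈ S, D.y j ≤ D.y s)
    fun S => wsum D c fun q => SW D S q ∧ NW D S q ∧ (NE D S q ∨ D.y q ≤ D.y j)

section

variable {S : Finset ℕ} {c q : ℕ}

theorem SW_insert_of_lt (hq : q < c) : SW D (insert c S) q ↔ SW D S q := by
  simp only [SW, Finset.mem_insert, exists_eq_or_imp]; grind

theorem NW_insert_of_lt (hq : q < c) : NW D (insert c S) q ↔ NW D S q := by
  simp only [NW, Finset.mem_insert, exists_eq_or_imp]; grind

/-- A new last column is invisible to the left quadrants of earlier columns, and lies in the upper
right quadrant of exactly those that are not above it. This is what drives all recurrences below. -/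
theorem NE_insert_of_lt (hq : q < c) : NE D (insert c S) q ↔ NE D S q ∨ D.y q ≤ D.y c := by
  simp only [NE, Finset.mem_insert, exists_eq_or_imp]; grind

theorem SW_insert_self : SW D (insert c S) c := ⟨c, Finset.mem_insert_self _ _, le_rfl, le_rfl⟩
theorem NW_insert_self : NW D (insert c S) c := ⟨c, Finset.mem_insert_self _ _, le_rfl, le_rfl⟩
theorem NE_insert_self : NE D (insert c S) c := ⟨c, Finset.mem_insert_self _ _, le_rfl, le_rfl⟩

theorem not_NE_of_lt (h : ∀ s ∈ S, s < c) : ¬ NE D S c := by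
  rintro ⟨s, hs, hle, -⟩; exact absurd (h s hs) (by omega)

theorem exists_insert (hS : ∀ s ∈ S, s < c + 1) (hc : c ∈ S) :
    ∃ S₀, (∀ s ∈ S₀, s < c) ∧ S = insert c S₀ := by
  refine ⟨S.erase c, fun s hs => ?_, (Finset.insert_erase hc).symm⟩
  have := hS s (Finset.mem_of_mem_erase hs)
  have := Finset.ne_of_mem_erase hs
  omega

theorem forall_lt_of_notMem (hS : ∀ s ∈ S, s < c + 1) (hc : c ∉ S) : ∀ s ∈ S, s < c := by
  intro s hs
  have := hS s hs
  have : s ≠ c := fun e => hc (e ▸ hs)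
  omega

end

/-- The heights of the columns before `n` are distinct. -/
def Distinct (n : ℕ) (D : Cols) : Prop := ∀ i < n, ∀ j < n, D.y i = D.y j → i = j

theorem Distinct.lt (hD : Distinct n D) {i j : ℕ} (hi : i < n) (hj : j < n) (hij : i ≠ j)
    (h : D.y i ≤ D.y j) : D.y i < D.y j :=
  lt_of_le_of_ne h fun e => hij (hD i hi j hj e)

/-! ### Recurrence for the family `KA` -/

variable {c : ℕ}

/-- Removing the new lowest point `c` leaves a set with the same highest point and some lowest point
`l` strictly above `c`. Column `c` counts because it is selected, and for earlier columns nothing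
changes. -/
theorem KA_low (hD : Distinct n D) (hc : c < n) {h : ℕ} (hh : h < c) :
    KA D (c + 1) c h = (fun z => (z.1 + D.w c, insert (D.pt c) z.2)) ''
      {z | ∃ l < c, D.y c < D.y l ∧ z ∈ KA D c l h} := by
  ext z
  constructor
  · rintro ⟨S, ⟨h1, h2, h3, h4⟩, rfl⟩
    obtain ⟨S, hS, rfl⟩ := exists_insert h1 h2
    have hhS : h ∈ S := (Finset.mem_insert.1 h3).resolve_left hh.ne
    obtain ⟨l, hl, hmin⟩ := S.exists_min_image D.y ⟨h, hhS⟩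
    refine ⟨(_, S.image D.pt), ⟨l, hS l hl, ?_, S, ⟨hS, hl, hhS, fun s hs => ⟨hmin s hs, ?_⟩⟩, rfl⟩, ?_⟩
    · exact hD.lt hc ((hS l hl).trans hc) (hS l hl).ne' (h4 l (Finset.mem_insert_of_mem hl)).1
    · exact (h4 s (Finset.mem_insert_of_mem hs)).2
    · simp only [Finset.image_insert]
      rw [wsum_succ_of ⟨SW_insert_self, NW_insert_self⟩ fun q hq =>
        and_congr (SW_insert_of_lt hq) (NW_insert_of_lt hq)]
  · rintro ⟨_, ⟨l, hl, hlt, S, ⟨h1, h2, h3, h4⟩, rfl⟩, rfl⟩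
    refine ⟨insert c S, ⟨?_, Finset.mem_insert_self _ _, Finset.mem_insert_of_mem h3, ?_⟩, ?_⟩
    · grind
    · grind
    · simp only [Finset.image_insert]
      rw [wsum_succ_of ⟨SW_insert_self, NW_insert_self⟩ fun q hq =>
        and_congr (SW_insert_of_lt hq) (NW_insert_of_lt hq)]

theorem KA_high (hD : Distinct n D) (hc : c < n) {l : ℕ} (hl : l < c) :
    KA D (c + 1) l c = (fun z => (z.1 + D.w c, insert (D.pt c) z.2)) ''
      {z | ∃ h < c, D.y h < D.y c ∧ z ∈ KA D c l h} := by
  ext z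
  constructor
  · rintro ⟨S, ⟨h1, h3, h2, h4⟩, rfl⟩
    obtain ⟨S, hS, rfl⟩ := exists_insert h1 h2
    have hhS : l ∈ S := (Finset.mem_insert.1 h3).resolve_left hl.ne
    obtain ⟨h, hh, hmax⟩ := S.exists_max_image D.y ⟨l, hhS⟩
    refine ⟨(_, S.image D.pt), ⟨h, hS h hh, ?_, S, ⟨hS, hhS, hh, fun s hs => ⟨?_, hmax s hs⟩⟩, rfl⟩, ?_⟩
    · exact hD.lt ((hS h hh).trans hc) hc (hS h hh).ne (h4 h (Finset.mem_insert_of_mem hh)).2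
    · exact (h4 s (Finset.mem_insert_of_mem hs)).1
    · simp only [Finset.image_insert]
      rw [wsum_succ_of ⟨SW_insert_self, NW_insert_self⟩ fun q hq =>
        and_congr (SW_insert_of_lt hq) (NW_insert_of_lt hq)]
  · rintro ⟨_, ⟨h, hh, hlt, S, ⟨h1, h2, h3, h4⟩, rfl⟩, rfl⟩
    refine ⟨insert c S, ⟨?_, Finset.mem_insert_of_mem h2, Finset.mem_insert_self _ _, ?_⟩, ?_⟩
    · grind
    · grind
    · simp only [Finset.image_insert]
      rw [wsum_succ_of ⟨SW_insert_self, NW_insert_self⟩ fun q hq =>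
        and_congr (SW_insert_of_lt hq) (NW_insert_of_lt hq)]

theorem wsum_singleton (p : ℕ → Prop) (hc : p c) (h : ∀ q < c, ¬ p q) :
    wsum D (c + 1) p = D.w c := by
  rw [wsum_succ_of hc fun q _ => Iff.rfl, wsum_eq_zero h, zero_add]

theorem not_SW_singleton {q : ℕ} (hq : q < c) : ¬ SW D {c} q := by
  rintro ⟨s, hs, h, -⟩
  rw [Finset.mem_singleton] at hs
  omega

/-- If the lowest point is also the highest, all points share one height, and distinct heights leave
only `c`. -/
theorem KA_self (hD : Distinct n D) (hc : c < n) : KA D (c + 1) c c = {(D.w c, {D.pt c})} := by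
  have hval : wsum D (c + 1) (fun q => SW D {c} q ∧ NW D {c} q) = D.w c :=
    wsum_singleton _ ⟨SW_insert_self (S := ∅), NW_insert_self (S := ∅)⟩
      fun q hq h => not_SW_singleton hq h.1
  ext z
  constructor
  · rintro ⟨S, ⟨h1, h2, h3, h4⟩, rfl⟩
    obtain rfl : S = {c} := by
      refine Finset.eq_singleton_iff_unique_mem.2 ⟨h2, fun s hs => ?_⟩
      exact hD s (by have := h1 s hs; omega) c hc (le_antisymm (h4 s hs).2 (h4 s hs).1)
    simp [hval]
  · rintro rfl
    exact ⟨{c}, ⟨by simp, by simp, by simp, by simp⟩, by simp [hval]⟩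

/-- Both extremes lie to the left of `c`, so `c` counts exactly when its height is between theirs,
whether selected or not. Hence `S` and `S.erase c` have equal values, it suffices to extend
solutions that avoid `c`, and no list cell is spent. -/
theorem Best.KA_succ {l h : ℕ} (hl : l < c) (hh : h < c) {x : Cell} (hx : Best (KA D c l h) x) :
    Best (KA D (c + 1) l h)
      (if D.y c < D.y l ∨ D.y h < D.y c then x else addCell D c x) := by
  have hval : ∀ S : Finset ℕ, (∀ s ∈ S, s < c + 1) → l ∈ S → h ∈ S →
      (∀ s ∈ S, D.y l ≤ D.y s ∧ D.y s ≤ D.y h) →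
      wsum D (c + 1) (fun q => SW D S q ∧ NW D S q) =
        wsum D c (fun q => SW D (S.erase c) q ∧ NW D (S.erase c) q) +
          if D.y c < D.y l ∨ D.y h < D.y c then 0 else D.w c := by
    intro S hS hlS hhS hb
    have hq : ∀ q < c, SW D S q ∧ NW D S q ↔ SW D (S.erase c) q ∧ NW D (S.erase c) q := by
      intro q hq
      simp only [SW, NW, Finset.mem_erase]; grind
    split_ifs with hy
    · rw [wsum_succ_of_not _ hq, add_zero]
      rintro ⟨⟨s, hs, -, h1⟩, ⟨t, ht, -, h2⟩⟩
      rcases hy with hy | hy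
      · linarith [(hb s hs).1]
      · linarith [(hb t ht).2]
    · rw [not_or, not_lt, not_lt] at hy
      exact wsum_succ_of ⟨⟨l, hlS, hl.le, hy.1⟩, ⟨h, hhS, hh.le, hy.2⟩⟩ hq
  have hx' : Best ((fun z => (z.1 + (if D.y c < D.y l ∨ D.y h < D.y c then 0 else D.w c), z.2)) ''
      KA D c l h) (if D.y c < D.y l ∨ D.y h < D.y c then x else addCell D c x) := by
    split_ifs
    · simpa using hx
    · exact hx.add c
  refine hx'.of_le ?_ ?_
  · rintro _ ⟨_, ⟨S, ⟨h1, h2, h3, h4⟩, rfl⟩, rfl⟩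
    refine ⟨S, ⟨fun s hs => (h1 s hs).trans (Nat.lt_succ_self c), h2, h3, h4⟩, ?_⟩
    have hcS : c ∉ S := fun hc => absurd (h1 c hc) (lt_irrefl c)
    simp only [hval S (fun s hs => (h1 s hs).trans (Nat.lt_succ_self c)) h2 h3 h4,
      Finset.erase_eq_of_notMem hcS]
  · rintro _ ⟨S, ⟨h1, h2, h3, h4⟩, rfl⟩
    refine ⟨_, ⟨_, ⟨S.erase c, ⟨?_, ?_, ?_, ?_⟩, rfl⟩, rfl⟩, (hval S h1 h2 h3 h4).le⟩
    · grind
    · grind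
    · grind
    · exact fun s hs => h4 s (Finset.mem_of_mem_erase hs)

end DP
end RealRAM

/-! ### Recurrences for the families `KR`, `KB` and `KM` -/

namespace RealRAM
namespace DP

variable {D : Cols} {n c : ℕ}

theorem KR_eq_empty {u j : ℕ} (h : D.y j < D.y u) : KR D c u j = ∅ := by
  ext z
  simp only [Set.mem_empty_iff_false, iff_false]
  rintro ⟨S, ⟨-, -, -, h1, -⟩, -⟩
  exact absurd h1 h.not_ge

theorem KM_zero {j : ℕ} : KM D 0 j = ∅ := by
  ext z
  simp only [Set.mem_empty_iff_false, iff_false]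
  rintro ⟨S, ⟨h, ⟨s, hs⟩, -⟩, -⟩
  exact absurd (h s hs) (by omega)

/-- The new point `c` could help only columns not above it. But a column whose lower left quadrant
meets `S` is above `c`, since all of `S` is. -/
theorem KR_self_value {S : Finset ℕ} {j : ℕ} (hS : ∀ s ∈ S, D.y c < D.y s) :
    wsum D (c + 1) (fun q => SW D (insert c S) q ∧ NW D (insert c S) q ∧
      (NE D (insert c S) q ∨ D.y q ≤ D.y j)) =
    wsum D c (fun q => SW D S q ∧ NW D S q ∧ (NE D S q ∨ D.y q ≤ D.y j)) + D.w c := by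
  refine wsum_succ_of ⟨SW_insert_self, NW_insert_self, .inl NE_insert_self⟩ fun q hq => ?_
  rw [SW_insert_of_lt hq, NW_insert_of_lt hq, NE_insert_of_lt hq]
  refine and_congr_right fun h => and_congr_right fun _ => ?_
  obtain ⟨s, hs, -, h1⟩ := h
  have := hS s hs
  grind

/-- Row `j` is below all of `S`, hence below every column whose lower left quadrant meets `S`, so
the alternative never applies. -/
theorem KM_value {S : Finset ℕ} {j : ℕ} (hS : ∀ s ∈ S, D.y j < D.y s) :
    wsum D c (fun q => SW D S q ∧ NW D S q ∧ (NE D S q ∨ D.y q ≤ D.y j)) =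
    wsum D c (fun q => SW D S q ∧ NW D S q ∧ NE D S q) := by
  refine wsum_congr fun q _ => and_congr_right fun h => and_congr_right fun _ => ?_
  obtain ⟨s, hs, -, h1⟩ := h
  have := hS s hs
  grind

/-- Remove the new lowest point `c`. The rest is empty, which forces `j = c` because some point is
not below row `j`; or it lies entirely above row `j`; or its lowest point is not above row `j`. -/
theorem KR_self (hD : Distinct n D) (hc : c < n) {j : ℕ} (hj : j < n) (hcj : D.y c ≤ D.y j) :
    KR D (c + 1) c j = (fun z => (z.1 + D.w c, insert (D.pt c) z.2)) ''
      (KM D c j ∪ {z | ∃ u < c, D.y c < D.y u ∧ z ∈ KR D c u j}) ∪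
        {z | j = c ∧ z = (D.w c, {D.pt c})} := by
  ext z
  constructor
  · rintro ⟨S, ⟨h1, h2, h3, h4, t, ht, htj⟩, rfl⟩
    obtain ⟨S, hS, rfl⟩ := exists_insert h1 h2
    have hlt : ∀ s ∈ S, D.y c < D.y s := fun s hs => hD.lt hc ((hS s hs).trans hc) (hS s hs).ne'
      (h3 s (Finset.mem_insert_of_mem hs))
    dsimp only
    rw [KR_self_value hlt]
    rcases S.eq_empty_or_nonempty with rfl | hne
    · right
      simp only [insert_empty_eq, Finset.mem_singleton] at ht
      subst ht
      refine ⟨hD _ hj _ hc (le_antisymm htj hcj), ?_⟩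
      rw [wsum_eq_zero (by simp [SW])]
      simp
    · left
      obtain ⟨u, hu, hmin⟩ := S.exists_min_image D.y hne
      refine ⟨(_, S.image D.pt), ?_, by dsimp only; rw [Finset.image_insert]⟩
      by_cases huj : D.y j < D.y u
      · left
        have hjS : ∀ s ∈ S, D.y j < D.y s := fun s hs => huj.trans_le (hmin s hs)
        exact ⟨S, ⟨hS, hne, hjS⟩, by dsimp only; rw [KM_value hjS]⟩
      · right
        refine ⟨u, hS u hu, hlt u hu, S, ⟨hS, hu, hmin, not_lt.1 huj, t, ?_, htj⟩, rfl⟩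
        refine (Finset.mem_insert.1 ht).resolve_left ?_
        rintro rfl
        linarith [hlt u hu]
  · rintro (⟨_, (⟨S, ⟨h1, ⟨t, ht⟩, h3⟩, rfl⟩ | ⟨u, hu, hcu, S, ⟨h1, h2, h3, h4, t, ht, htj⟩, rfl⟩), rfl⟩ | ⟨rfl, rfl⟩)
    · have hlt : ∀ s ∈ S, D.y c < D.y s := fun s hs => hcj.trans_lt (h3 s hs)
      refine ⟨insert c S, ⟨by grind, by simp, ?_, hcj, t, by simp [ht], (h3 t ht).le⟩, ?_⟩
      · intro s hs
        rcases Finset.mem_insert.1 hs with rfl | hs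
        exacts [le_rfl, (hlt s hs).le]
      · dsimp only
        rw [KR_self_value hlt, KM_value h3, Finset.image_insert]
    · have hlt : ∀ s ∈ S, D.y c < D.y s := fun s hs => hcu.trans_le (h3 s hs)
      refine ⟨insert c S, ⟨by grind, by simp, ?_, hcj, t, by simp [ht], htj⟩, ?_⟩
      · intro s hs
        rcases Finset.mem_insert.1 hs with rfl | hs
        exacts [le_rfl, (hlt s hs).le]
      · dsimp only
        rw [KR_self_value hlt, Finset.image_insert]
    · refine ⟨{j}, ⟨by simp, by simp, by simp, le_rfl, by simp⟩, ?_⟩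
      dsimp only
      rw [wsum_singleton]
      · simp
      · exact ⟨SW_insert_self (S := ∅), NW_insert_self (S := ∅), .inl (NE_insert_self (S := ∅))⟩
      · exact fun q hq h => not_SW_singleton hq h.1

/-- As `c` is in the last column and belongs to the set, a column not above `c` satisfies the upper
right condition anyway. -/
theorem KB_self : KB D c c = KR D (c + 1) c c := by
  have hval : ∀ S : Finset ℕ, c ∈ S → (wsum D (c + 1) fun q => SW D S q ∧ NW D S q ∧ NE D S q) =
      wsum D (c + 1) fun q => SW D S q ∧ NW D S q ∧ (NE D S q ∨ D.y q ≤ D.y c) := by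
    intro S hS
    refine wsum_congr fun q hq => and_congr_right fun _ => and_congr_right fun _ =>
      ⟨.inl, ?_⟩
    rintro (h | h)
    exacts [h, ⟨c, hS, by omega, h⟩]
  ext z
  constructor
  · rintro ⟨S, ⟨h1, h2, h3, h4⟩, rfl⟩
    exact ⟨S, ⟨h1, h2, h4, le_rfl, c, h2, le_rfl⟩, by dsimp only; rw [hval S h2]⟩
  · rintro ⟨S, ⟨h1, h2, h4, -, -⟩, rfl⟩
    exact ⟨S, ⟨h1, h2, h2, h4⟩, by dsimp only; rw [hval S h2]⟩

/-- If some point is higher than `c`, it lies to the left of `c`, and the rest is a `KR` set for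
which `c` is the announced point. Otherwise `c` is the highest point, the upper left condition
implies the upper right one, and the value is that of `KA`. -/
theorem KB_of_lt {u : ℕ} (hu : u < c) :
    KB D c u = (fun z => (z.1 + D.w c, insert (D.pt c) z.2)) '' KR D c u c ∪ KA D (c + 1) u c := by
  have hval : ∀ S : Finset ℕ, wsum D (c + 1) (fun q => SW D (insert c S) q ∧ NW D (insert c S) q ∧
      NE D (insert c S) q) =
      wsum D c (fun q => SW D S q ∧ NW D S q ∧ (NE D S q ∨ D.y q ≤ D.y c)) + D.w c := fun S =>
    wsum_succ_of ⟨SW_insert_self, NW_insert_self, NE_insert_self⟩ fun q hq => by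
      rw [SW_insert_of_lt hq, NW_insert_of_lt hq, NE_insert_of_lt hq]
  have hval' : ∀ S : Finset ℕ, c ∈ S → (∀ s ∈ S, D.y s ≤ D.y c) →
      (wsum D (c + 1) fun q => SW D S q ∧ NW D S q ∧ NE D S q) =
      wsum D (c + 1) fun q => SW D S q ∧ NW D S q := by
    intro S hS hmax
    refine wsum_congr fun q hq => and_congr_right fun _ => and_iff_left_of_imp ?_
    rintro ⟨s, hs, -, h⟩
    exact ⟨c, hS, by omega, h.trans (hmax s hs)⟩
  ext z
  constructor
  · rintro ⟨S, ⟨h1, h2, h3, h4⟩, rfl⟩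
    by_cases hmax : ∀ s ∈ S, D.y s ≤ D.y c
    · exact .inr ⟨S, ⟨h1, h3, h2, fun s hs => ⟨h4 s hs, hmax s hs⟩⟩, by dsimp only; rw [hval' S h2 hmax]⟩
    · left
      push Not at hmax
      obtain ⟨t, ht, htc⟩ := hmax
      obtain ⟨S, hS, rfl⟩ := exists_insert h1 h2
      refine ⟨_, ⟨S, ⟨hS, by grind, by grind, h4 c (by simp), t, by grind, htc.le⟩, rfl⟩, ?_⟩
      dsimp only
      rw [hval, Finset.image_insert]
  · rintro (⟨_, ⟨S, ⟨h1, h2, h3, h4, h5⟩, rfl⟩, rfl⟩ | ⟨S, ⟨h1, h2, h3, h4⟩, rfl⟩)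
    · refine ⟨insert c S, ⟨by grind, by simp, by simp [h2], by grind⟩, ?_⟩
      dsimp only
      rw [hval, Finset.image_insert]
    · exact ⟨S, ⟨h1, h3, h2, fun s hs => (h4 s hs).1⟩,
        by dsimp only; rw [hval' S h3 fun s hs => (h4 s hs).2]⟩

/-- A set that contains `c` is classified by its lowest point. If `c` is not selected, nothing lies
in its upper right quadrant, so it does not count. -/
theorem KM_succ {j : ℕ} :
    KM D (c + 1) j = KM D c j ∪ {z | ∃ u < c + 1, D.y j < D.y u ∧ z ∈ KB D c u} := by
  have hval : ∀ S : Finset ℕ, (∀ s ∈ S, s < c) →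
      wsum D (c + 1) (fun q => SW D S q ∧ NW D S q ∧ NE D S q) =
      wsum D c (fun q => SW D S q ∧ NW D S q ∧ NE D S q) := fun S hS =>
    wsum_succ_of_not (fun h => not_NE_of_lt hS h.2.2) fun q hq => Iff.rfl
  ext z
  constructor
  · rintro ⟨S, ⟨h1, h2, h3⟩, rfl⟩
    by_cases hc : c ∈ S
    · obtain ⟨u, hu, hmin⟩ := S.exists_min_image D.y h2
      exact .inr ⟨u, h1 u hu, h3 u hu, S, ⟨h1, hc, hu, hmin⟩, rfl⟩
    · have hS := forall_lt_of_notMem h1 hc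
      exact .inl ⟨S, ⟨hS, h2, h3⟩, by dsimp only; rw [hval S hS]⟩
  · rintro (⟨S, ⟨h1, h2, h3⟩, rfl⟩ | ⟨u, hu, hju, S, ⟨h1, h2, h3, h4⟩, rfl⟩)
    · exact ⟨S, ⟨fun s hs => (h1 s hs).trans (Nat.lt_succ_self c), h2, h3⟩, by dsimp only; rw [hval S h1]⟩
    · exact ⟨S, ⟨h1, ⟨c, h2⟩, fun s hs => hju.trans_le (h4 s hs)⟩, rfl⟩

/-- If `c` is not selected or lies below row `j`, the announced row makes its selection irrelevant:
`c` counts exactly when its height is between those of `u` and `j`. If `c` is selected and not below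
row `j`, it takes over the role of the announced point for the columns so far, and the set belongs
to `KB`. Splitting off `KB` leaves a constant number of operations per entry. -/
theorem Best.KR_succ {u j : ℕ} (hu : u < c) {x b : Cell} (hx : Best (KR D c u j) x)
    (hb : Best (KB D c u) b) :
    Best (KR D (c + 1) u j)
      (if D.y j < D.y u ∨ D.y c < D.y j then
          (if D.y c < D.y u ∨ D.y j < D.y c then x else addCell D c x)
        else (if D.y c < D.y u ∨ D.y j < D.y c then x else addCell D c x).better b) := by
  by_cases hju : D.y j < D.y u
  · rw [KR_eq_empty hju] at hx ⊢
    rw [if_pos (.inl hju), hx.eq_none]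
    simpa [addCell] using Best.none
  rw [not_lt] at hju
  -- The point `t` not below row `j` lies before `c`, and so supplies the upper left condition for
  -- `c`, as `u` supplies the lower left one.
  have hval : ∀ S : Finset ℕ, (∀ s ∈ S, s < c + 1) → u ∈ S → (∀ s ∈ S, D.y u ≤ D.y s) →
      (∃ s ∈ S, s < c ∧ D.y j ≤ D.y s) → (c ∈ S → D.y c < D.y j) →
      wsum D (c + 1) (fun q => SW D S q ∧ NW D S q ∧ (NE D S q ∨ D.y q ≤ D.y j)) =
        wsum D c (fun q => SW D (S.erase c) q ∧ NW D (S.erase c) q ∧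
          (NE D (S.erase c) q ∨ D.y q ≤ D.y j)) +
          if D.y c < D.y u ∨ D.y j < D.y c then 0 else D.w c := by
    intro S hS huS hmin ⟨t, ht, htc, htj⟩ hcS
    have hq : ∀ q < c, SW D S q ∧ NW D S q ∧ (NE D S q ∨ D.y q ≤ D.y j) ↔
        SW D (S.erase c) q ∧ NW D (S.erase c) q ∧ (NE D (S.erase c) q ∨ D.y q ≤ D.y j) := by
      intro q hq
      by_cases hc : c ∈ S
      · have hlt := hcS hc
        obtain ⟨S, h0, rfl⟩ := exists_insert hS hc
        have hn : c ∉ S := fun h => absurd (h0 c h) (lt_irrefl c)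
        rw [SW_insert_of_lt hq, NW_insert_of_lt hq, NE_insert_of_lt hq, Finset.erase_insert hn]
        refine and_congr_right fun _ => and_congr_right fun _ => ?_
        grind
      · rw [Finset.erase_eq_of_notMem hc]
    split_ifs with hy
    · rw [wsum_succ_of_not _ hq, add_zero]
      rintro ⟨⟨s, hs, -, h1⟩, -, ⟨s', hs', h2, h3⟩ | h2⟩
      · have : s' = c := by have := hS s' hs'; omega
        subst this
        have := hcS hs'
        rcases hy with hy | hy
        · linarith [hmin s hs]
        · linarith
      · rcases hy with hy | hy
        · linarith [hmin s hs]
        · linarith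
    · rw [not_or, not_lt, not_lt] at hy
      exact wsum_succ_of ⟨⟨u, huS, hu.le, hy.1⟩, ⟨t, ht, htc.le, hy.2.trans htj⟩, .inr hy.2⟩ hq
  have hx' : Best ((fun z => (z.1 + (if D.y c < D.y u ∨ D.y j < D.y c then 0 else D.w c), z.2)) ''
      KR D c u j) (if D.y c < D.y u ∨ D.y j < D.y c then x else addCell D c x) := by
    split_ifs
    · simpa using hx
    · exact hx.add c
  have hsub : (fun z => (z.1 + (if D.y c < D.y u ∨ D.y j < D.y c then 0 else D.w c), z.2)) ''
      KR D c u j ⊆ KR D (c + 1) u j := by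
    rintro _ ⟨_, ⟨S, ⟨h1, h2, h3, h4, t, ht, htj⟩, rfl⟩, rfl⟩
    have h1' : ∀ s ∈ S, s < c + 1 := fun s hs => (h1 s hs).trans (Nat.lt_succ_self c)
    refine ⟨S, ⟨h1', h2, h3, h4, t, ht, htj⟩, ?_⟩
    have hcS : c ∉ S := fun hc => absurd (h1 c hc) (lt_irrefl c)
    simp only [hval S h1' h2 h3 ⟨t, ht, h1 t ht, htj⟩ (fun h => absurd h hcS),
      Finset.erase_eq_of_notMem hcS]
  -- Erasing `c` keeps the set admissible: a point not below row `j` cannot be `c` under the last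
  -- assumption.
  have hdom : ∀ S : Finset ℕ, (∀ s ∈ S, s < c + 1) → u ∈ S → (∀ s ∈ S, D.y u ≤ D.y s) →
      (∃ s ∈ S, D.y j ≤ D.y s) → (c ∈ S → D.y c < D.y j) →
      ∃ z ∈ (fun z => (z.1 + (if D.y c < D.y u ∨ D.y j < D.y c then 0 else D.w c), z.2)) ''
        KR D c u j,
        wsum D (c + 1) (fun q => SW D S q ∧ NW D S q ∧ (NE D S q ∨ D.y q ≤ D.y j)) ≤ z.1 := by
    rintro S h1 h2 h3 ⟨t, ht, htj⟩ hcS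
    have htc : t ≠ c := by
      rintro rfl
      linarith [hcS ht]
    have htc' : t < c := by have := h1 t ht; omega
    refine ⟨_, ⟨_, ⟨S.erase c, ⟨?_, ?_, fun s hs => h3 s (Finset.mem_of_mem_erase hs), hju, t,
      Finset.mem_erase.2 ⟨htc, ht⟩, htj⟩, rfl⟩, rfl⟩, (hval S h1 h2 h3 ⟨t, ht, htc', htj⟩ hcS).le⟩
    · grind
    · grind
  by_cases hcj : D.y c < D.y j
  · rw [if_pos (.inr hcj)]
    refine hx'.of_le hsub ?_
    rintro _ ⟨S, ⟨h1, h2, h3, h4, h5⟩, rfl⟩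
    exact hdom S h1 h2 h3 h5 fun _ => hcj
  · rw [if_neg (by rw [not_or]; exact ⟨hju.not_gt, hcj⟩)]
    rw [not_lt] at hcj
    have hB : ∀ S : Finset ℕ, c ∈ S →
        wsum D (c + 1) (fun q => SW D S q ∧ NW D S q ∧ NE D S q) =
        wsum D (c + 1) (fun q => SW D S q ∧ NW D S q ∧ (NE D S q ∨ D.y q ≤ D.y j)) := by
      intro S hS
      refine wsum_congr fun q hq => and_congr_right fun _ => and_congr_right fun _ =>
        ⟨.inl, ?_⟩
      rintro (h | h)
      exacts [h, ⟨c, hS, by omega, h.trans hcj⟩]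
    refine (hx'.better hb).of_le (Set.union_subset hsub ?_) ?_
    · rintro _ ⟨S, ⟨h1, h2, h3, h4⟩, rfl⟩
      exact ⟨S, ⟨h1, h3, h4, hju, c, h2, hcj⟩, by dsimp only; rw [hB S h2]⟩
    · rintro _ ⟨S, ⟨h1, h2, h3, h4, h5⟩, rfl⟩
      by_cases hcS : c ∈ S
      · exact ⟨_, .inr ⟨S, ⟨h1, hcS, h2, h3⟩, rfl⟩, (hB S hcS).ge⟩
      · obtain ⟨z, hz, hle⟩ := hdom S h1 h2 h3 h5 fun h => absurd h hcS
        exact ⟨z, .inl hz, hle⟩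

end DP
end RealRAM

/-! ### Loops, and the table of the family `KA` -/

namespace RealRAM
namespace DP

variable {D : Cols} {n c : ℕ} {env : Fin 3 → ℕ}

theorem iter_inv {α : Type*} {f : ℕ → α → α} {N : ℕ} {s : α} (P : ℕ → α → Prop) (h0 : P 0 s)
    (hs : ∀ i < N, ∀ s, P i s → P (i + 1) (f i s)) : P N (iter f N s) := by
  have : ∀ i ≤ N, P i (iter f i s) := by
    intro i
    induction i with
    | zero => exact fun _ => h0
    | succ i ih => exact fun hi => hs i (by omega) _ (ih (by omega))
  exact this N le_rfl

/-- A loop that improves the accumulator by the cells `g i` for which `P i` holds. -/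
theorem iter_improve {N : ℕ} {f : ℕ → St → St} {s : St} {P : ℕ → Prop} {g : ℕ → Cell}
    {K₀ : Set (ℝ × Finset ℕ)} {K : ℕ → Set (ℝ × Finset ℕ)}
    (hf : ∀ i < N, ∀ s' : St, s'.tab = s.tab →
      (P i → f i s' = { s' with acc := s'.acc.better (g i) }) ∧ (¬ P i → f i s' = s'))
    (h0 : Best K₀ s.acc) (hg : ∀ i < N, P i → Best (K i) (g i)) :
    (iter f N s).tab = s.tab ∧ (iter f N s).best = s.best ∧
      Best (K₀ ∪ {z | ∃ i < N, P i ∧ z ∈ K i}) (iter f N s).acc := by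
  refine iter_inv (fun m (s' : St) => s'.tab = s.tab ∧ s'.best = s.best ∧
    Best (K₀ ∪ {z | ∃ i < m, P i ∧ z ∈ K i}) s'.acc) ⟨rfl, rfl, by simpa using h0⟩ ?_
  rintro i hi s' ⟨h1, h2, h3⟩
  obtain ⟨h4, h5⟩ := hf i hi s' h1
  by_cases hP : P i
  · rw [h4 hP]
    refine ⟨h1, h2, ?_⟩
    convert h3.better (hg i hi hP) using 1
    ext z
    simp only [Set.mem_union, Set.mem_ofPred_eq]
    grind
  · rw [h5 hP]
    refine ⟨h1, h2, ?_⟩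
    convert h3 using 1
    ext z
    simp only [Set.mem_union, Set.mem_ofPred_eq]
    grind

/-! The tables `0, …, 5` belong to the families `KA`, `KR`, `KR` (with `u = c`, when it is created),
`KB`, `KM`, and to the mirror image of `KA`. The loop variables are `0` (the current column),
`1`, and `2`. -/

def lowLoop : Prog :=
  .forTo 2 (.var 0) (.seq .clear (.seq
    (.forTo 1 (.var 0) (.ite (.var 0) (.var 1) (.improve 0 (.var 1) (.var 2)) .skip))
    (.seq (.push (.var 0)) (.store 0 (.var 0) (.var 2)))))

def highLoop : Prog :=
  .forTo 1 (.var 0) (.seq .clear (.seq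
    (.forTo 2 (.var 0) (.ite (.var 2) (.var 0) (.improve 0 (.var 1) (.var 2)) .skip))
    (.seq (.push (.var 0)) (.store 0 (.var 1) (.var 0)))))

/-- Works in place, since a new entry depends only on the old one at the same position. It has
quadratically many rounds per column, but no `push`. -/
def insideLoop : Prog :=
  .forTo 1 (.var 0) (.forTo 2 (.var 0) (.ite (.var 0) (.var 1) .skip
    (.ite (.var 2) (.var 0) .skip
      (.seq (.load 0 (.var 1) (.var 2)) (.seq (.addw (.var 0)) (.store 0 (.var 1) (.var 2)))))))

/-- The update of the table `0` for a new column. -/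
def stageA : Prog :=
  .seq lowLoop (.seq highLoop (.seq insideLoop
    (.seq (.single (.var 0)) (.store 0 (.var 0) (.var 0)))))

/-- Only row `c` is written and only rows before `c` are read, so every read still sees the old
table. -/
theorem lowLoop_spec (hD : Distinct n D) (hc : c < n) (henv : env 0 = c) (s : St)
    (hA : ∀ l < c, ∀ h < c, Best (KA D c l h) (s.tab 0 l h)) :
    (lowLoop.eval n D env s).best = s.best ∧
    (∀ a l h, a ≠ 0 ∨ l ≠ c → (lowLoop.eval n D env s).tab a l h = s.tab a l h) ∧
    ∀ h < c, Best (KA D (c + 1) c h) ((lowLoop.eval n D env s).tab 0 c h) := by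
  subst henv
  refine iter_inv (fun m (s' : St) => s'.best = s.best ∧
    (∀ a l h, a ≠ 0 ∨ l ≠ env 0 → s'.tab a l h = s.tab a l h) ∧
    ∀ h < m, Best (KA D (env 0 + 1) (env 0) h) (s'.tab 0 (env 0) h)) ⟨rfl, fun _ _ _ _ => rfl, by simp⟩ ?_
  rintro h hh s' ⟨h1, h2, h3⟩
  simp only [Bnd.eval] at hh
  simp only [Prog.eval, Idx.eval, Bnd.eval, Function.update_self, ne_eq, Fin.reduceEq, not_false_eq_true,
    Function.update_of_ne]
  set f := fun i s => if D.y (env 0) < D.y i then St.mk (s.acc.better (s.tab 0 i h)) s.tab s.best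
    else s with hf
  obtain ⟨h4, h5, h6⟩ := iter_improve (N := env 0) (f := f) (s := St.mk none s'.tab s'.best)
    (P := fun l => D.y (env 0) < D.y l) (g := fun l => s'.tab 0 l h) (K₀ := ∅)
    (K := fun l => KA D (env 0) l h)
    (fun i hi t ht => ⟨fun hP => by simp [hf, hP, ht], fun hP => by simp [hf, hP]⟩)
    Best.none (fun l hl _ => by rw [h2 0 l h (.inr hl.ne)]; exact hA l hl h hh)
  refine ⟨by rw [h5]; exact h1, ?_, ?_⟩
  · rintro a l h' hal
    rw [h4]
    simp only [setTab]
    rw [if_neg (by tauto)]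
    exact h2 a l h' hal
  · intro h' hh'
    rw [h4]
    simp only [setTab, true_and]
    split_ifs with e
    · subst e
      rw [KA_low hD hc hh]
      simpa using h6.push (D := D) (env 0)
    · exact h3 h' (by omega)

theorem highLoop_spec (hD : Distinct n D) (hc : c < n) (henv : env 0 = c) (s : St)
    (hA : ∀ l < c, ∀ h < c, Best (KA D c l h) (s.tab 0 l h)) :
    (highLoop.eval n D env s).best = s.best ∧
    (∀ a l h, a ≠ 0 ∨ h ≠ c → (highLoop.eval n D env s).tab a l h = s.tab a l h) ∧
    ∀ l < c, Best (KA D (c + 1) l c) ((highLoop.eval n D env s).tab 0 l c) := by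
  subst henv
  refine iter_inv (fun m (s' : St) => s'.best = s.best ∧
    (∀ a l h, a ≠ 0 ∨ h ≠ env 0 → s'.tab a l h = s.tab a l h) ∧
    ∀ l < m, Best (KA D (env 0 + 1) l (env 0)) (s'.tab 0 l (env 0)))
    ⟨rfl, fun _ _ _ _ => rfl, by simp⟩ ?_
  rintro l hl s' ⟨h1, h2, h3⟩
  simp only [Bnd.eval] at hl
  simp only [Prog.eval, Idx.eval, Bnd.eval, Function.update_self, ne_eq, Fin.reduceEq, not_false_eq_true,
    Function.update_of_ne]
  set f := fun i s => if D.y i < D.y (env 0) then St.mk (s.acc.better (s.tab 0 l i)) s.tab s.best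
    else s with hf
  obtain ⟨h4, h5, h6⟩ := iter_improve (N := env 0) (f := f) (s := St.mk none s'.tab s'.best)
    (P := fun h => D.y h < D.y (env 0)) (g := fun h => s'.tab 0 l h) (K₀ := ∅)
    (K := fun h => KA D (env 0) l h)
    (fun i hi t ht => ⟨fun hP => by simp [hf, hP, ht], fun hP => by simp [hf, hP]⟩)
    Best.none (fun h hh _ => by rw [h2 0 l h (.inr hh.ne)]; exact hA l hl h hh)
  refine ⟨by rw [h5]; exact h1, ?_, ?_⟩
  · rintro a l' h hal
    rw [h4]
    simp only [setTab]
    rw [if_neg (by tauto)]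
    exact h2 a l' h hal
  · intro l' hl'
    rw [h4]
    simp only [setTab, true_and, and_true]
    split_ifs with e
    · subst e
      rw [KA_high hD hc hl]
      simpa using h6.push (D := D) (env 0)
    · exact h3 l' (by omega)

theorem insideLoop_spec (henv : env 0 = c) (s : St)
    (hA : ∀ l < c, ∀ h < c, Best (KA D c l h) (s.tab 0 l h)) :
    (insideLoop.eval n D env s).best = s.best ∧
    (∀ a l h, a ≠ 0 ∨ c ≤ l ∨ c ≤ h → (insideLoop.eval n D env s).tab a l h = s.tab a l h) ∧
    ∀ l < c, ∀ h < c, Best (KA D (c + 1) l h) ((insideLoop.eval n D env s).tab 0 l h) := by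
  subst henv
  refine iter_inv (fun m (s' : St) => s'.best = s.best ∧
    (∀ a l h, a ≠ 0 ∨ m ≤ l ∨ env 0 ≤ h → s'.tab a l h = s.tab a l h) ∧
    ∀ l < m, ∀ h < env 0, Best (KA D (env 0 + 1) l h) (s'.tab 0 l h))
    ⟨rfl, fun _ _ _ _ => rfl, by simp⟩ ?_
  rintro i hi s' ⟨h1, h2, h3⟩
  simp only [Bnd.eval] at hi
  refine (?_ : _ ∧ _ ∧ ∀ l h, h < env 0 → l < i + 1 → _).imp_right
    (And.imp_right fun H l hl h hh => H l h hh hl)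
  -- The pairs are processed in lexicographic order: those before `(i, m)` hold new entries, the
  -- others old ones.
  have := iter_inv (f := fun j s => Prog.eval n D (.ite (.var 0) (.var 1) .skip
    (.ite (.var 2) (.var 0) .skip (.seq (.load 0 (.var 1) (.var 2)) (.seq (.addw (.var 0))
      (.store 0 (.var 1) (.var 2)))))) (Function.update (Function.update env 1 i) 2 j) s)
    (N := env 0) (s := s') (fun m (t : St) => t.best = s.best ∧
    (∀ a l h, a ≠ 0 ∨ i < l ∨ (l = i ∧ m ≤ h) ∨ env 0 ≤ h → t.tab a l h = s.tab a l h) ∧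
    ∀ l h, h < env 0 → l < i ∨ l = i ∧ h < m → Best (KA D (env 0 + 1) l h) (t.tab 0 l h))
    ⟨h1, fun a l h hh => h2 a l h (by omega), fun l h hh hl => h3 l (by omega) h hh⟩ ?_
  · obtain ⟨h4, h5, h6⟩ := this
    exact ⟨h4, fun a l h hh => h5 a l h (by omega), fun l h hh hl => h6 l h hh (by omega)⟩
  rintro j hj t ⟨h4, h5, h6⟩
  have hb := (hA i hi j hj).KA_succ hi hj
  have ht := h5 0 i j (by omega)
  have hkeep : (D.y (env 0) < D.y i ∨ D.y j < D.y (env 0)) →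
      t.best = s.best ∧
      (∀ a l h, a ≠ 0 ∨ i < l ∨ (l = i ∧ j + 1 ≤ h) ∨ env 0 ≤ h → t.tab a l h = s.tab a l h) ∧
      ∀ l h, h < env 0 → l < i ∨ l = i ∧ h < j + 1 → Best (KA D (env 0 + 1) l h) (t.tab 0 l h) := by
    intro hy
    refine ⟨h4, fun a l h hh => h5 a l h (by omega), fun l h hh hl => ?_⟩
    by_cases e : l = i ∧ h = j
    · obtain ⟨rfl, rfl⟩ := e
      rw [if_pos hy] at hb
      rwa [ht]
    · exact h6 l h hh (by omega)
  simp only [Prog.eval, Idx.eval, Function.update_self, ne_eq, Fin.reduceEq, not_false_eq_true,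
    Function.update_of_ne]
  split_ifs with c1 c2
  · exact hkeep (.inl c1)
  · exact hkeep (.inr c2)
  · rw [if_neg (by tauto)] at hb
    refine ⟨h4, fun a l h hh => ?_, fun l h hh hl => ?_⟩
    · simp only [setTab]
      rw [if_neg (by rintro ⟨rfl, rfl, rfl⟩; omega)]
      exact h5 a l h (by omega)
    · simp only [setTab, true_and]
      split_ifs with e
      · obtain ⟨rfl, rfl⟩ := e
        rwa [ht]
      · exact h6 l h hh (by omega)

/-- The new row and the new column are built first, because they read the old entries that
`insideLoop` then overwrites. -/
theorem stageA_spec (hD : Distinct n D) (hc : c < n) (henv : env 0 = c) (s : St)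
    (hA : ∀ l < c, ∀ h < c, Best (KA D c l h) (s.tab 0 l h)) :
    (stageA.eval n D env s).best = s.best ∧
    (∀ a l h, a ≠ 0 → (stageA.eval n D env s).tab a l h = s.tab a l h) ∧
    ∀ l < c + 1, ∀ h < c + 1, Best (KA D (c + 1) l h) ((stageA.eval n D env s).tab 0 l h) := by
  obtain ⟨a1, a2, a3⟩ := lowLoop_spec hD hc henv s hA
  set s1 := lowLoop.eval n D env s with hs1
  have hA1 : ∀ l < c, ∀ h < c, Best (KA D c l h) (s1.tab 0 l h) := fun l hl h hh => by
    rw [a2 0 l h (by omega)]; exact hA l hl h hh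
  obtain ⟨b1, b2, b3⟩ := highLoop_spec hD hc henv s1 hA1
  set s2 := highLoop.eval n D env s1 with hs2
  have hA2 : ∀ l < c, ∀ h < c, Best (KA D c l h) (s2.tab 0 l h) := fun l hl h hh => by
    rw [b2 0 l h (by omega)]; exact hA1 l hl h hh
  obtain ⟨c1, c2, c3⟩ := insideLoop_spec (n := n) henv s2 hA2
  set s3 := insideLoop.eval n D env s2 with hs3
  simp only [stageA, Prog.eval, Idx.eval, ← hs1, ← hs2, ← hs3, henv]
  refine ⟨by rw [c1, b1, a1], fun a l h ha => ?_, fun l hl h hh => ?_⟩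
  · simp only [setTab, ha, false_and, if_false]
    rw [c2 a l h (.inl ha), b2 a l h (.inl ha), a2 a l h (.inl ha)]
  · simp only [setTab, true_and]
    split_ifs with e
    · obtain ⟨rfl, rfl⟩ := e
      rw [KA_self hD hc]
      exact Best.single _
    · by_cases hl' : l = c
      · subst hl'
        rw [c2 0 l h (by omega), b2 0 l h (by omega)]
        exact a3 h (by omega)
      · by_cases hh' : h = c
        · subst hh'
          rw [c2 0 l h (by omega)]
          exact b3 l (by omega)
        · exact c3 l (by omega) h (by omega)

end DP
end RealRAM

/-! ### Loops for the families `KR`, `KB` and `KM` -/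

namespace RealRAM
namespace DP

variable {D : Cols} {n c : ℕ} {env : Fin 3 → ℕ}

/-- The results go to table `2`, whose row `c` is never changed afterwards: the final combination
needs the values for sets ending at their lowest point, while the copy in table `1` is advanced with
each later column. -/
def startLoop : Prog :=
  .forTo 2 .size (.seq .clear (.seq (.ite (.var 2) (.var 0) .skip
    (.seq (.load 4 .zero (.var 2)) (.seq
      (.forTo 1 (.var 0) (.ite (.var 0) (.var 1) (.improve 1 (.var 1) (.var 2)) .skip))
      (.seq (.push (.var 0)) (.ite (.var 0) (.var 2) .skip (.improve 0 (.var 0) (.var 0)))))))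
    (.store 2 (.var 0) (.var 2))))

/-- Sets ending in column `c` are needed only while `c` is processed, so one row of table `3` is
reused for all columns. -/
def consumeLoop : Prog :=
  .seq (.forTo 1 (.var 0) (.seq (.load 1 (.var 1) (.var 0)) (.seq (.push (.var 0))
    (.seq (.improve 0 (.var 1) (.var 0)) (.store 3 .zero (.var 1))))))
    (.seq (.load 2 (.var 0) (.var 0)) (.store 3 .zero (.var 0)))

/-- Follows the case distinction of `Best.KR_succ`. With quadratically many rounds per column it
must not allocate; selected points enter through the ready-made lists of table `3`. -/
def advanceLoop : Prog :=
  .forTo 1 (.var 0) (.forTo 2 .size (.seq (.load 1 (.var 1) (.var 2)) (.seq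
    (.ite (.var 0) (.var 1) .skip (.ite (.var 2) (.var 0) .skip (.addw (.var 0)))) (.seq
    (.ite (.var 2) (.var 1) .skip (.ite (.var 0) (.var 2) .skip (.improve 3 .zero (.var 1))))
    (.store 1 (.var 1) (.var 2))))))

def copyLoop : Prog :=
  .forTo 2 .size (.seq (.load 2 (.var 0) (.var 2)) (.store 1 (.var 0) (.var 2)))

def aboveLoop : Prog :=
  .forTo 2 .size (.seq (.load 4 .zero (.var 2)) (.seq
    (.forTo 1 (.succ 0) (.ite (.var 2) (.var 1) (.improve 3 .zero (.var 1)) .skip))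
    (.store 4 .zero (.var 2))))

theorem startLoop_spec (hD : Distinct n D) (hc : c < n) (henv : env 0 = c) (s : St)
    (hA : Best (KA D (c + 1) c c) (s.tab 0 c c))
    (hM : ∀ j < n, Best (KM D c j) (s.tab 4 0 j))
    (hR : ∀ u < c, ∀ j < n, Best (KR D c u j) (s.tab 1 u j)) :
    (startLoop.eval n D env s).best = s.best ∧
    (∀ a l h, a ≠ 2 ∨ l ≠ c → (startLoop.eval n D env s).tab a l h = s.tab a l h) ∧
    ∀ j < n, Best (KR D (c + 1) c j) ((startLoop.eval n D env s).tab 2 c j) := by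
  subst henv
  refine iter_inv (fun m (s' : St) => s'.best = s.best ∧
    (∀ a l h, a ≠ 2 ∨ l ≠ env 0 → s'.tab a l h = s.tab a l h) ∧
    ∀ j < m, Best (KR D (env 0 + 1) (env 0) j) (s'.tab 2 (env 0) j))
    ⟨rfl, fun _ _ _ _ => rfl, by simp⟩ ?_
  rintro j hj s' ⟨h1, h2, h3⟩
  simp only [Bnd.eval] at hj
  have key : ∀ t : St, t.tab = s'.tab → t.best = s'.best →
      Best (KR D (env 0 + 1) (env 0) j) t.acc →
      (Prog.eval n D (.store 2 (.var 0) (.var 2)) (Function.update env 2 j) t).best = s.best ∧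
      (∀ a l h, a ≠ 2 ∨ l ≠ env 0 → (Prog.eval n D (.store 2 (.var 0) (.var 2))
        (Function.update env 2 j) t).tab a l h = s.tab a l h) ∧
      ∀ j' < j + 1, Best (KR D (env 0 + 1) (env 0) j') ((Prog.eval n D (.store 2 (.var 0) (.var 2))
        (Function.update env 2 j) t).tab 2 (env 0) j') := by
    intro t ht ht' hacc
    simp only [Prog.eval, Idx.eval, Function.update_self, ne_eq, Fin.reduceEq, not_false_eq_true,
      Function.update_of_ne, ht]
    refine ⟨ht'.trans h1, fun a l h hal => ?_, fun j' hj' => ?_⟩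
    · simp only [setTab]
      rw [if_neg (by tauto)]
      exact h2 a l h hal
    · simp only [setTab, true_and]
      split_ifs with e
      · subst e; exact hacc
      · exact h3 j' (by omega)
  simp only [Prog.eval] at key ⊢
  simp only [Idx.eval, Bnd.eval, Function.update_self, ne_eq, Fin.reduceEq, not_false_eq_true,
    Function.update_of_ne] at key ⊢
  by_cases hcj : D.y j < D.y (env 0)
  · rw [if_pos hcj]
    refine key ⟨none, s'.tab, s'.best⟩ rfl rfl ?_
    rw [KR_eq_empty hcj]
    exact Best.none
  rw [if_neg hcj]
  set f := fun i s => if D.y (env 0) < D.y i then St.mk (s.acc.better (s.tab 1 i j)) s.tab s.best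
    else s with hf
  have e4 : s'.tab 4 0 j = s.tab 4 0 j := h2 4 0 j (.inl (by decide))
  obtain ⟨h4, h5, h6⟩ := iter_improve (N := env 0) (f := f)
    (s := St.mk (s'.tab 4 0 j) s'.tab s'.best)
    (P := fun l => D.y (env 0) < D.y l) (g := fun l => s'.tab 1 l j) (K₀ := KM D (env 0) j)
    (K := fun l => KR D (env 0) l j)
    (fun i hi t ht => ⟨fun hP => by simp [hf, hP, ht], fun hP => by simp [hf, hP]⟩)
    (by rw [e4]; exact hM j hj)
    (fun u hu _ => by rw [h2 1 u j (.inl (by decide))]; exact hR u hu j hj)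
  have h7 := h6.push (D := D) (env 0)
  have e0 : s'.tab 0 (env 0) (env 0) = s.tab 0 (env 0) (env 0) := h2 0 _ _ (.inl (by decide))
  split_ifs with hjc
  · refine key _ h4 h5 ?_
    rw [KR_self hD hc hj (not_lt.1 hcj)]
    convert h7 using 1
    have : j ≠ env 0 := by rintro rfl; exact lt_irrefl _ hjc
    ext z
    simp [this]
  -- Neither height is smaller than the other, so `j` is the current column. Only here does the
  -- singleton case of `KR_self` occur; its solution is taken from table `0`.
  · have : j = env 0 := hD j hj _ hc (le_antisymm (not_lt.1 hjc) (not_lt.1 hcj))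
    refine key (St.mk _ _ _) h4 h5 ?_
    rw [KR_self hD hc hj (not_lt.1 hcj)]
    convert h7.better hA using 1
    · rw [KA_self hD hc]
      congr 1
      ext z
      simp [this]
    · simp only
      rw [h4]
      simp only [e0]

theorem consumeLoop_spec (henv : env 0 = c) (hc : c < n) (s : St)
    (hA : ∀ u < c, Best (KA D (c + 1) u c) (s.tab 0 u c))
    (hR : ∀ u < c, ∀ j < n, Best (KR D c u j) (s.tab 1 u j))
    (hT : Best (KR D (c + 1) c c) (s.tab 2 c c)) :
    (consumeLoop.eval n D env s).best = s.best ∧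
    (∀ a l h, a ≠ 3 → (consumeLoop.eval n D env s).tab a l h = s.tab a l h) ∧
    ∀ u < c + 1, Best (KB D c u) ((consumeLoop.eval n D env s).tab 3 0 u) := by
  subst henv
  have := iter_inv (N := env 0) (s := s) (f := fun i s => Prog.eval n D
    (.seq (.load 1 (.var 1) (.var 0)) (.seq (.push (.var 0))
    (.seq (.improve 0 (.var 1) (.var 0)) (.store 3 .zero (.var 1))))) (Function.update env 1 i) s)
    (fun m (s' : St) => s'.best = s.best ∧
    (∀ a l h, a ≠ 3 → s'.tab a l h = s.tab a l h) ∧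
    ∀ u < m, Best (KB D (env 0) u) (s'.tab 3 0 u)) ⟨rfl, fun _ _ _ _ => rfl, by simp⟩ ?_
  · obtain ⟨h1, h2, h3⟩ := this
    simp only [consumeLoop, Prog.eval] at h1 h2 h3 ⊢
    simp only [Idx.eval, Bnd.eval, Function.update_self, ne_eq, Fin.reduceEq, not_false_eq_true,
      Function.update_of_ne] at h1 h2 h3 ⊢
    refine ⟨h1, fun a l h ha => ?_, fun u hu => ?_⟩
    · simp only [setTab, ha, false_and, if_false]
      exact h2 a l h ha
    · simp only [setTab, true_and]
      split_ifs with e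
      · subst e
        rw [h2 2 _ _ (by decide), KB_self]
        exact hT
      · exact h3 u (by omega)
  rintro u hu s' ⟨h1, h2, h3⟩
  simp only [Prog.eval, Idx.eval, Function.update_self, ne_eq, Fin.reduceEq, not_false_eq_true,
    Function.update_of_ne]
  refine ⟨h1, fun a l h ha => ?_, fun u' hu' => ?_⟩
  · simp only [setTab, ha, false_and, if_false]
    exact h2 a l h ha
  · simp only [setTab, true_and]
    split_ifs with e
    · subst e
      rw [h2 1 _ _ (by decide), h2 0 _ _ (by decide), KB_of_lt hu]
      exact ((hR u' hu _ hc).push _).better (hA u' hu)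
    · exact h3 u' (by omega)

theorem advanceLoop_spec (henv : env 0 = c) (s : St)
    (hB : ∀ u < c, Best (KB D c u) (s.tab 3 0 u))
    (hR : ∀ u < c, ∀ j < n, Best (KR D c u j) (s.tab 1 u j)) :
    (advanceLoop.eval n D env s).best = s.best ∧
    (∀ a l h, a ≠ 1 → (advanceLoop.eval n D env s).tab a l h = s.tab a l h) ∧
    ∀ u < c, ∀ j < n, Best (KR D (c + 1) u j) ((advanceLoop.eval n D env s).tab 1 u j) := by
  subst henv
  suffices H : (advanceLoop.eval n D env s).best = s.best ∧
    (∀ a l h, a ≠ 1 ∨ env 0 ≤ l → (advanceLoop.eval n D env s).tab a l h = s.tab a l h) ∧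
    ∀ u < env 0, ∀ j < n, Best (KR D (env 0 + 1) u j) ((advanceLoop.eval n D env s).tab 1 u j) from
    ⟨H.1, fun a l h ha => H.2.1 a l h (.inl ha), H.2.2⟩
  refine iter_inv (fun m (s' : St) => s'.best = s.best ∧
    (∀ a l h, a ≠ 1 ∨ m ≤ l → s'.tab a l h = s.tab a l h) ∧
    ∀ u < m, ∀ j < n, Best (KR D (env 0 + 1) u j) (s'.tab 1 u j))
    ⟨rfl, fun _ _ _ _ => rfl, by simp⟩ ?_
  rintro i hi s' ⟨h1, h2, h3⟩
  simp only [Bnd.eval] at hi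
  refine (?_ : _ ∧ _ ∧ ∀ l h, h < n → l < i + 1 → _).imp_right
    (And.imp_right fun H l hl h hh => H l h hh hl)
  have := iter_inv (f := fun j s => Prog.eval n D (.seq (.load 1 (.var 1) (.var 2)) (.seq
    (.ite (.var 0) (.var 1) .skip (.ite (.var 2) (.var 0) .skip (.addw (.var 0)))) (.seq
    (.ite (.var 2) (.var 1) .skip (.ite (.var 0) (.var 2) .skip (.improve 3 .zero (.var 1))))
    (.store 1 (.var 1) (.var 2))))) (Function.update (Function.update env 1 i) 2 j) s)
    (N := n) (s := s') (fun m (t : St) => t.best = s.best ∧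
    (∀ a l h, a ≠ 1 ∨ i < l ∨ (l = i ∧ m ≤ h) → t.tab a l h = s.tab a l h) ∧
    ∀ l h, h < n → l < i ∨ l = i ∧ h < m → Best (KR D (env 0 + 1) l h) (t.tab 1 l h))
    ⟨h1, fun a l h hh => h2 a l h (by omega), fun l h hh hl => h3 l (by omega) h hh⟩ ?_
  · obtain ⟨h4, h5, h6⟩ := this
    exact ⟨h4, fun a l h hh => h5 a l h (by omega), fun l h hh hl => h6 l h hh (by omega)⟩
  rintro j hj t ⟨h4, h5, h6⟩
  have hb := (hR i hi j hj).KR_succ hi (hB i hi)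
  rw [← h5 1 i j (by omega), ← h5 3 0 i (.inl (by decide))] at hb
  have key : ∀ t' : St, t'.tab = t.tab → t'.best = t.best →
      Best (KR D (env 0 + 1) i j) t'.acc →
      (Prog.eval n D (.store 1 (.var 1) (.var 2)) (Function.update (Function.update env 1 i) 2 j)
        t').best = s.best ∧
      (∀ a l h, a ≠ 1 ∨ i < l ∨ (l = i ∧ j + 1 ≤ h) → (Prog.eval n D (.store 1 (.var 1) (.var 2))
        (Function.update (Function.update env 1 i) 2 j) t').tab a l h = s.tab a l h) ∧
      ∀ l h, h < n → l < i ∨ l = i ∧ h < j + 1 → Best (KR D (env 0 + 1) l h)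
        ((Prog.eval n D (.store 1 (.var 1) (.var 2))
          (Function.update (Function.update env 1 i) 2 j) t').tab 1 l h) := by
    intro t' ht ht' hacc
    simp only [Prog.eval, Idx.eval, Function.update_self, ne_eq, Fin.reduceEq, not_false_eq_true,
      Function.update_of_ne, ht]
    refine ⟨ht'.trans h4, fun a l h hal => ?_, fun l h hh hl => ?_⟩
    · simp only [setTab]
      rw [if_neg (by rintro ⟨rfl, rfl, rfl⟩; omega)]
      exact h5 a l h (by omega)
    · simp only [setTab, true_and]
      split_ifs with e
      · obtain ⟨rfl, rfl⟩ := e; exact hacc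
      · exact h6 l h hh (by omega)
  simp only [Prog.eval] at key ⊢
  simp only [Idx.eval, Function.update_self, ne_eq, Fin.reduceEq, not_false_eq_true,
    Function.update_of_ne] at key ⊢
  refine key _ ?_ ?_ ?_
  · split_ifs <;> rfl
  · split_ifs <;> rfl
  · convert hb using 1
    by_cases c1 : D.y (env 0) < D.y i <;> by_cases c2 : D.y j < D.y (env 0) <;>
      by_cases c3 : D.y j < D.y i <;> by_cases c4 : D.y (env 0) < D.y j <;>
      simp only [c1, c2, c3, c4, if_true, if_false, or_true, or_false]

theorem copyLoop_spec (henv : env 0 = c) (s : St) :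
    (copyLoop.eval n D env s).best = s.best ∧
    (∀ a l h, a ≠ 1 ∨ l ≠ c → (copyLoop.eval n D env s).tab a l h = s.tab a l h) ∧
    ∀ j < n, (copyLoop.eval n D env s).tab 1 c j = s.tab 2 c j := by
  subst henv
  refine iter_inv (fun m (s' : St) => s'.best = s.best ∧
    (∀ a l h, a ≠ 1 ∨ l ≠ env 0 → s'.tab a l h = s.tab a l h) ∧
    ∀ j < m, s'.tab 1 (env 0) j = s.tab 2 (env 0) j) ⟨rfl, fun _ _ _ _ => rfl, by simp⟩ ?_
  rintro j hj s' ⟨h1, h2, h3⟩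
  simp only [Prog.eval, Idx.eval, Function.update_self, ne_eq, Fin.reduceEq, not_false_eq_true,
    Function.update_of_ne]
  refine ⟨h1, fun a l h hal => ?_, fun j' hj' => ?_⟩
  · simp only [setTab]
    rw [if_neg (by tauto)]
    exact h2 a l h hal
  · simp only [setTab, true_and]
    split_ifs with e
    · subst e; exact h2 2 _ _ (.inl (by decide))
    · exact h3 j' (by omega)

theorem aboveLoop_spec (henv : env 0 = c) (s : St)
    (hM : ∀ j < n, Best (KM D c j) (s.tab 4 0 j))
    (hB : ∀ u < c + 1, Best (KB D c u) (s.tab 3 0 u)) :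
    (aboveLoop.eval n D env s).best = s.best ∧
    (∀ a l h, a ≠ 4 → (aboveLoop.eval n D env s).tab a l h = s.tab a l h) ∧
    ∀ j < n, Best (KM D (c + 1) j) ((aboveLoop.eval n D env s).tab 4 0 j) := by
  subst henv
  suffices H : (aboveLoop.eval n D env s).best = s.best ∧
    (∀ a l h, a ≠ 4 ∨ n ≤ h → (aboveLoop.eval n D env s).tab a l h = s.tab a l h) ∧
    ∀ j < n, Best (KM D (env 0 + 1) j) ((aboveLoop.eval n D env s).tab 4 0 j) from
    ⟨H.1, fun a l h ha => H.2.1 a l h (.inl ha), H.2.2⟩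
  refine iter_inv (fun m (s' : St) => s'.best = s.best ∧
    (∀ a l h, a ≠ 4 ∨ m ≤ h → s'.tab a l h = s.tab a l h) ∧
    ∀ j < m, Best (KM D (env 0 + 1) j) (s'.tab 4 0 j))
    ⟨rfl, fun _ _ _ _ => rfl, by simp⟩ ?_
  rintro j hj s' ⟨h1, h2, h3⟩
  simp only [Bnd.eval] at hj
  simp only [Prog.eval, Idx.eval, Bnd.eval, Function.update_self, ne_eq, Fin.reduceEq,
    not_false_eq_true, Function.update_of_ne]
  set f := fun i s => if D.y j < D.y i then St.mk (s.acc.better (s.tab 3 0 i)) s.tab s.best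
    else s with hf
  obtain ⟨h4, h5, h6⟩ := iter_improve (N := env 0 + 1) (f := f)
    (s := St.mk (s'.tab 4 0 j) s'.tab s'.best)
    (P := fun l => D.y j < D.y l) (g := fun l => s'.tab 3 0 l) (K₀ := KM D (env 0) j)
    (K := fun l => KB D (env 0) l)
    (fun i hi t ht => ⟨fun hP => by simp [hf, hP, ht], fun hP => by simp [hf, hP]⟩)
    (by rw [h2 4 0 j (by omega)]; exact hM j hj)
    (fun u hu _ => by rw [h2 3 0 u (.inl (by decide))]; exact hB u hu)
  refine ⟨h5.trans h1, fun a l h hal => ?_, fun j' hj' => ?_⟩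
  · simp only [setTab]
    rw [if_neg (by rintro ⟨rfl, rfl, rfl⟩; omega), h4]
    exact h2 a l h (by omega)
  · simp only [setTab, true_and]
    split_ifs with e
    · subst e
      rw [KM_succ]
      exact h6
    · rw [h4]
      exact h3 j' (by omega)

end DP
end RealRAM

/-! ### The passes over the columns -/

namespace RealRAM
namespace DP

variable {D : Cols} {n c : ℕ} {env : Fin 3 → ℕ}

def stageB : Prog :=
  .seq startLoop (.seq consumeLoop (.seq advanceLoop (.seq copyLoop aboveLoop)))

/-- Only `KM` has to be reset. The invariants of the other tables concern indices below the current
column, so leftovers of an earlier pass are harmless; the invariant of `KM` concerns all rows from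
the start. -/
def clearLoop : Prog := .forTo 2 .size (.seq .clear (.store 4 .zero (.var 2)))

def forwardPass : Prog := .seq clearLoop (.forTo 0 .size (.seq stageA stageB))

/-- Row `c` of table `0` will be altered by later columns, whereas the combination needs its state
right after column `c`. -/
def saveLoop : Prog :=
  .forTo 2 (.succ 0) (.seq (.load 0 (.var 0) (.var 2)) (.store 5 (.var 0) (.var 2)))

def mirrorPass : Prog := .forTo 0 .size (.seq stageA saveLoop)

/-- Mirrored columns `c` and `j` stand for `b = n - 1 - c` and `v = n - 1 - j`; the bound `j ≤ c`
says that `v` is not to the left of `b`. -/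
def combinePass : Prog :=
  .forTo 0 .size (.forTo 2 (.succ 0) (.combine 2 (.rev 0) (.rev 2) 5 (.var 0) (.var 2)))

/-- The order of the loops matters: `startLoop` and `consumeLoop` read the old tables `1` and `4`,
which are updated only after that. -/
theorem stageB_spec (hD : Distinct n D) (hc : c < n) (henv : env 0 = c) (s : St)
    (hA : ∀ l < c + 1, ∀ h < c + 1, Best (KA D (c + 1) l h) (s.tab 0 l h))
    (hM : ∀ j < n, Best (KM D c j) (s.tab 4 0 j))
    (hR : ∀ u < c, ∀ j < n, Best (KR D c u j) (s.tab 1 u j)) :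
    (stageB.eval n D env s).best = s.best ∧
    (∀ l h, (stageB.eval n D env s).tab 0 l h = s.tab 0 l h ∧
      (stageB.eval n D env s).tab 5 l h = s.tab 5 l h ∧
      (l ≠ c → (stageB.eval n D env s).tab 2 l h = s.tab 2 l h)) ∧
    (∀ j < n, Best (KR D (c + 1) c j) ((stageB.eval n D env s).tab 2 c j)) ∧
    (∀ j < n, Best (KM D (c + 1) j) ((stageB.eval n D env s).tab 4 0 j)) ∧
    ∀ u < c + 1, ∀ j < n, Best (KR D (c + 1) u j) ((stageB.eval n D env s).tab 1 u j) := by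
  obtain ⟨a1, a2, a3⟩ := startLoop_spec hD hc henv s (hA c (by omega) c (by omega)) hM hR
  set s1 := startLoop.eval n D env s with hs1
  obtain ⟨b1, b2, b3⟩ := consumeLoop_spec henv hc s1
    (fun u hu => by rw [a2 0 _ _ (.inl (by decide))]; exact hA u (by omega) c (by omega))
    (fun u hu j hj => by rw [a2 1 _ _ (.inl (by decide))]; exact hR u hu j hj) (a3 c hc)
  set s2 := consumeLoop.eval n D env s1 with hs2
  obtain ⟨c1, c2, c3⟩ := advanceLoop_spec (n := n) henv s2 (fun u hu => b3 u (by omega))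
    (fun u hu j hj => by
      rw [b2 1 _ _ (by decide), a2 1 _ _ (.inl (by decide))]; exact hR u hu j hj)
  set s3 := advanceLoop.eval n D env s2 with hs3
  obtain ⟨d1, d2, d3⟩ := copyLoop_spec (D := D) (n := n) henv s3
  set s4 := copyLoop.eval n D env s3 with hs4
  obtain ⟨e1, e2, e3⟩ := aboveLoop_spec (n := n) henv s4
    (fun j hj => by
      rw [d2 4 _ _ (.inl (by decide)), c2 4 _ _ (by decide), b2 4 _ _ (by decide),
        a2 4 _ _ (.inl (by decide))]
      exact hM j hj)
    (fun u hu => by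
      rw [d2 3 _ _ (.inl (by decide)), c2 3 _ _ (by decide)]
      exact b3 u hu)
  have hkeep : ∀ a l h, a ≠ 1 → a ≠ 2 ∨ l ≠ c → a ≠ 3 → a ≠ 4 →
      (aboveLoop.eval n D env s4).tab a l h = s.tab a l h := fun a l h h1 h2 h3 h4 => by
    rw [e2 a l h h4, d2 a l h (.inl h1), c2 a l h h1, b2 a l h h3, a2 a l h h2]
  have h2 : ∀ j, s3.tab 2 c j = s1.tab 2 c j := fun j => by
    rw [c2 2 _ _ (by decide), b2 2 _ _ (by decide)]
  simp only [stageB, Prog.eval, ← hs1, ← hs2, ← hs3, ← hs4]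
  refine ⟨by rw [e1, d1, c1, b1, a1], fun l h => ⟨hkeep 0 l h (by decide) (.inl (by decide))
    (by decide) (by decide), hkeep 5 l h (by decide) (.inl (by decide)) (by decide) (by decide),
    fun hl => hkeep 2 l h (by decide) (.inr hl) (by decide) (by decide)⟩, fun j hj => ?_, e3,
    fun u hu j hj => ?_⟩
  · rw [e2 2 _ _ (by decide), d2 2 _ _ (.inl (by decide)), h2]
    exact a3 j hj
  · rw [e2 1 _ _ (by decide)]
    by_cases h : u = c
    · subst h
      rw [d3 j hj, h2]
      exact a3 j hj
    · rw [d2 1 _ _ (.inr h)]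
      exact c3 u (by omega) j hj

theorem clearLoop_spec (s : St) :
    (clearLoop.eval n D env s).best = s.best ∧
    (∀ a l h, a ≠ 4 → (clearLoop.eval n D env s).tab a l h = s.tab a l h) ∧
    ∀ j < n, (clearLoop.eval n D env s).tab 4 0 j = none := by
  refine iter_inv (fun m (s' : St) => s'.best = s.best ∧
    (∀ a l h, a ≠ 4 → s'.tab a l h = s.tab a l h) ∧ ∀ j < m, s'.tab 4 0 j = none)
    ⟨rfl, fun _ _ _ _ => rfl, by simp⟩ ?_
  rintro j hj s' ⟨h1, h2, h3⟩
  simp only [Prog.eval, Idx.eval, Function.update_self]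
  refine ⟨h1, fun a l h ha => ?_, fun j' hj' => ?_⟩
  · simp only [setTab, ha, false_and, if_false]
    exact h2 a l h ha
  · simp only [setTab, true_and]
    split_ifs with e
    · rfl
    · exact h3 j' (by omega)

theorem forwardPass_spec (hD : Distinct n D) (s : St) :
    (forwardPass.eval n D env s).best = s.best ∧
    (∀ l h, (forwardPass.eval n D env s).tab 5 l h = s.tab 5 l h) ∧
    ∀ b < n, ∀ j < n, Best (KR D (b + 1) b j) ((forwardPass.eval n D env s).tab 2 b j) := by
  obtain ⟨a1, a2, a3⟩ := clearLoop_spec (D := D) (n := n) (env := env) s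
  have := iter_inv (N := n) (s := clearLoop.eval n D env s)
    (f := fun i s => Prog.eval n D (.seq stageA stageB) (Function.update env 0 i) s)
    (fun c (t : St) => t.best = s.best ∧ (∀ l h, t.tab 5 l h = s.tab 5 l h) ∧
    (∀ b < c, ∀ j < n, Best (KR D (b + 1) b j) (t.tab 2 b j)) ∧
    (∀ l < c, ∀ h < c, Best (KA D c l h) (t.tab 0 l h)) ∧
    (∀ j < n, Best (KM D c j) (t.tab 4 0 j)) ∧
    (∀ u < c, ∀ j < n, Best (KR D c u j) (t.tab 1 u j))) ?_ ?_
  · exact ⟨this.1, this.2.1, this.2.2.1⟩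
  · refine ⟨a1, fun l h => a2 5 l h (by decide), by simp, by simp, fun j hj => ?_, by simp⟩
    rw [a3 j hj, KM_zero]
    exact Best.none
  · rintro c hc t ⟨h1, h2, h3, h4, h5, h6⟩
    obtain ⟨b1, b2, b3⟩ := stageA_spec hD hc (env := Function.update env 0 c) (by simp) t h4
    obtain ⟨c1, c2, c3, c4, c5⟩ := stageB_spec hD hc (env := Function.update env 0 c) (by simp) _
      b3 (fun j hj => by rw [b2 4 _ _ (by decide)]; exact h5 j hj)
      (fun u hu j hj => by rw [b2 1 _ _ (by decide)]; exact h6 u hu j hj)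
    simp only [Prog.eval]
    refine ⟨by rw [c1, b1, h1], fun l h => ?_, fun b hb j hj => ?_, fun l hl h hh => ?_, c4, c5⟩
    · rw [(c2 l h).2.1, b2 5 _ _ (by decide), h2]
    · by_cases e : b = c
      · subst e; exact c3 j hj
      · rw [(c2 b j).2.2 e, b2 2 _ _ (by decide)]
        exact h3 b (by omega) j hj
    · rw [(c2 l h).1]
      exact b3 l hl h hh

theorem mirrorPass_spec (hD : Distinct n D) (s : St) :
    (mirrorPass.eval n D env s).best = s.best ∧
    ∀ c < n, ∀ h ≤ c, Best (KA D (c + 1) c h) ((mirrorPass.eval n D env s).tab 5 c h) := by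
  have := iter_inv (N := n) (s := s)
    (f := fun i s => Prog.eval n D (.seq stageA saveLoop) (Function.update env 0 i) s)
    (fun c (t : St) => t.best = s.best ∧
    (∀ b < c, ∀ h ≤ b, Best (KA D (b + 1) b h) (t.tab 5 b h)) ∧
    (∀ l < c, ∀ h < c, Best (KA D c l h) (t.tab 0 l h))) ⟨rfl, by simp, by simp⟩ ?_
  · exact ⟨this.1, this.2.1⟩
  rintro c hc t ⟨h1, h2, h3⟩
  obtain ⟨b1, b2, b3⟩ := stageA_spec hD hc (env := Function.update env 0 c) (by simp) t h3
  simp only [Prog.eval]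
  set t' := stageA.eval n D (Function.update env 0 c) t
  have := iter_inv (N := c + 1) (s := t') (f := fun j s => Prog.eval n D
    (.seq (.load 0 (.var 0) (.var 2)) (.store 5 (.var 0) (.var 2)))
      (Function.update (Function.update env 0 c) 2 j) s)
    (fun m (s' : St) => s'.best = t'.best ∧
    (∀ a l h, a ≠ 5 ∨ l ≠ c → s'.tab a l h = t'.tab a l h) ∧
    ∀ j < m, s'.tab 5 c j = t'.tab 0 c j) ⟨rfl, fun _ _ _ _ => rfl, by simp⟩ ?_
  · obtain ⟨d1, d2, d3⟩ := this
    simp only [saveLoop, Prog.eval, Bnd.eval, Function.update_self] at d1 d2 d3 ⊢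
    refine ⟨by rw [d1, b1, h1], fun b hb h hh => ?_, fun l hl h hh => ?_⟩
    · by_cases e : b = c
      · subst e
        rw [d3 h (by omega)]
        exact b3 b (by omega) h (by omega)
      · rw [d2 5 b h (.inr e), b2 5 _ _ (by decide)]
        exact h2 b (by omega) h hh
    · rw [d2 0 l h (.inl (by decide))]
      exact b3 l hl h hh
  rintro j hj s' ⟨d1, d2, d3⟩
  simp only [Prog.eval, Idx.eval, Function.update_self, ne_eq, Fin.reduceEq, not_false_eq_true,
    Function.update_of_ne]
  refine ⟨d1, fun a l h hal => ?_, fun j' hj' => ?_⟩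
  · simp only [setTab]
    rw [if_neg (by tauto)]
    exact d2 a l h hal
  · simp only [setTab, true_and]
    split_ifs with e
    · subst e; exact d2 0 _ _ (.inl (by decide))
    · exact d3 j' (by omega)

/-- The predicate `P` carries soundness (the stored value belongs to the stored set); the other two
conclusions carry optimality. -/
theorem combinePass_spec (s : St) (P : ℝ × Finset ℕ → Prop) (h0 : P s.best)
    (hP : ∀ c < n, ∀ j ≤ c, ∀ x z, s.tab 2 (n - 1 - c) (n - 1 - j) = some x → s.tab 5 c j = some z →
      P (x.1 - D.w (n - 1 - c) + z.1, x.2 ∪ z.2)) :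
    P (combinePass.eval n D env s).best ∧ s.best.1 ≤ (combinePass.eval n D env s).best.1 ∧
    ∀ c < n, ∀ j ≤ c, ∀ x z, s.tab 2 (n - 1 - c) (n - 1 - j) = some x → s.tab 5 c j = some z →
      x.1 - D.w (n - 1 - c) + z.1 ≤ (combinePass.eval n D env s).best.1 := by
  have := iter_inv (N := n) (s := s)
    (f := fun i s => Prog.eval n D (.forTo 2 (.succ 0) (.combine 2 (.rev 0) (.rev 2) 5 (.var 0)
      (.var 2))) (Function.update env 0 i) s)
    (fun m (t : St) => t.tab = s.tab ∧ P t.best ∧ s.best.1 ≤ t.best.1 ∧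
      ∀ c < m, ∀ j ≤ c, ∀ x z, s.tab 2 (n - 1 - c) (n - 1 - j) = some x → s.tab 5 c j = some z →
      x.1 - D.w (n - 1 - c) + z.1 ≤ t.best.1) ⟨rfl, h0, le_rfl, by simp⟩ ?_
  · exact this.2
  rintro c hc t ⟨h1, h2, h3, h4⟩
  have := iter_inv (N := c + 1) (s := t)
    (f := fun j s => Prog.eval n D (.combine 2 (.rev 0) (.rev 2) 5 (.var 0) (.var 2))
      (Function.update (Function.update env 0 c) 2 j) s)
    (fun m (t' : St) => t'.tab = s.tab ∧ P t'.best ∧ t.best.1 ≤ t'.best.1 ∧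
      ∀ j < m, ∀ x z, s.tab 2 (n - 1 - c) (n - 1 - j) = some x → s.tab 5 c j = some z →
      x.1 - D.w (n - 1 - c) + z.1 ≤ t'.best.1) ⟨h1, h2, le_rfl, by simp⟩ ?_
  · obtain ⟨d1, d2, d3, d4⟩ := this
    simp only [Prog.eval, Bnd.eval, Function.update_self] at d1 d2 d3 d4 ⊢
    refine ⟨d1, d2, h3.trans d3, fun c' hc' j hj x z hx hz => ?_⟩
    by_cases e : c' = c
    · subst e; exact d4 j (by omega) x z hx hz
    · exact (h4 c' (by omega) j hj x z hx hz).trans d3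
  rintro j hj t' ⟨d1, d2, d3, d4⟩
  have key : P (joinBest D (n - 1 - c) t'.best (s.tab 2 (n - 1 - c) (n - 1 - j)) (s.tab 5 c j)) ∧
      t'.best.1 ≤ (joinBest D (n - 1 - c) t'.best (s.tab 2 (n - 1 - c) (n - 1 - j))
        (s.tab 5 c j)).1 ∧ ∀ x z, s.tab 2 (n - 1 - c) (n - 1 - j) = some x → s.tab 5 c j = some z →
      x.1 - D.w (n - 1 - c) + z.1 ≤ (joinBest D (n - 1 - c) t'.best
        (s.tab 2 (n - 1 - c) (n - 1 - j)) (s.tab 5 c j)).1 := by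
    cases hx : s.tab 2 (n - 1 - c) (n - 1 - j) with
    | none => exact ⟨d2, le_rfl, by simp⟩
    | some x =>
      cases hz : s.tab 5 c j with
      | none => exact ⟨d2, le_rfl, by simp⟩
      | some z =>
        simp only [joinBest]
        split_ifs with hlt
        · refine ⟨hP c hc j (by omega) x z hx hz, hlt.le, ?_⟩
          rintro _ _ ⟨⟩ ⟨⟩
          exact le_rfl
        · refine ⟨d2, le_rfl, ?_⟩
          rintro _ _ ⟨⟩ ⟨⟩
          exact not_lt.1 hlt
  simp only [Prog.eval, Idx.eval, Function.update_self, ne_eq, Fin.reduceEq, not_false_eq_true,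
    Function.update_of_ne, d1]
  refine ⟨trivial, key.1, d3.trans key.2.1, fun j' hj' x z hx hz => ?_⟩
  by_cases e : j' = j
  · subst e; exact key.2.2 x z hx hz
  · exact (d4 j' (by omega) x z hx hz).trans key.2.1

end DP
end RealRAM

/-! ### Decomposition of the hull at its lowest point -/

namespace RealRAM
namespace DP

variable {D : Cols} {n c : ℕ} {env : Fin 3 → ℕ}

/-- The columns in reversed order. -/
def Cols.rev (n : ℕ) (D : Cols) : Cols :=
  ⟨fun s => D.y (n - 1 - s), fun s => D.w (n - 1 - s), fun s => D.pt (n - 1 - s)⟩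

/-- The columns, reflected at a horizontal line. -/
def Cols.neg (D : Cols) : Cols := { D with y := fun s => -D.y s }

/-- The weight of the hull of a set of columns. -/
noncomputable def hull (n : ℕ) (D : Cols) (S : Finset ℕ) : ℝ :=
  wsum D n fun q => SW D S q ∧ NW D S q ∧ NE D S q ∧ SE D S q

theorem Distinct.rev (hD : Distinct n D) : Distinct n (D.rev n) := fun i hi j hj h => by
  have := hD (n - 1 - i) (by omega) (n - 1 - j) (by omega) h
  omega

theorem Distinct.neg (hD : Distinct n D) : Distinct n D.neg := fun i hi j hj h =>
  hD i hi j hj (neg_injective h)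

/-- The reflection interchanges lower and upper quadrants, and the hull condition is symmetric in
them. -/
theorem hull_neg (S : Finset ℕ) : hull n D.neg S = hull n D S := by
  unfold hull
  have : ∀ p, wsum D.neg n p = wsum D n p := fun _ => rfl
  rw [this]
  refine wsum_congr fun q _ => ?_
  simp only [SW, NW, NE, SE, Cols.neg, neg_le_neg_iff]
  tauto

theorem hull_empty : hull n D ∅ = 0 := wsum_eq_zero fun q _ h => by simp [SW] at h

open scoped Classical in
-- Up to column `b`, the right part is visible only through its highest point `v`, and `b` supplies
-- the lower right condition. Beyond `b`, the left conditions come for free from `b` and from `t`,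
-- which is at least as high as `v`.
theorem hull_union {b v : ℕ} {S₁ S₂ : Finset ℕ} (hb : b ≤ v) (hv : v < n)
    (h1 : ∀ s ∈ S₁, s < b + 1) (h2 : b ∈ S₁) (h3 : ∀ s ∈ S₁, D.y b ≤ D.y s)
    (h4 : ∃ t ∈ S₁, D.y v ≤ D.y t) (h5 : ∀ s ∈ S₂, b ≤ s) (h6 : b ∈ S₂) (h7 : v ∈ S₂)
    (h8 : ∀ s ∈ S₂, D.y b ≤ D.y s ∧ D.y s ≤ D.y v) :
    hull n D (S₁ ∪ S₂) =
      wsum D (b + 1) (fun q => SW D S₁ q ∧ NW D S₁ q ∧ (NE D S₁ q ∨ D.y q ≤ D.y v)) - D.w b +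
        ∑ q ∈ Finset.Ico b n with NE D S₂ q ∧ SE D S₂ q, D.w q := by
  obtain ⟨t, ht, hvt⟩ := h4
  have e1 : ∀ q < b + 1, (SW D (S₁ ∪ S₂) q ∧ NW D (S₁ ∪ S₂) q ∧ NE D (S₁ ∪ S₂) q ∧
      SE D (S₁ ∪ S₂) q) ↔ (SW D S₁ q ∧ NW D S₁ q ∧ (NE D S₁ q ∨ D.y q ≤ D.y v)) := by
    intro q hq
    have a1 : SW D (S₁ ∪ S₂) q ↔ SW D S₁ q := by
      simp only [SW, Finset.mem_union]; grind
    have a2 : NW D (S₁ ∪ S₂) q ↔ NW D S₁ q := by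
      simp only [NW, Finset.mem_union]; grind
    have a3 : NE D (S₁ ∪ S₂) q ↔ (NE D S₁ q ∨ D.y q ≤ D.y v) := by
      constructor
      · rintro ⟨s, hs, h, h'⟩
        rcases Finset.mem_union.1 hs with hs | hs
        · exact .inl ⟨s, hs, h, h'⟩
        · exact .inr (h'.trans (h8 s hs).2)
      · rintro (⟨s, hs, h⟩ | h)
        · exact ⟨s, Finset.mem_union_left _ hs, h⟩
        · exact ⟨v, Finset.mem_union_right _ h7, by omega, h⟩
    rw [a1, a2, a3]
    -- The point `b` is not above `s`, which is not above `q`; so `b` lies in the lower right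
    -- quadrant of `q`.
    refine and_congr_right fun ⟨s, hs, _, hsq⟩ => and_congr_right fun _ => and_iff_left ?_
    exact ⟨b, Finset.mem_union_left _ h2, by omega, (h3 s hs).trans hsq⟩
  have e2 : ∀ q, b + 1 ≤ q → ((SW D (S₁ ∪ S₂) q ∧ NW D (S₁ ∪ S₂) q ∧ NE D (S₁ ∪ S₂) q ∧
      SE D (S₁ ∪ S₂) q) ↔ NE D S₂ q ∧ SE D S₂ q) := by
    intro q hq
    have a3 : NE D (S₁ ∪ S₂) q ↔ NE D S₂ q := by
      simp only [NE, Finset.mem_union]; grind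
    have a4 : SE D (S₁ ∪ S₂) q ↔ SE D S₂ q := by
      simp only [SE, Finset.mem_union]; grind
    rw [a3, a4]
    constructor
    · exact fun h => h.2.2
    · rintro ⟨⟨s, hs, hqs, hys⟩, ⟨s', hs', hqs', hys'⟩⟩
      refine ⟨⟨b, Finset.mem_union_left _ h2, by omega, (h8 s' hs').1.trans hys'⟩,
        ⟨t, Finset.mem_union_left _ ht, ?_, (hys.trans (h8 s hs).2).trans hvt⟩, ⟨s, hs, hqs, hys⟩,
        ⟨s', hs', hqs', hys'⟩⟩
      have := h1 t ht
      omega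
  have e3 : NE D S₂ b ∧ SE D S₂ b := ⟨⟨b, h6, le_rfl, le_rfl⟩, ⟨b, h6, le_rfl, le_rfl⟩⟩
  rw [← wsum_congr e1, hull, wsum, wsum, Finset.sum_filter, Finset.sum_filter, Finset.sum_filter,
    Finset.sum_eq_sum_Ico_succ_bot (by omega : b < n), if_pos e3,
    ← Finset.sum_range_add_sum_Ico _ (by omega : b + 1 ≤ n)]
  -- Column `b` counts in both sums; this cancels the duplicate.
  have : ∀ x y z : ℝ, x - y + (y + z) = x + z := fun x y z => by ring
  rw [this]
  congr 1
  refine Finset.sum_congr rfl fun q hq => ?_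
  have hq' := e2 q (Finset.mem_Ico.1 hq).1
  by_cases h : NE D S₂ q ∧ SE D S₂ q
  · rw [if_pos (hq'.2 h), if_pos h]
  · rw [if_neg (mt hq'.1 h), if_neg h]

open scoped Classical in
-- Reversing the columns turns the left conditions of `KA` into the right conditions.
theorem wsum_rev {b : ℕ} (hb : b < n) {S : Finset ℕ} (hS : ∀ s ∈ S, s < n) :
    wsum (D.rev n) (n - 1 - b + 1) (fun q => SW (D.rev n) S q ∧ NW (D.rev n) S q) =
      ∑ q ∈ Finset.Ico b n with NE D (S.image (n - 1 - ·)) q ∧ SE D (S.image (n - 1 - ·)) q, D.w q := by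
  unfold wsum
  have key : ∀ q < n, (SW (D.rev n) S (n - 1 - q) ↔ SE D (S.image (n - 1 - ·)) q) ∧
      (NW (D.rev n) S (n - 1 - q) ↔ NE D (S.image (n - 1 - ·)) q) := by
    intro q hq
    have hq' : n - 1 - (n - 1 - q) = q := by omega
    simp only [SW, SE, NW, NE, Finset.exists_mem_image, Cols.rev, hq']
    constructor <;> refine exists_congr fun s => and_congr_right fun hs => and_congr_left fun _ => ?_
    all_goals
      have := hS s hs
      omega
  refine Finset.sum_nbij' (n - 1 - ·) (n - 1 - ·) ?_ ?_ ?_ ?_ ?_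
  · intro q hq
    simp only [Finset.mem_filter, Finset.mem_range, Finset.mem_Ico] at hq ⊢
    obtain ⟨k1, k2⟩ := key (n - 1 - q) (by omega)
    rw [show n - 1 - (n - 1 - q) = q by omega] at k1 k2
    exact ⟨by omega, k2.1 hq.2.2, k1.1 hq.2.1⟩
  · intro q hq
    simp only [Finset.mem_filter, Finset.mem_range, Finset.mem_Ico] at hq ⊢
    obtain ⟨k1, k2⟩ := key q (by omega)
    exact ⟨by omega, k1.2 hq.2.2, k2.2 hq.2.1⟩
  · intro q hq
    simp only [Finset.mem_filter, Finset.mem_range] at hq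
    omega
  · intro q hq
    simp only [Finset.mem_filter, Finset.mem_Ico] at hq
    omega
  · exact fun q _ => rfl

/-- Soundness of the combination: any two matching parts, optimal or not, come from an actual set
with the combined value. -/
theorem hull_join {b v : ℕ} (hb : b ≤ v) (hv : v < n) {x z : ℝ × Finset ℕ}
    (hx : x ∈ KR D (b + 1) b v)
    (hz : z ∈ KA (D.rev n) (n - 1 - b + 1) (n - 1 - b) (n - 1 - v)) :
    ∃ S, (∀ s ∈ S, s < n) ∧ (x.1 - D.w b + z.1, x.2 ∪ z.2) = (hull n D S, S.image D.pt) := by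
  obtain ⟨S₁, ⟨h1, h2, h3, -, h4⟩, rfl⟩ := hx
  obtain ⟨S₂, ⟨h5, h6, h7, h8⟩, rfl⟩ := hz
  refine ⟨S₁ ∪ S₂.image (n - 1 - ·), by grind, ?_⟩
  have hb' : n - 1 - (n - 1 - b) = b := by omega
  have hv' : n - 1 - (n - 1 - v) = v := by omega
  dsimp only
  rw [hull_union hb hv h1 h2 h3 h4, wsum_rev (by omega) (by grind)]
  · rw [Finset.image_union, Finset.image_image]
    rfl
  · simp only [Finset.forall_mem_image]
    intro s hs
    have := h5 s hs
    omega
  · exact Finset.mem_image.2 ⟨_, h6, hb'⟩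
  · exact Finset.mem_image.2 ⟨_, h7, hv'⟩
  · simp only [Finset.forall_mem_image]
    intro s hs
    have := h8 s hs
    simp only [Cols.rev, hb', hv'] at this
    exact this

/-- Completeness of the combination: cutting `S` at its lowest point gives two matching parts that
recover its value. -/
theorem hull_split {S : Finset ℕ} (hS : ∀ s ∈ S, s < n) {b t : ℕ} (hb : b ∈ S) (ht : t ∈ S)
    (hmin : ∀ s ∈ S, D.y b ≤ D.y s) (hmax : ∀ s ∈ S, D.y s ≤ D.y t) (htb : t ≤ b) :
    ∃ v, b ≤ v ∧ v < n ∧ ∃ x ∈ KR D (b + 1) b v,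
      ∃ z ∈ KA (D.rev n) (n - 1 - b + 1) (n - 1 - b) (n - 1 - v),
        x.1 - D.w b + z.1 = hull n D S := by
  -- The announced point is the highest point of `S` that is not to the left of `b`.
  obtain ⟨v, hv, hvmax⟩ := (S.filter (b ≤ ·)).exists_max_image D.y ⟨b, by simp [hb]⟩
  rw [Finset.mem_filter] at hv
  have hvn := hS v hv.1
  have hb' : n - 1 - (n - 1 - b) = b := by omega
  have hv' : n - 1 - (n - 1 - v) = v := by omega
  have hrr : ((S.filter (b ≤ ·)).image (n - 1 - ·)).image (n - 1 - ·) = S.filter (b ≤ ·) := by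
    rw [Finset.image_image]
    refine (Finset.image_congr fun s hs => ?_).trans Finset.image_id
    have := hS s (Finset.mem_filter.1 hs).1
    simp only [Function.comp, id]; omega
  refine ⟨v, hv.2, hvn, _, ⟨S.filter (· < b + 1), ⟨by simp, by simp [hb], ?_, hmin v hv.1, t, ?_,
    hmax v hv.1⟩, rfl⟩, _, ⟨(S.filter (b ≤ ·)).image (n - 1 - ·), ⟨?_, ?_, ?_, ?_⟩, rfl⟩, ?_⟩
  · exact fun s hs => hmin s (Finset.mem_filter.1 hs).1
  · simp only [Finset.mem_filter]; exact ⟨ht, by omega⟩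
  · simp only [Finset.forall_mem_image, Finset.mem_filter]
    rintro s ⟨hs, hbs⟩
    omega
  · exact Finset.mem_image_of_mem _ (by simp [hb])
  · exact Finset.mem_image_of_mem _ (by simp [hv])
  · simp only [Finset.forall_mem_image, Cols.rev, hb', hv']
    intro s hs
    have hs' := Finset.mem_filter.1 hs
    rw [show n - 1 - (n - 1 - s) = s by have := hS s hs'.1; omega]
    exact ⟨hmin s hs'.1, hvmax s hs⟩
  · dsimp only
    rw [wsum_rev (by omega), hrr, ← hull_union hv.2 hvn]
    · congr 1
      ext s
      simp only [Finset.mem_union, Finset.mem_filter]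
      grind
    · simp
    · simp [hb]
    · exact fun s hs => hmin s (Finset.mem_filter.1 hs).1
    · exact ⟨t, by simp only [Finset.mem_filter]; exact ⟨ht, by omega⟩, hmax v hv.1⟩
    · simp
    · simp [hb]
    · simp [hv]
    · exact fun s hs => ⟨hmin s (Finset.mem_filter.1 hs).1, hvmax s hs⟩
    · simp only [Finset.forall_mem_image, Finset.mem_filter]
      rintro s ⟨hs, hbs⟩
      omega

/-- The state holds a solution and its value. -/
def IsSolution (n : ℕ) (D : Cols) (z : ℝ × Finset ℕ) : Prop :=
  ∃ S, (∀ s ∈ S, s < n) ∧ z = (hull n D S, S.image D.pt)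

/-- After the passes, the best solution is at least as good as each set whose highest point is not
to the right of its lowest point. -/
theorem passes_spec (hD : Distinct n D) (s : St) (hs : IsSolution n D s.best) :
    let s' := combinePass.eval n D env
      (forwardPass.eval n D env (mirrorPass.eval n (D.rev n) env s))
    IsSolution n D s'.best ∧ s.best.1 ≤ s'.best.1 ∧
    ∀ S : Finset ℕ, (∀ s ∈ S, s < n) → ∀ b ∈ S, ∀ t ∈ S, (∀ s ∈ S, D.y b ≤ D.y s) →
      (∀ s ∈ S, D.y s ≤ D.y t) → t ≤ b → hull n D S ≤ s'.best.1 := by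
  intro s'
  obtain ⟨a1, a2⟩ := mirrorPass_spec (env := env) hD.rev s
  obtain ⟨b1, b2, b3⟩ := forwardPass_spec (env := env) hD (mirrorPass.eval n (D.rev n) env s)
  set s2 := forwardPass.eval n D env (mirrorPass.eval n (D.rev n) env s)
  have hbest : s2.best = s.best := b1.trans a1
  have hA : ∀ c < n, ∀ h ≤ c, Best (KA (D.rev n) (c + 1) c h) (s2.tab 5 c h) := fun c hc h hh => by
    rw [b2]; exact a2 c hc h hh
  obtain ⟨c1, c2, c3⟩ := combinePass_spec (D := D) (n := n) (env := env) s2 (IsSolution n D)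
    (by rw [hbest]; exact hs) fun c hc j hj x z hx hz => by
      refine hull_join (b := n - 1 - c) (v := n - 1 - j) (by omega) (by omega)
        ((b3 _ (by omega) _ (by omega)).1 x hx) ?_
      have := (hA c hc j hj).1 z hz
      rwa [show n - 1 - (n - 1 - c) = c by omega, show n - 1 - (n - 1 - j) = j by omega]
  refine ⟨c1, hbest ▸ c2, fun S hS b hb t ht hmin hmax htb => ?_⟩
  obtain ⟨v, hbv, hvn, x, hx, z, hz, hxz⟩ := hull_split hS hb ht hmin hmax htb
  -- Each part may be replaced by the tabulated optimum of its family, since any two members of the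
  -- families match.
  obtain ⟨x', hx', hxx⟩ := (b3 b (by omega) v hvn).2 x hx
  obtain ⟨z', hz', hzz⟩ := (hA (n - 1 - b) (by omega) (n - 1 - v) (by omega)).2 z hz
  have := c3 (n - 1 - b) (by omega) (n - 1 - v) (by omega) x' z'
  rw [show n - 1 - (n - 1 - b) = b by omega, show n - 1 - (n - 1 - v) = v by omega] at this
  have := this hx' hz'
  rw [← hxz]
  linarith

end DP
end RealRAM

namespace RealRAM
namespace DP

variable {n K M : ℕ} {ord : ℕ → ℕ} {D : Cols} {s : St} {σ : Store 10} {I : Input}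

/-! ### Sorting the input -/

/-- The `x`-coordinate of an input point. -/
noncomputable def xCoord (I : Input) (i : ℕ) : ℝ := I.read (fun j => (I.pts j).1) i

/-- The number of input points to the left of a point, among the first `m` points. -/
noncomputable def rank (I : Input) (m i : ℕ) : ℕ :=
  ((Finset.range m).filter fun j => xCoord I j < xCoord I i).card

theorem rank_le (m i : ℕ) : rank I m i ≤ m :=
  (Finset.card_filter_le _ _).trans (Finset.card_range m).le

theorem rank_succ (m i : ℕ) :
    rank I (m + 1) i = rank I m i + if xCoord I m < xCoord I i then 1 else 0 := by
  rw [rank, Finset.range_add_one, Finset.filter_insert]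
  split_ifs
  · rw [Finset.card_insert_of_notMem (by simp)]; rfl
  · rfl

theorem rank_mono {i j : ℕ} (m : ℕ) (h : xCoord I i ≤ xCoord I j) : rank I m i ≤ rank I m j :=
  Finset.card_le_card fun _ ha => by
    rw [Finset.mem_filter] at ha ⊢
    exact ⟨ha.1, ha.2.trans_le h⟩

theorem rank_lt_rank {i j : ℕ} {m : ℕ} (hi : i < m) (h : xCoord I i < xCoord I j) :
    rank I m i < rank I m j := by
  refine Finset.card_lt_card (Finset.ssubset_iff_of_subset (fun a ha => ?_) |>.2 ⟨i, ?_, ?_⟩)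
  · rw [Finset.mem_filter] at ha ⊢
    exact ⟨ha.1, ha.2.trans h⟩
  · simpa using ⟨hi, h⟩
  · simp

theorem rank_lt {i m : ℕ} (hi : i < m) : rank I m i < m := by
  have : ((Finset.range m).filter fun j => xCoord I j < xCoord I i).card < (Finset.range m).card :=
    Finset.card_lt_card ((Finset.ssubset_iff_of_subset (Finset.filter_subset _ _)).2
      ⟨i, by simpa using hi, by simp⟩)
  rwa [Finset.card_range] at this

theorem rank_injOn (hI : ∀ i < n, ∀ j < n, xCoord I i = xCoord I j → i = j) :
    ∀ i < n, ∀ j < n, rank I n i = rank I n j → i = j := by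
  intro i hi j hj h
  rcases lt_trichotomy (xCoord I i) (xCoord I j) with h' | h' | h'
  · exact absurd h (rank_lt_rank hi h').ne
  · exact hI i hi j hj h'
  · exact absurd h (rank_lt_rank hj h').ne'

/-- The order by `x`-coordinates. -/
theorem exists_order (hI : ∀ i < n, ∀ j < n, xCoord I i = xCoord I j → i = j) :
    ∃ ord : ℕ → ℕ, (∀ r < n, ord r < n ∧ rank I n (ord r) = r) ∧
      (∀ i < n, ∃ r < n, ord r = i) ∧
      ∀ r < n, ∀ r' < n, (xCoord I (ord r) ≤ xCoord I (ord r') ↔ r ≤ r') := by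
  have hinj := rank_injOn hI
  have hsurj := Finset.surj_on_of_inj_on_of_card_le (s := Finset.range n) (t := Finset.range n)
    (fun i _ => rank I n i) (fun i hi => by
      rw [Finset.mem_range] at hi ⊢; exact rank_lt hi)
    (fun i j hi hj h => hinj i (Finset.mem_range.1 hi) j (Finset.mem_range.1 hj) h) le_rfl
  have : ∀ r, ∃ i, r < n → i < n ∧ rank I n i = r := fun r => by
    by_cases hr : r < n
    · obtain ⟨i, hi, h⟩ := hsurj r (Finset.mem_range.2 hr)
      exact ⟨i, fun _ => ⟨Finset.mem_range.1 hi, h.symm⟩⟩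
    · exact ⟨0, fun h => absurd h hr⟩
  choose ord hord using this
  refine ⟨ord, hord, fun i hi => ⟨rank I n i, rank_lt hi, ?_⟩, fun r hr r' hr' => ⟨fun h => ?_, fun h => ?_⟩⟩
  · obtain ⟨h1, h2⟩ := hord _ (rank_lt (I := I) hi)
    exact hinj _ h1 _ hi h2
  · rw [← (hord r hr).2, ← (hord r' hr').2]
    exact rank_mono n h
  · by_contra hlt
    have := rank_lt_rank (hord r' hr').1 (not_le.1 hlt)
    rw [(hord r hr).2, (hord r' hr').2] at this
    omega

/-- Sorting and loading touch only natural variables from `4` on and the arrays `6` and `7`, none of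
which `Core` mentions. -/
theorem Core.congr {σ' : Store 10} (h : Core n K s σ) (h1 : ∀ v : Fin 10, v < 4 → σ'.nvar v = σ.nvar v)
    (h2 : σ'.rvar = σ.rvar) (h3 : ∀ a : Fin 10, a ≠ 6 → a ≠ 7 → σ'.narr a = σ.narr a)
    (h4 : ∀ a : Fin 10, a ≠ 6 → a ≠ 7 → σ'.rarr a = σ.rarr a) (h5 : σ'.marked = σ.marked) :
    Core n K s σ' := by
  have e0 := h1 0 (by decide)
  have e1 := h1 1 (by decide)
  have e2 := h1 2 (by decide)
  have e3 := h1 3 (by decide)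
  have e8 := h3 8 (by decide) (by decide)
  have e9 := h3 9 (by decide) (by decide)
  have et : ∀ a, σ'.narr (tabVar a) = σ.narr (tabVar a) := fun a => h3 _ (by simp) (by simp)
  have et' : ∀ a, σ'.rarr (tabVar a) = σ.rarr (tabVar a) := fun a => h4 _ (by simp) (by simp)
  obtain ⟨c1, c2, c3, c4, c5, c6, c7, c8, c9, c10⟩ := h
  constructor <;> simp only [e0, e1, e2, e3, e8, e9, et, et', h2, h5] <;> assumption

/-- Compute the rank of the point `nvar 5` in `nvar 4`. -/
def rankCmd : Cmd 10 :=
  .seq (.nset 4 (.const 0))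
    (.forTo 6 .size (.cond (.realLt (.inputX (.var 6)) (.inputX (.var 5)))
      (.nset 4 (.add (.var 4) (.const 1))) .skip))

/-- Each rank is found by comparison with all points. Quadratic time is affordable here, and
distinct abscissas make the ranks distinct. -/
def sortCmd : Cmd 10 := .forTo 5 .size (.seq rankCmd (.nstore 7 (.var 4) (.var 5)))

theorem rankCmd_does (hn : I.n = n) (hM : n < M) (h : Core n K s σ) {i : ℕ} (hi : i < n)
    (hσ : σ.nvar 5 = i) :
    Does M I rankCmd σ (n * 30 + 20) fun τ => Core n K s τ ∧ τ.nvar 5 = i ∧ τ.nvar 4 = rank I n i ∧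
      τ.narr 7 = σ.narr 7 := by
  subst hn
  refine Does.seq (T₁ := 2) (T₂ := I.n * 30 + 18) (Does.nset (Nat.zero_le _) le_rfl ?_) (by omega)
  refine (Does.forTo (N := I.n) (T' := 20) (fun j τ => (Core I.n K s τ ∧ τ.nvar 5 = i ∧
    τ.nvar 4 = rank I j i ∧ τ.narr 7 = σ.narr 7) ∧ τ.nvar 6 = j) hM.le ?_ ?_ ?_
    (by simp [NExpr.cost]; omega)).mono le_rfl fun τ hτ => hτ.1
  · refine ⟨⟨h.congr ?_ rfl (fun _ _ _ => rfl) (fun _ _ _ => rfl) rfl, ?_, ?_, rfl⟩, ?_⟩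
    · intro v hv
      dsimp only
      rw [Function.update_of_ne (by rintro rfl; simp at hv),
        Function.update_of_ne (by rintro rfl; simp at hv)]
    · simpa using hσ
    · simp [NExpr.eval, rank]
    · simp
  · exact fun j _ τ hτ => ⟨hτ.2, hM.le, rfl⟩
  · rintro j hj τ ⟨⟨h1, h2, h3, h4⟩, h5⟩
    refine Does.cond (T' := 4) ⟨⟨trivial, by simpa [NExpr.eval, h5] using hj⟩, trivial,
      by simpa [NExpr.eval, h2] using hi⟩ (fun ht => ?_) (fun ht => ?_)
      (by simp [Test.cost, RExpr.cost, NExpr.cost])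
    · refine Does.nset ⟨trivial, show 1 ≤ M by omega, ?_⟩ (by simp [NExpr.cost]) ?_
      · have := rank_le (I := I) j i
        simp only [NExpr.eval, h3]; omega
      · simp only [Test.Holds, RExpr.eval, NExpr.eval, h2, h5] at ht
        refine ⟨by simpa using h5, ⟨h1.congr ?_ rfl (fun _ _ _ => rfl) (fun _ _ _ => rfl) rfl, ?_, ?_,
          h4⟩, by simp⟩
        · intro v hv
          dsimp only
          rw [Function.update_of_ne (by rintro rfl; simp at hv),
            Function.update_of_ne (by rintro rfl; simp at hv)]
        · simpa using h2
        · simp [NExpr.eval, h3, rank_succ, xCoord, ht]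
    · simp only [Test.Holds, RExpr.eval, NExpr.eval, h2, h5] at ht
      refine Does.skip (by omega) ⟨h5, ⟨h1.congr ?_ rfl (fun _ _ _ => rfl) (fun _ _ _ => rfl) rfl,
        ?_, ?_, h4⟩, by simp⟩
      · intro v hv
        dsimp only
        rw [Function.update_of_ne (by rintro rfl; simp at hv)]
      · simpa using h2
      · rw [rank_succ, if_neg (show ¬ xCoord I j < xCoord I i from ht)]; simpa using h3

theorem sortCmd_does (hn : I.n = n) (hM : n < M) (h : Core n K s σ)
    (hI : ∀ i < n, ∀ j < n, xCoord I i = xCoord I j → i = j) :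
    Does M I sortCmd σ (n * (n * 30 + 40) + 10) fun τ => Core n K s τ ∧
      ∀ i < n, τ.narr 7 (rank I n i) = i := by
  subst hn
  refine (Does.forTo (N := I.n) (T' := I.n * 30 + 25) (fun i τ => (Core I.n K s τ ∧
    ∀ j < i, τ.narr 7 (rank I I.n j) = j) ∧ τ.nvar 5 = i) hM.le ?_ ?_ ?_
    (by simp [NExpr.cost]; nlinarith)).mono le_rfl fun τ hτ => hτ.1
  · refine ⟨⟨h.congr ?_ rfl (fun _ _ _ => rfl) (fun _ _ _ => rfl) rfl, by simp⟩, by simp⟩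
    intro v hv
    dsimp only
    rw [Function.update_of_ne (by rintro rfl; simp at hv)]
  · exact fun j _ τ hτ => ⟨hτ.2, hM.le, rfl⟩
  · rintro i hi τ ⟨⟨h1, h2⟩, h3⟩
    refine Does.seq ((rankCmd_does rfl hM h1 hi h3).mono le_rfl ?_) (T₂ := 5) (by omega)
    rintro τ' ⟨h4, h5, h6, h7⟩
    have hr := rank_lt (I := I) hi
    refine Does.nstore trivial ?_ trivial (by simp [NExpr.cost]) ⟨h5, ⟨h4.congr ?_ rfl ?_ (fun _ _ _ => rfl) rfl,
      ?_⟩, by simp⟩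
    · simp only [NExpr.eval, h6]; omega
    · intro v hv
      dsimp only
      rw [Function.update_of_ne (by rintro rfl; simp at hv)]
    · intro a _ ha
      simp [Function.update_of_ne ha]
    · intro j hj
      simp only [NExpr.eval, h5, h6, h7, Function.update_self]
      rcases Nat.lt_succ_iff_lt_or_eq.1 hj with hj | rfl
      · rw [Function.update_of_ne, h2 j hj]
        exact fun e => hj.ne (rank_injOn hI j (by omega) i hi e)
      · simp

/-! ### Loading the columns -/

/-- The columns of the input, in the order `ord`. -/
noncomputable def inputCols (I : Input) (ord : ℕ → ℕ) : Cols :=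
  ⟨fun c => I.read (fun j => (I.pts j).2) (ord c), fun c => I.read I.w (ord c), ord⟩

/-- The reflection is written as a subtraction from `0`, there being no negation on the machine. -/
def heightExpr (neg : Bool) : RExpr 10 :=
  if neg then .sub .zero (.inputY (.load 6 (.var 5))) else .inputY (.load 6 (.var 5))

/-- Load the columns in the order `i`, possibly reflected at a horizontal line. -/
def loadCols (i : Idx) (neg : Bool) : Cmd 10 :=
  .forTo 5 .size (.seq (.nstore 6 (.var 5) (.load 7 i.expr))
    (.seq (.rstore 6 (.var 5) (heightExpr neg)) (.rstore 7 (.var 5) (.inputW (.load 6 (.var 5))))))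

def Cols.orient (neg : Bool) (D : Cols) : Cols := if neg then D.neg else D

theorem loadCols_does (hn : I.n = n) (hM : n < M) (hord : ∀ r < n, ord r < n) (h : Core n K s σ)
    (ho : Ordered n ord σ) {i : Idx} (hi : i.Ok {0}) (neg : Bool)
    (hD : ∀ x < n, D.y x = ((inputCols I ord).orient neg).y (i.eval n fun _ => x) ∧
      D.w x = (inputCols I ord).w (i.eval n fun _ => x) ∧ D.pt x = ord (i.eval n fun _ => x)) :
    Does M I (loadCols i neg) σ (n * 60 + 10) (Rel n K ord D ∅ (fun _ => 0) s) := by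
  subst hn
  refine (Does.forTo (N := I.n) (T' := 50) (fun j τ => (Core I.n K s τ ∧ Ordered I.n ord τ ∧
    ∀ x < j, τ.rarr 6 x = D.y x ∧ τ.rarr 7 x = D.w x ∧ τ.narr 6 x = D.pt x ∧ D.pt x < I.n) ∧
    τ.nvar 5 = j) hM.le ?_ ?_ ?_ ?_).mono le_rfl fun τ hτ =>
      ⟨hτ.1.1, hτ.1.2.2, fun v hv => by simp at hv, hτ.1.2.1⟩
  · refine ⟨⟨h.congr ?_ rfl (fun _ _ _ => rfl) (fun _ _ _ => rfl) rfl, ho, by simp⟩, by simp⟩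
    intro v hv
    dsimp only
    rw [Function.update_of_ne (by rintro rfl; simp at hv)]
  · exact fun j _ τ hτ => ⟨hτ.2, hM.le, rfl⟩
  · rintro x hx τ ⟨⟨h1, h2, h3⟩, h4⟩
    -- Machine variable `5` is loop variable `0` of the language, so its index expressions can be
    -- reused here.
    have hs : InScope I.n {0} (fun _ => x) τ := fun v hv => by
      obtain rfl := Finset.mem_singleton.1 hv
      exact ⟨h4, hx⟩
    obtain ⟨e1, e2, e3⟩ := Idx.expr_spec rfl hM.le hs hi
    obtain ⟨d1, d2, d3⟩ := hD x hx
    have ep := h2 _ e3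
    have hp := hord _ e3
    have hcost := i.expr_cost
    refine Does.seq (T₁ := 10) (T₂ := 40) (Does.nstore trivial ?_ ⟨e1, ?_⟩
      (by simp only [NExpr.cost]; omega) ?_) le_rfl
    · simp only [NExpr.eval]; omega
    · omega
    simp only [NExpr.eval, e2, h4, ep]
    refine Does.seq (T₁ := 15) (T₂ := 10) (Does.rstore trivial ?_ ?_ ?_ ?_) (by omega)
    · simp only [NExpr.eval]; omega
    · cases neg <;> simp [heightExpr, RExpr.Safe, NExpr.Safe, NExpr.eval, h4, hp, hx.trans hM]
    · cases neg <;> simp [heightExpr, RExpr.cost, NExpr.cost]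
    refine Does.rstore trivial ?_ ?_ ?_ ?_
    · simp only [NExpr.eval]; omega
    · simp [RExpr.Safe, NExpr.Safe, NExpr.eval, h4, hp, hx.trans hM]
    · simp [RExpr.cost, NExpr.cost]
    refine ⟨h4, ⟨h1.congr ?_ rfl ?_ ?_ rfl, ?_, ?_⟩, by simp⟩
    · intro v hv
      dsimp only
      rw [Function.update_of_ne (by rintro rfl; simp at hv)]
    · intro a ha _
      simp [Function.update_of_ne ha]
    · intro a ha ha'
      simp [Function.update_of_ne ha, Function.update_of_ne ha']
    · intro r hr
      simpa using h2 r hr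
    · intro z hz
      by_cases hzx : z = x
      · subst hzx
        rw [d1, d2, d3]
        cases neg <;>
          simp [NExpr.eval, RExpr.eval, heightExpr, h4, inputCols, Cols.orient, Cols.neg, hp]
      · have := h3 z (by omega)
        simpa [NExpr.eval, h4, Function.update_of_ne hzx] using this
  · simp [NExpr.cost]; omega

/-! ### The output -/

/-- Mark the entries of the list `h`. -/
def markCmd (h : Fin 10) : Cmd 10 :=
  .loop (.not (.natEq (.var h) (.const 0)))
    (.seq (.mark (.load 9 (.var h))) (.nset h (.load 8 (.var h))))

/-- Links strictly decrease, so a list with head `i` takes at most `i` rounds, each of at most 12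
steps. -/
theorem markCmd_does {h : Fin 10} {c : ℕ} (hn : I.n = n) (hc : c < M) :
    ∀ i ≤ c, ∀ σ : Store 10, σ.nvar h = i →
    (∀ i, 0 < i → i ≤ c → σ.narr 8 i < i ∧ σ.narr 9 i < n) →
    Does M I (markCmd h) σ (i * 12 + 5) fun τ =>
      τ = { σ with
        nvar := Function.update σ.nvar h 0
        marked := σ.marked ∪ linkedSet (σ.narr 8) (σ.narr 9) i } := by
  intro i
  induction i using Nat.strong_induction_on with
  | _ i ih =>
    intro hi σ hσ hheap
    rcases Nat.eq_zero_or_pos i with rfl | hpos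
    · refine ⟨_, σ, .loop_done ⟨trivial, Nat.zero_le _⟩ ?_, ?_, ?_⟩
      · simp [Test.Holds, NExpr.eval, hσ]
      · simp [Test.cost, NExpr.cost]
      · have : Function.update σ.nvar h 0 = σ.nvar := by rw [← hσ]; simp
        simp [this, linkedSet]
    · obtain ⟨hp, hm⟩ := hheap i hpos hi
      obtain ⟨t, τ, hr, ht, hτ⟩ := ih _ hp (by omega)
        { σ with
          nvar := Function.update σ.nvar h (σ.narr 8 i)
          marked := insert (σ.narr 9 i) σ.marked } (by simp) hheap
      have r1 : Run M I (.mark (.load 9 (.var h))) σ 3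
          { σ with marked := insert (σ.narr 9 i) σ.marked } := by
        have := Run.mark (M := M) (I := I) σ (.load 9 (.var h))
          ⟨trivial, by simp only [NExpr.eval, hσ]; omega⟩ (by simp only [NExpr.eval, hσ]; omega)
        simpa only [NExpr.eval, hσ, NExpr.cost, Nat.reduceAdd] using this
      have r2 := Run.nset (M := M) (I := I) { σ with marked := insert (σ.narr 9 i) σ.marked } h
        (.load 8 (.var h)) ⟨trivial, by simp only [NExpr.eval, hσ]; omega⟩
      simp only [NExpr.eval, hσ] at r2
      refine ⟨_, τ, .loop_step ⟨trivial, Nat.zero_le _⟩ ?_ (.seq r1 r2) hr, ?_, ?_⟩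
      · simp only [Test.Holds, NExpr.eval, hσ]; omega
      · simp only [Test.cost, NExpr.cost]; omega
      · rw [hτ, linkedSet_of_pos hpos hp]
        simp [Finset.insert_union, Finset.union_insert]

/-- The best solution is kept as two lists. Their common point is marked twice, which is harmless.
-/
theorem output_does (hn : I.n = n) (hK : K < M) (h : Core n K s σ) :
    Does M I (.seq (markCmd 2) (markCmd 3)) σ (K * 24 + 10) fun τ => τ.marked = s.best.2 := by
  have hc := h.count
  have hb := h.best_le
  refine Does.seq (T₁ := K * 12 + 5) (T₂ := K * 12 + 5)
    ((markCmd_does hn (by omega : σ.nvar 1 < M) _ hb.1 σ rfl h.heap).mono (by omega) ?_) (by omega)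
  rintro _ rfl
  refine (markCmd_does hn (by omega : σ.nvar 1 < M) (σ.nvar 3) hb.2
    { σ with
      nvar := Function.update σ.nvar 2 0
      marked := σ.marked ∪ linkedSet (σ.narr 8) (σ.narr 9) (σ.nvar 2) } (by simp) h.heap).mono (by omega) ?_
  rintro _ rfl
  simp [h.marked, h.best_set]

end DP
end RealRAM

namespace RealRAM
namespace DP

variable {n K M : ℕ} {ord : ℕ → ℕ} {s : St} {σ : Store 10} {I : Input}

/-! ### The program -/

/-- Run all passes on the input, possibly reflected at a horizontal line. -/
def orientCmd (neg : Bool) : Cmd 10 :=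
  .seq (loadCols (.rev 0) neg) (.seq mirrorPass.compile (.seq (loadCols (.var 0) neg)
    (.seq forwardPass.compile combinePass.compile)))

def maxWeightCmd : Cmd 10 :=
  .seq sortCmd (.seq (orientCmd false) (.seq (orientCmd true) (.seq (markCmd 2) (markCmd 3))))

noncomputable def orientEval (n : ℕ) (D : Cols) (s : St) : St :=
  combinePass.eval n D (fun _ => 0) (forwardPass.eval n D (fun _ => 0)
    (mirrorPass.eval n (D.rev n) (fun _ => 0) s))

theorem passes_ok : mirrorPass.Ok ∅ ∧ forwardPass.Ok ∅ ∧ combinePass.Ok ∅ := by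
  simp [mirrorPass, forwardPass, combinePass, stageA, stageB, saveLoop, clearLoop, startLoop,
    consumeLoop, advanceLoop, copyLoop, aboveLoop, lowLoop, highLoop, insideLoop, Prog.Ok, Idx.Ok,
    Bnd.Ok]

theorem passes_cost (n : ℕ) :
    mirrorPass.cost n + forwardPass.cost n + combinePass.cost n ≤ 40000 * (n ^ 3 + 1) := by
  have h1 : n ≤ n ^ 3 := Nat.le_self_pow (by decide) n
  have h2 : n ^ 2 ≤ n ^ 3 := by
    rcases Nat.eq_zero_or_pos n with rfl | h
    · simp
    · exact Nat.pow_le_pow_right h (by decide)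
  simp only [mirrorPass, forwardPass, combinePass, stageA, stageB, saveLoop, clearLoop, startLoop,
    consumeLoop, advanceLoop, copyLoop, aboveLoop, lowLoop, highLoop, insideLoop, Prog.cost]
  linarith

/-- Every `push` and `single` lies within at most two nested loops. -/
theorem passes_alloc (n : ℕ) :
    mirrorPass.alloc n + forwardPass.alloc n + combinePass.alloc n ≤ 40 * (n ^ 2 + 1) := by
  have h1 : n ≤ n ^ 2 := Nat.le_self_pow (by decide) n
  simp only [mirrorPass, forwardPass, combinePass, stageA, stageB, saveLoop, clearLoop, startLoop,
    consumeLoop, advanceLoop, copyLoop, aboveLoop, lowLoop, highLoop, insideLoop, Prog.alloc]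
  linarith

theorem orientCmd_does (hn : I.n = n) (hM : n * n ≤ M) (hM' : n < M) (hord : ∀ r < n, ord r < n)
    (h : Core n K s σ) (ho : Ordered n ord σ) (neg : Bool) (hK : K + 40 * (n ^ 2 + 1) < M) :
    Does M I (orientCmd neg) σ (40200 * (n ^ 3 + 1)) fun τ =>
      Core n (K + 40 * (n ^ 2 + 1)) (orientEval n ((inputCols I ord).orient neg) s) τ ∧
        Ordered n ord τ := by
  obtain ⟨k1, k2, k3⟩ := passes_ok
  have hc := passes_cost n
  have ha := passes_alloc n
  have h1 : n ≤ n ^ 3 := Nat.le_self_pow (by decide) n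
  have hload := fun (s : St) (K : ℕ) (σ : Store 10) (h : Core n K s σ) (ho : Ordered n ord σ) =>
    loadCols_does (D := (inputCols I ord).orient neg) hn hM' hord h ho (i := .var 0)
      (by simp [Idx.Ok]) neg fun x _ => by cases neg <;> simp [Cols.orient, Cols.neg, inputCols, Idx.eval]
  refine Does.seq ((loadCols_does (D := ((inputCols I ord).orient neg).rev n) hn hM' hord h ho
    (i := .rev 0) (by simp [Idx.Ok]) neg fun x _ => ?_).mono le_rfl fun τ hτ => ?_)
    (T₂ := mirrorPass.cost n + (n * 60 + 10 + (forwardPass.cost n + combinePass.cost n))) (by omega)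
  · cases neg <;> simp [Cols.orient, Cols.neg, Cols.rev, inputCols, Idx.eval]
  refine Does.seq ((mirrorPass.compile_does hn hM k1 hτ (by omega)).mono le_rfl fun τ hτ => ?_)
    le_rfl
  refine Does.seq ((hload _ _ τ hτ.core hτ.ordered).mono le_rfl fun τ hτ => ?_) le_rfl
  refine Does.seq ((forwardPass.compile_does hn hM k2 hτ (by omega)).mono le_rfl fun τ hτ => ?_)
    le_rfl
  refine (combinePass.compile_does hn hM k3 hτ (by omega)).mono le_rfl fun τ hτ => ?_
  exact ⟨hτ.core.mono (by omega), hτ.ordered⟩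

/-- A nonempty set has its highest point not to the right of its lowest one, or this holds after
reflection. The second run starts from the best solution of the first and never loses value; the
empty set is beaten by the initial value. -/
theorem orientEval_spec {D : Cols} (hD : Distinct n D) (hs : IsSolution n D s.best)
    (h0 : 0 ≤ s.best.1) :
    IsSolution n D (orientEval n D.neg (orientEval n D s)).best ∧
      ∀ S : Finset ℕ, (∀ s ∈ S, s < n) →
        hull n D S ≤ (orientEval n D.neg (orientEval n D s)).best.1 := by
  have hneg : ∀ z, IsSolution n D.neg z ↔ IsSolution n D z := fun z => by
    simp only [IsSolution, hull_neg]; rfl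
  obtain ⟨a1, a2, a3⟩ := passes_spec (env := fun _ => 0) hD s hs
  obtain ⟨b1, b2, b3⟩ := passes_spec (env := fun _ => 0) hD.neg (orientEval n D s) ((hneg _).2 a1)
  refine ⟨(hneg _).1 b1, fun S hS => ?_⟩
  obtain rfl | hne := S.eq_empty_or_nonempty
  · exact hull_empty.trans_le (h0.trans (a2.trans b2))
  obtain ⟨b, hb, hmin⟩ := S.exists_min_image D.y hne
  obtain ⟨t, ht, hmax⟩ := S.exists_max_image D.y hne
  rcases le_total t b with h | h
  · exact (a3 S hS b hb t ht hmin hmax h).trans b2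
  -- In the reflected columns the lowest and the highest point exchange their roles.
  · rw [← hull_neg]
    exact b3 S hS t ht b hb (fun s hs => neg_le_neg (hmax s hs)) (fun s hs => neg_le_neg (hmin s hs)) h

/-- The initial state of the dynamic program. -/
def St.initial : St := ⟨none, fun _ _ _ => none, (0, ∅)⟩

theorem Core.initial (n : ℕ) : Core n 0 St.initial (Store.initial 10) := by
  constructor <;> simp [St.initial, Store.initial, decode, linkedSet]
  omega

theorem isSolution_initial (D : Cols) : IsSolution n D St.initial.best :=
  ⟨∅, by simp, by simp [hull_empty, St.initial]⟩

theorem maxWeightCmd_does (hn : I.n = n) (hM : 100 * (n ^ 2 + 1) ≤ M)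
    (hx : ∀ i < n, ∀ j < n, xCoord I i = xCoord I j → i = j)
    (hord : ∀ r < n, ord r < n ∧ rank I n (ord r) = r) :
    Does M I maxWeightCmd (Store.initial 10) (100000 * (n ^ 3 + 1)) fun τ =>
      τ.marked = (orientEval n (inputCols I ord).neg
        (orientEval n (inputCols I ord) St.initial)).best.2 := by
  have h1 : n ≤ n ^ 3 := Nat.le_self_pow (by decide) n
  have h2 : n ≤ n ^ 2 := Nat.le_self_pow (by decide) n
  have h3 : n ^ 2 ≤ n ^ 3 := by
    rcases Nat.eq_zero_or_pos n with rfl | h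
    · simp
    · exact Nat.pow_le_pow_right h (by decide)
  have h4 : n * n = n ^ 2 := (sq n).symm
  refine Does.seq ((sortCmd_does hn (by omega) (Core.initial n) hx).mono le_rfl fun τ hτ => ?_)
    (T₂ := 40200 * (n ^ 3 + 1) + (40200 * (n ^ 3 + 1) + (80 * (n ^ 2 + 1) * 24 + 10)))
    (by linarith)
  have ho : Ordered n ord τ := fun r hr => by
    simpa only [(hord r hr).2] using hτ.2 _ (hord r hr).1
  have hlt : ∀ r < n, ord r < n := fun r hr => (hord r hr).1
  refine Does.seq ((orientCmd_does hn (by omega) (by omega) hlt hτ.1 ho false (by omega)).mono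
    le_rfl fun τ hτ => ?_) le_rfl
  refine Does.seq ((orientCmd_does hn (by omega) (by omega) hlt hτ.1 hτ.2 true (by omega)).mono
    le_rfl fun τ hτ => ?_) le_rfl
  exact output_does (K := 80 * (n ^ 2 + 1)) hn (by omega) (hτ.1.mono (by omega))

end DP

open DP

/-! ### Correctness for the rectilinear convex hull -/

theorem mem_closure_quadrant {p q : ℝ × ℝ} :
    (q ∈ closure (quadrant 0 p) ↔ p.1 ≤ q.1 ∧ p.2 ≤ q.2) ∧
    (q ∈ closure (quadrant 1 p) ↔ q.1 ≤ p.1 ∧ p.2 ≤ q.2) ∧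
    (q ∈ closure (quadrant 2 p) ↔ q.1 ≤ p.1 ∧ q.2 ≤ p.2) ∧
    (q ∈ closure (quadrant 3 p) ↔ p.1 ≤ q.1 ∧ q.2 ≤ p.2) := by
  refine ⟨?_, ?_, ?_, ?_⟩
  · rw [show quadrant 0 p = Set.Ioi p.1 ×ˢ Set.Ioi p.2 from rfl, closure_prod_eq, closure_Ioi,
      closure_Ioi]; rfl
  · rw [show quadrant 1 p = Set.Iio p.1 ×ˢ Set.Ioi p.2 from rfl, closure_prod_eq, closure_Iio,
      closure_Ioi]; rfl
  · rw [show quadrant 2 p = Set.Iio p.1 ×ˢ Set.Iio p.2 from rfl, closure_prod_eq, closure_Iio,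
      closure_Iio]; rfl
  · rw [show quadrant 3 p = Set.Ioi p.1 ×ˢ Set.Iio p.2 from rfl, closure_prod_eq, closure_Ioi,
      closure_Iio]; rfl

theorem mem_rch {S : Set (ℝ × ℝ)} {q : ℝ × ℝ} :
    q ∈ rch S ↔ (∃ p ∈ S, p.1 ≤ q.1 ∧ p.2 ≤ q.2) ∧ (∃ p ∈ S, q.1 ≤ p.1 ∧ p.2 ≤ q.2) ∧
      (∃ p ∈ S, q.1 ≤ p.1 ∧ q.2 ≤ p.2) ∧ (∃ p ∈ S, p.1 ≤ q.1 ∧ q.2 ≤ p.2) := by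
  simp only [rch, quadrantUnion, Set.mem_iInter, Set.mem_iUnion, exists_prop]
  constructor
  · intro h
    exact ⟨by simpa only [mem_closure_quadrant.1] using h 0,
      by simpa only [mem_closure_quadrant.2.1] using h 1,
      by simpa only [mem_closure_quadrant.2.2.1] using h 2,
      by simpa only [mem_closure_quadrant.2.2.2] using h 3⟩
  · rintro ⟨h0, h1, h2, h3⟩ i
    match i with
    | 0 => simpa only [mem_closure_quadrant.1] using h0
    | 1 => simpa only [mem_closure_quadrant.2.1] using h1
    | 2 => simpa only [mem_closure_quadrant.2.2.1] using h2
    | 3 => simpa only [mem_closure_quadrant.2.2.2] using h3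

/-- The points with indices in `T`. -/
def pointSet {n : ℕ} (pts : Fin n → ℝ × ℝ) (T : Finset ℕ) : Set (ℝ × ℝ) :=
  {p | ∃ i : Fin n, (i : ℕ) ∈ T ∧ pts i = p}

theorem regionWeight_rch {n : ℕ} (pts : Fin n → ℝ × ℝ) (w : Fin n → ℝ) {ord : ℕ → ℕ}
    (hord : ∀ r < n, ord r < n) (hsurj : ∀ i < n, ∃ r < n, ord r = i)
    (hle : ∀ r < n, ∀ r' < n,
      (xCoord ⟨n, pts, w⟩ (ord r) ≤ xCoord ⟨n, pts, w⟩ (ord r') ↔ r ≤ r'))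
    {S : Finset ℕ} (hS : ∀ s ∈ S, s < n) :
    regionWeight pts w (rch (pointSet pts (S.image ord))) = hull n (inputCols ⟨n, pts, w⟩ ord) S := by
  have hex : ∀ P : ℝ × ℝ → Prop, (∃ p ∈ pointSet pts (S.image ord), P p) ↔
      ∃ s ∈ S, ∃ h : s < n, P (pts ⟨ord s, hord s h⟩) := by
    intro P
    constructor
    · rintro ⟨_, ⟨i, hi, rfl⟩, hp⟩
      obtain ⟨s, hs, hsi⟩ := Finset.mem_image.1 hi
      refine ⟨s, hs, hS s hs, ?_⟩
      convert hp
    · rintro ⟨s, hs, h, hp⟩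
      exact ⟨_, ⟨⟨ord s, hord s h⟩, Finset.mem_image_of_mem _ hs, rfl⟩, hp⟩
  have hxle : ∀ r (hr : r < n) r' (hr' : r' < n),
      (pts ⟨ord r, hord r hr⟩).1 ≤ (pts ⟨ord r', hord r' hr'⟩).1 ↔ r ≤ r' := by
    intro r hr r' hr'
    simpa only [xCoord, Input.read, hord r hr, hord r' hr', dif_pos] using hle r hr r' hr'
  have hmem : ∀ q (hq : q < n), pts ⟨ord q, hord q hq⟩ ∈ rch (pointSet pts (S.image ord)) ↔
      SW (inputCols ⟨n, pts, w⟩ ord) S q ∧ NW (inputCols ⟨n, pts, w⟩ ord) S q ∧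
      NE (inputCols ⟨n, pts, w⟩ ord) S q ∧ SE (inputCols ⟨n, pts, w⟩ ord) S q := by
    intro q hq
    have hy : ∀ s (hs : s < n), (inputCols ⟨n, pts, w⟩ ord).y s = (pts ⟨ord s, hord s hs⟩).2 :=
      fun s hs => by simp only [inputCols, Input.read, hord s hs, dif_pos]
    have ec : ∀ (A : ℕ → Prop) (B : (s : ℕ) → s < n → Prop), (∀ s (h : s < n), B s h ↔ A s) →
        ((∃ s ∈ S, ∃ h : s < n, B s h) ↔ ∃ s ∈ S, A s) := fun A B hAB =>
      exists_congr fun s => and_congr_right fun hs =>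
        ⟨fun ⟨h, hb⟩ => (hAB s h).1 hb, fun ha => ⟨hS s hs, (hAB s _).2 ha⟩⟩
    rw [mem_rch, hex, hex, hex, hex]
    rw [ec (fun s => s ≤ q ∧ (inputCols ⟨n, pts, w⟩ ord).y s ≤ (inputCols ⟨n, pts, w⟩ ord).y q),
      ec (fun s => q ≤ s ∧ (inputCols ⟨n, pts, w⟩ ord).y s ≤ (inputCols ⟨n, pts, w⟩ ord).y q),
      ec (fun s => q ≤ s ∧ (inputCols ⟨n, pts, w⟩ ord).y q ≤ (inputCols ⟨n, pts, w⟩ ord).y s),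
      ec (fun s => s ≤ q ∧ (inputCols ⟨n, pts, w⟩ ord).y q ≤ (inputCols ⟨n, pts, w⟩ ord).y s)]
    · unfold SW NW NE SE; tauto
    all_goals intro s hs; rw [hxle _ (by assumption) _ (by assumption), hy q hq, hy s hs]
  have hinj : ∀ r < n, ∀ r' < n, ord r = ord r' → r = r' := fun r hr r' hr' h =>
    le_antisymm ((hle r hr r' hr').1 (by rw [h])) ((hle r' hr' r hr).1 (by rw [h]))
  classical
  -- For the summation only the equivalence with membership matters, so the hull condition is
  -- replaced by a variable predicate.
  suffices ∀ p : ℕ → Prop, (∀ q (hq : q < n),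
      pts ⟨ord q, hord q hq⟩ ∈ rch (pointSet pts (S.image ord)) ↔ p q) →
      regionWeight pts w (rch (pointSet pts (S.image ord))) = wsum (inputCols ⟨n, pts, w⟩ ord) n p
    from this _ hmem
  intro p hmem
  unfold regionWeight wsum
  symm
  refine Finset.sum_bij (fun q hq => ⟨ord q, hord q (Finset.mem_range.1 (Finset.mem_filter.1 hq).1)⟩) ?_ ?_ ?_ ?_
  · intro q hq
    obtain ⟨hq, h⟩ := Finset.mem_filter.1 hq
    exact Finset.mem_filter.2 ⟨Finset.mem_univ _, (hmem q (Finset.mem_range.1 hq)).2 h⟩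
  · intro q hq q' hq' h
    exact hinj q (Finset.mem_range.1 (Finset.mem_filter.1 hq).1) q'
      (Finset.mem_range.1 (Finset.mem_filter.1 hq').1) (congrArg Fin.val h)
  · intro i hi
    obtain ⟨q, hq, hqi⟩ := hsurj i i.2
    obtain rfl : i = ⟨ord q, hord q hq⟩ := Fin.ext hqi.symm
    exact ⟨q, Finset.mem_filter.2 ⟨Finset.mem_range.2 hq, (hmem q hq).1 (Finset.mem_filter.1 hi).2⟩,
      rfl⟩
  · intro q hq
    have hq' := Finset.mem_range.1 (Finset.mem_filter.1 hq).1
    simp only [inputCols, Input.read, hord q hq', dif_pos]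

theorem isMaxWeightRCH_of_isSolution {n : ℕ} (pts : Fin n → ℝ × ℝ) (w : Fin n → ℝ) {ord : ℕ → ℕ}
    (hord : ∀ r < n, ord r < n) (hsurj : ∀ i < n, ∃ r < n, ord r = i)
    (hle : ∀ r < n, ∀ r' < n,
      (xCoord ⟨n, pts, w⟩ (ord r) ≤ xCoord ⟨n, pts, w⟩ (ord r') ↔ r ≤ r'))
    {z : ℝ × Finset ℕ} (hz : IsSolution n (inputCols ⟨n, pts, w⟩ ord) z)
    (hmax : ∀ S : Finset ℕ, (∀ s ∈ S, s < n) → hull n (inputCols ⟨n, pts, w⟩ ord) S ≤ z.1) :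
    IsMaxWeightRCH pts w (pointSet pts z.2) := by
  classical
  refine ⟨fun p ⟨i, _, hi⟩ => ⟨i, hi⟩, fun T hT => ?_⟩
  obtain ⟨S, hS, rfl⟩ := hz
  -- Every competitor is the point set of some set of columns, so the bound on `hull` applies to it.
  have hTS : T = pointSet pts
      (((Finset.range n).filter fun s => ∃ h : s < n, pts ⟨ord s, hord s h⟩ ∈ T).image ord) := by
    ext p
    constructor
    · intro hp
      obtain ⟨i, rfl⟩ := hT hp
      obtain ⟨s, hs, hsi⟩ := hsurj i i.2
      have hi' : i = ⟨ord s, hord s hs⟩ := Fin.ext hsi.symm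
      refine ⟨i, Finset.mem_image.2 ⟨s, ?_, hsi⟩, rfl⟩
      rw [Finset.mem_filter, Finset.mem_range]
      exact ⟨hs, hs, hi' ▸ hp⟩
    · rintro ⟨i, hi, rfl⟩
      obtain ⟨s, hs, hsi⟩ := Finset.mem_image.1 hi
      obtain ⟨h, hp⟩ := (Finset.mem_filter.1 hs).2
      have hi' : i = ⟨ord s, hord s h⟩ := Fin.ext hsi.symm
      exact hi' ▸ hp
  rw [hTS, regionWeight_rch pts w hord hsurj hle (by simp +contextual)]
  refine (hmax _ (by simp +contextual)).trans_eq ?_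
  exact (regionWeight_rch pts w hord hsurj hle hS).symm

end RealRAM

theorem mainTheorem4 :
    ∃ (k : ℕ) (prog : RealRAM.Cmd k) (C : ℕ),
      ∀ (n : ℕ) (pts : Fin n → ℝ × ℝ) (w : Fin n → ℝ), GeneralPosition pts →
        ∃ (M t : ℕ) (σ : RealRAM.Store k),
          M ≤ C * (n ^ 2 + 1) ∧
          RealRAM.numCells k M n ≤ C * (n ^ 2 + 1) ∧
          t ≤ C * (n ^ 3 + 1) ∧
          RealRAM.Run M ⟨n, pts, w⟩ prog (RealRAM.Store.initial k) t σ ∧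
          IsMaxWeightRCH pts w (σ.output ⟨n, pts, w⟩) := by
  open RealRAM RealRAM.DP in
  refine ⟨10, maxWeightCmd, 100000, fun n pts w hg => ?_⟩
  have hread : ∀ (f : Fin n → ℝ) (i : ℕ) (h : i < n),
      Input.read ⟨n, pts, w⟩ f i = f ⟨i, h⟩ := fun f i h => by simp [Input.read, h]
  have hx : ∀ i < n, ∀ j < n, xCoord ⟨n, pts, w⟩ i = xCoord ⟨n, pts, w⟩ j → i = j := by
    intro i hi j hj h
    rw [xCoord, xCoord, hread _ i hi, hread _ j hj] at h
    exact congrArg Fin.val (hg.1 h)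
  obtain ⟨ord, hord, hsurj, hle⟩ := exists_order hx
  have hlt : ∀ r < n, ord r < n := fun r hr => (hord r hr).1
  have hD : Distinct n (inputCols ⟨n, pts, w⟩ ord) := by
    intro i hi j hj h
    simp only [inputCols, hread _ _ (hlt i hi), hread _ _ (hlt j hj)] at h
    have : ord i = ord j := congrArg Fin.val (hg.2 h)
    rw [← (hord i hi).2, this, (hord j hj).2]
  obtain ⟨t, σ, hrun, ht, hσ⟩ := maxWeightCmd_does (I := ⟨n, pts, w⟩) rfl le_rfl hx hord
  obtain ⟨h1, h2⟩ := orientEval_spec hD (isSolution_initial _) le_rfl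
  have h3 : n ≤ n ^ 2 := Nat.le_self_pow (by decide) n
  -- The two runs allocate at most `80 * (n ^ 2 + 1)` list cells, and arrays of this length also
  -- hold the `n ^ 2` table entries.
  refine ⟨100 * (n ^ 2 + 1), t, σ, by omega, by unfold numCells; omega, ht, hrun, ?_⟩
  have hout : σ.output ⟨n, pts, w⟩ = pointSet pts σ.marked := rfl
  rw [hout, hσ]
  refine isMaxWeightRCH_of_isSolution pts w hlt hsurj hle h1 h2
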